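/- Let $M$ be a smooth manifold and $\pi:X\to M$ a smooth principal $\mathbb T^n$-bundle, $\mathbb T^n=\mathbb R^n/\mathbb Z^n$, with a principal connection $\Theta=(\Theta_I)$. Let $\{M_\alpha\}$ be an open cover of $M$ with equivariant fibre coordinates $\theta_\alpha:X_\alpha=\pi^{-1}(M_\alpha)\to\mathbb T^n$ that trivialise $X$ over $M_\alpha$ and satisfy $\theta_\alpha-\theta_\beta=-\lambda_{\alpha\beta}$ on $X_{\alpha\beta}=X_\alpha\cap X_\beta$, where $\lambda_{\alpha\beta}:M_{\alpha\beta}\to\mathbb T^n$. Let a gerbe with connection relative to the cover $\{X_\alpha\}$ be given: hermitian line bundles $L_{\alpha\beta}$ on $X_{\alpha\beta}$ with unitary connections $A_{\alpha\beta}$, with covariantly constant isomorphisms $L_{\beta\alpha}\cong L_{\alpha\beta}^{-1}$ and covariantly constant trivialisations $f_{\alpha\beta\gamma}$ of $L_{\alpha\beta}\otimes L_{\beta\gamma}\otimes L_{\gamma\alpha}$ that satisfy the cocycle condition on fourfold intersections, and smooth $2$-forms $B_\alpha$ on $X_\alpha$ with $B_\alpha-B_\beta=dA_{\alpha\beta}$.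 Suppose that every $B_\alpha$ is $\mathbb T^n$-invariant, and write $$B_\alpha=B_{2\alpha}+\langle B_{1\alpha},\Theta\rangle+\tfrac12\langle B_{0\alpha},\Theta\wedge\Theta\rangle$$ with $B_{2\alpha},B_{1\alpha},B_{0\alpha}$ pulled back from $M_\alpha$. Put $m_{\alpha\beta}=B_{0\alpha}-B_{0\beta}$. Let $p:Y\to X$ be the principal $\mathbb T^n$-bundle with fibre coordinates $\theta_{\#\alpha}$ over $X_\alpha$ that the gerbe connection defines by $\theta_{\#\alpha}-\theta_{\#\beta}=-\lambda_{\#\alpha\beta}$, where $\lambda^I_{\#\alpha\beta}(x)\in\mathbb R/\mathbb Z$ is $\frac1{2\pi i}\log$ of the holonomy of $A_{\alpha\beta}$ around the orbit of the $I$-th circle of $\mathbb T^n$ through $x$. Suppose that $m_{\alpha\beta}$ is a coboundary: $m_{\alpha\beta}=n_\alpha-n_\beta$ on $M_{\alpha\beta}$ for locally constant skew-symmetric integral matrices $n_\alpha$ on $M_\alpha$. Let $\tilde\theta_\alpha=\theta_{\#\alpha}-n_\alpha\theta_\alpha$, and let $B_{1\alpha}'$ be the $B_1$-component of $B_\alpha'=B_\alpha-\tfrac12\langle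 n_\alpha,d\theta_\alpha\wedge d\theta_\alpha\rangle$. (When $m_{\alpha\beta}=0$ one can take $n_\alpha=0$, and then $\tilde\theta_\alpha=\theta_{\#\alpha}$ and $B'_{1\alpha}=B_{1\alpha}$.) Then: 1. The function $\lambda_{\#\alpha\beta}+n_\alpha\theta_\alpha-n_\beta\theta_\beta$ on $X_{\alpha\beta}$ is the pull-back of a smooth function $\tilde h_{\alpha\beta}:M_{\alpha\beta}\to\mathbb T^n$. The form $B'_{1\alpha}$ is the pull-back of a smooth $\mathbb R^n$-valued $1$-form on $M_\alpha$, and $B'_{1\alpha}-B'_{1\beta}=d\tilde h_{\alpha\beta}$ on $M_{\alpha\beta}$. 2. $Y$ is a principal $\mathbb T^n\times\mathbb T^n$-bundle over $M$ with projection $\pi\circ p$ and fibre coordinates $(\theta_\alpha,\tilde\theta_\alpha)$, whose gluing functions are $\lambda_{\alpha\beta}$ and $\tilde h_{\alpha\beta}$: $$\theta_\alpha-\theta_\beta=-\lambda_{\alpha\beta},\qquad \tilde\theta_\alpha-\tilde\theta_\beta=-\tilde h_{\alpha\beta}.$$ The action of the second torus is that of the structure group of $p$, and the action of the first torus covers the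 given one on $X$. 3. The $1$-forms $\Theta_I$ (pulled back to $Y$) and $\tilde\Theta^I$, where $\tilde\Theta^I=d\tilde\theta^I_\alpha+B'^I_{1\alpha}$ over every $M_\alpha$, are globally defined on $Y$ and together form a principal connection on this $\mathbb T^n\times\mathbb T^n$-bundle. 4. There is a principal $\mathbb T^n$-bundle $\tilde X\to M$ with gluing functions $\tilde h_{\alpha\beta}$ such that $Y$ is the fibre product $X\times_M\tilde X$: there is a smooth map $q:Y\to\tilde X$ such that $(p,q)$ is a diffeomorphism of $Y$ onto $X\times_M\tilde X$ that is equivariant under $\mathbb T^n\times\mathbb T^n$ and carries the fibre coordinates to each other. -/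

import Mathlib

open scoped Manifold ContDiff Topology

universe uM

noncomputable section

namespace TorusGerbe

/-! ### Torus-valued functions and differential forms -/

/-- The torus `ℝ^J / ℤ^J`. -/
abbrev Torus (J : Type*) := J → UnitAddCircle

/-- The projection `ℝ^J → ℝ^J / ℤ^J`. -/
def toTorus {J : Type*} (t : J → ℝ) : Torus J := fun j => (t j : UnitAddCircle)

/-- Multiplication of a point of the torus by an integral matrix. -/
def matTorus {J : Type*} [Fintype J] (A : Matrix J J ℤ) (t : Torus J) : Torus J :=
  fun i => ∑ j, A i j • t j

section Manifold

variable (E : Type*) [NormedAddCommGroup E] [NormedSpace ℝ E]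
  {X : Type*} [TopologicalSpace X] [ChartedSpace E X]

/-- A map to `ℝ/ℤ` is smooth on the open set `S` if near every point of `S` it has a smooth
real-valued lift. -/
def SmoothCircleOn (f : X → UnitAddCircle) (S : Set X) : Prop :=
  ∀ x ∈ S, ∃ V : Set X, IsOpen V ∧ x ∈ V ∧ ∃ g : X → ℝ,
    ContMDiffOn 𝓘(ℝ, E) 𝓘(ℝ, ℝ) ∞ g V ∧ ∀ y ∈ V, f y = (g y : UnitAddCircle)

/-- `df = f'` at `x`, for a map `f` to `ℝ/ℤ`: some local real-valued lift of `f` has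
derivative `f'` at `x`.  (Two lifts that are continuous at `x` differ by a constant near `x`.) -/
def HasCircleDerivAt (f : X → UnitAddCircle) (x : X)
    (f' : TangentSpace 𝓘(ℝ, E) x →L[ℝ] ℝ) : Prop :=
  ∃ g : X → ℝ, (∀ᶠ y in 𝓝 x, f y = (g y : UnitAddCircle)) ∧
    HasMFDerivAt 𝓘(ℝ, E) 𝓘(ℝ, ℝ) g x f'

open Classical in
/-- The differential of a map to `ℝ/ℤ` (zero where there is none). -/
def circleDeriv (f : X → UnitAddCircle) (x : X) : TangentSpace 𝓘(ℝ, E) x →L[ℝ] ℝ :=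
  if h : ∃ f', HasCircleDerivAt E f x f' then h.choose else 0

variable (X)

/-- Real `1`-forms, without regularity. -/
abbrev OneForm := ∀ x : X, TangentSpace 𝓘(ℝ, E) x →L[ℝ] ℝ

/-- Bilinear forms on the tangent spaces; alternation is required separately. -/
abbrev TwoForm :=
  ∀ x : X, TangentSpace 𝓘(ℝ, E) x →L[ℝ] TangentSpace 𝓘(ℝ, E) x →L[ℝ] ℝ

variable {X}

/-- A `1`-form is smooth on the open set `S` if it is a smooth function on the part of the
tangent bundle that lies over `S`. -/
def OneForm.SmoothOn [IsManifold 𝓘(ℝ, E) ∞ X] (a : OneForm E X) (S : Set X) : Prop :=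
  ContMDiffOn 𝓘(ℝ, E).tangent 𝓘(ℝ, ℝ) ∞
    (fun v : TangentBundle 𝓘(ℝ, E) X => a v.1 v.2) {v | v.1 ∈ S}

/-- A `2`-form is smooth on `S` if it is a smooth section of `Hom(TX, Hom(TX, ℝ))` over `S`. -/
def TwoForm.SmoothOn [IsManifold 𝓘(ℝ, E) ∞ X] (b : TwoForm E X) (S : Set X) : Prop :=
  ContMDiffOn 𝓘(ℝ, E) (𝓘(ℝ, E).prod 𝓘(ℝ, E →L[ℝ] E →L[ℝ] ℝ)) ∞
    (fun x => Bundle.TotalSpace.mk' (E →L[ℝ] E →L[ℝ] ℝ)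
      (E := fun x : X => TangentSpace 𝓘(ℝ, E) x →L[ℝ] TangentSpace 𝓘(ℝ, E) x →L[ℝ] ℝ)
      x (b x)) S

/-- The derivative of the inverse of the chart at `x₀`. -/
def chartInvDeriv (x₀ : X) (z : E) :
    E →L[ℝ] TangentSpace 𝓘(ℝ, E) ((chartAt E x₀).symm z) :=
  mfderiv 𝓘(ℝ, E) 𝓘(ℝ, E) (chartAt E x₀).symm z

/-- The expression of a `1`-form in the chart at `x₀`. -/
def OneForm.inChart (a : OneForm E X) (x₀ : X) (z : E) : E →L[ℝ] ℝ :=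
  (a ((chartAt E x₀).symm z)).comp (chartInvDeriv E x₀ z)

/-- `da = b` on `S`: in every chart, `D_u (a v) - D_v (a u) = b (u, v)`. -/
def HasExtDerivOn (a : OneForm E X) (b : TwoForm E X) (S : Set X) : Prop :=
  ∀ x₀ : X, ∀ z ∈ (chartAt E x₀).target, (chartAt E x₀).symm z ∈ S → ∀ u v : E,
    fderiv ℝ (OneForm.inChart E a x₀) z u v - fderiv ℝ (OneForm.inChart E a x₀) z v u =
      b ((chartAt E x₀).symm z) (chartInvDeriv E x₀ z u) (chartInvDeriv E x₀ z v)

/-- The pull-back of a `1`-form along `f`. -/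
def OneForm.pullback {E' : Type*} [NormedAddCommGroup E'] [NormedSpace ℝ E']
    {X' : Type*} [TopologicalSpace X'] [ChartedSpace E' X']
    (f : X' → X) (a : OneForm E X) : OneForm E' X' :=
  fun x => (a (f x)).comp (mfderiv 𝓘(ℝ, E') 𝓘(ℝ, E) f x)

end Manifold

/-! ### Principal torus bundles -/

/-- A smooth principal bundle `X → M` with structure group the torus `ℝ^J / ℤ^J`, with fibre
coordinates `θ_α` over the members of the open cover `U` of `M`. -/
structure PrincipalTorusBundle (J : Type*) [Fintype J]
    (E : Type*) [NormedAddCommGroup E] [NormedSpace ℝ E]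
    (M : Type*) [TopologicalSpace M] [ChartedSpace E M]
    (E' : Type*) [NormedAddCommGroup E'] [NormedSpace ℝ E']
    (X : Type*) [TopologicalSpace X] [ChartedSpace E' X]
    {ι : Type*} (U : ι → Set M) where
  isOpen_cover : ∀ α, IsOpen (U α)
  cover : ∀ m : M, ∃ α, m ∈ U α
  /-- the projection `X → M` -/
  proj : X → M
  proj_smooth : ContMDiff 𝓘(ℝ, E') 𝓘(ℝ, E) ∞ proj
  /-- the action of the torus -/
  act : Torus J → X → X
  act_zero : ∀ x, act 0 x = x
  act_add : ∀ s t x, act (s + t) x = act s (act t x)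
  /-- the action is smooth; `ℝ^J → ℝ^J / ℤ^J` is a local diffeomorphism -/
  act_smooth : ContMDiff (𝓘(ℝ, J → ℝ).prod 𝓘(ℝ, E')) 𝓘(ℝ, E') ∞
    (fun p : (J → ℝ) × X => act (toTorus p.1) p.2)
  proj_act : ∀ t x, proj (act t x) = proj x
  /-- the fibre coordinate `θ_α`, meaningful over `U α` -/
  coord : ι → X → Torus J
  coord_smooth : ∀ α j, SmoothCircleOn E' (fun x => coord α x j) (proj ⁻¹' U α)
  coord_act : ∀ α t x, proj x ∈ U α → coord α (act t x) = t + coord α x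
  /-- `(proj, θ_α)` is injective over `U α` ... -/
  coord_inj : ∀ α x y, proj x ∈ U α → proj x = proj y → coord α x = coord α y → x = y
  /-- ... and there is a smooth section `θ_α = 0`; thus `(m, t) ↦ act t (σ m)` is the smooth
  inverse of `(proj, θ_α)`, which is an equivariant diffeomorphism onto `U α × ℝ^J / ℤ^J` -/
  exists_section : ∀ α, ∃ σ : M → X, ContMDiffOn 𝓘(ℝ, E) 𝓘(ℝ, E') ∞ σ (U α) ∧
    ∀ m ∈ U α, proj (σ m) = m ∧ coord α (σ m) = 0

namespace PrincipalTorusBundle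

variable {J : Type*} [Fintype J]
  {E : Type*} [NormedAddCommGroup E] [NormedSpace ℝ E]
  {M : Type*} [TopologicalSpace M] [ChartedSpace E M]
  {E' : Type*} [NormedAddCommGroup E'] [NormedSpace ℝ E']
  {X : Type*} [TopologicalSpace X] [ChartedSpace E' X]
  {ι : Type*} {U : ι → Set M}
  (P : PrincipalTorusBundle J E M E' X U)

/-- The bundle has gluing functions `lam`: `θ_α - θ_β = - lam_αβ` over `U α ∩ U β`. -/
def HasGluing (lam : ι → ι → M → Torus J) : Prop :=
  ∀ α β x, P.proj x ∈ U α → P.proj x ∈ U β →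
    P.coord α x - P.coord β x = - lam α β (P.proj x)

open Classical in
/-- The orbit `s ↦ (s e_j) • x` of the `j`-th circle; it is a loop of period `1`. -/
def orbit (j : J) (x : X) (s : ℝ) : X := P.act (toTorus (s • Pi.single j (1 : ℝ))) x

/-- The velocity of the orbit of the `j`-th circle at time `s`. -/
def orbitVelocity (j : J) (x : X) (s : ℝ) : TangentSpace 𝓘(ℝ, E') (P.orbit j x s) :=
  mfderiv 𝓘(ℝ, ℝ) 𝓘(ℝ, E') (P.orbit j x) s (1 : ℝ)

/-- The fundamental vector field `∂/∂θ_j`. -/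
def fund (j : J) (x : X) : TangentSpace 𝓘(ℝ, E') x := P.orbitVelocity j x 0

/-- The derivative of the translation by `t`. -/
def actDeriv (t : Torus J) (x : X) :
    TangentSpace 𝓘(ℝ, E') x →L[ℝ] TangentSpace 𝓘(ℝ, E') (P.act t x) :=
  mfderiv 𝓘(ℝ, E') 𝓘(ℝ, E') (P.act t) x

/-- A principal connection: a smooth invariant `1`-form with values in `ℝ^J` that takes the
value `e_j` on `∂/∂θ_j`. -/
structure IsConnection [IsManifold 𝓘(ℝ, E') ∞ X] (Θ : J → OneForm E' X) : Prop where
  smooth : ∀ j, OneForm.SmoothOn E' (Θ j) Set.univ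
  vertical_self : ∀ j x, Θ j x (P.fund j x) = 1
  vertical_ne : ∀ j k x, j ≠ k → Θ j x (P.fund k x) = 0
  invariant : ∀ j t x v, Θ j (P.act t x) (P.actDeriv t x v) = Θ j x v

end PrincipalTorusBundle

/-! ### Gerbes with connection -/

/-- A hermitian line bundle with unitary connection (a `1`-form gauge field) over the open subset
`W` of `X`, given by local frames: transition functions `trans i j`, written additively, and
connection forms `form i` with `form i - form j = d (trans i j)`. -/
structure LineBundleConn (E : Type*) [NormedAddCommGroup E] [NormedSpace ℝ E]
    (X : Type*) [TopologicalSpace X] [ChartedSpace E X] [IsManifold 𝓘(ℝ, E) ∞ X]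
    (W : Set X) where
  idx : Type
  dom : idx → Set X
  isOpen_dom : ∀ i, IsOpen (dom i)
  iUnion_dom : ⋃ i, dom i = W
  trans : idx → idx → X → UnitAddCircle
  trans_smooth : ∀ i j, SmoothCircleOn E (trans i j) (dom i ∩ dom j)
  trans_cocycle : ∀ i j k x, x ∈ dom i → x ∈ dom j → x ∈ dom k →
    trans i j x + trans j k x = trans i k x
  form : idx → OneForm E X
  form_smooth : ∀ i, OneForm.SmoothOn E (form i) (dom i)
  form_glue : ∀ i j x, x ∈ dom i → x ∈ dom j →
    HasCircleDerivAt E (trans i j) x (form i x - form j x)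

/-- `h` is `(2πi)⁻¹ log` of the holonomy of the connection around the curve `γ` on `[0, 1]`, where
`γ 0 = γ 1` and `γ'` is the velocity of `γ`.  The functions `u i` are the fibre coordinates of a
horizontal lift, `u i - u j = - trans i j` and `u i' = - form i (γ')`, and the lift starting at
`u i 0` ends at `u i 0 - h`; so `h = ∮ form i` when `γ` runs inside `dom i`. -/
def LineBundleConn.IsHolonomy {E : Type*} [NormedAddCommGroup E] [NormedSpace ℝ E]
    {X : Type*} [TopologicalSpace X] [ChartedSpace E X] [IsManifold 𝓘(ℝ, E) ∞ X]
    {W : Set X} (L : LineBundleConn E X W) (γ : ℝ → X)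
    (γ' : ∀ s, TangentSpace 𝓘(ℝ, E) (γ s)) (h : UnitAddCircle) : Prop :=
  ∃ u : L.idx → ℝ → UnitAddCircle,
    (∀ i j s, γ s ∈ L.dom i → γ s ∈ L.dom j → u i s - u j s = - L.trans i j (γ s)) ∧
    (∀ i s, γ s ∈ L.dom i → ∃ g : ℝ → ℝ, (∀ᶠ r in 𝓝 s, u i r = (g r : UnitAddCircle)) ∧
      HasDerivAt g (- L.form i (γ s) (γ' s)) s) ∧
    (∀ i, γ 0 ∈ L.dom i → u i 1 = u i 0 - h)

/-- A gerbe with connection relative to the open cover `W` of `X`: line bundles `L_αβ` with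
connection on `W α ∩ W β`; covariantly constant isomorphisms `e_αβ` between `L_βα` and the dual of
`L_αβ`; covariantly constant trivialisations `f_αβγ` of `L_αβ ⊗ L_βγ ⊗ L_γα`, subject to the
cocycle condition on fourfold intersections; and `2`-forms `B_α` with
`B_α - B_β = dA_αβ`.  Values in `U(1)` are written additively, in `ℝ/ℤ`. -/
structure GerbeConn (E : Type*) [NormedAddCommGroup E] [NormedSpace ℝ E]
    (X : Type*) [TopologicalSpace X] [ChartedSpace E X] [IsManifold 𝓘(ℝ, E) ∞ X]
    {ι : Type*} (W : ι → Set X) where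
  L : ∀ α β, LineBundleConn E X (W α ∩ W β)
  e : ∀ α β, (L α β).idx → (L β α).idx → X → UnitAddCircle
  e_symm : ∀ α β i j x, x ∈ (L α β).dom i → x ∈ (L β α).dom j → e α β i j x = e β α j i x
  e_glue : ∀ α β i i' j j' x, x ∈ (L α β).dom i → x ∈ (L α β).dom i' →
    x ∈ (L β α).dom j → x ∈ (L β α).dom j' →
    e α β i j x - e α β i' j' x = (L α β).trans i i' x + (L β α).trans j j' x
  e_const : ∀ α β i j x, x ∈ (L α β).dom i → x ∈ (L β α).dom j →
    HasCircleDerivAt E (e α β i j) x ((L α β).form i x + (L β α).form j x)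
  f : ∀ α β γ, (L α β).idx → (L β γ).idx → (L γ α).idx → X → UnitAddCircle
  f_glue : ∀ α β γ i i' j j' k k' x, x ∈ (L α β).dom i → x ∈ (L α β).dom i' →
    x ∈ (L β γ).dom j → x ∈ (L β γ).dom j' → x ∈ (L γ α).dom k → x ∈ (L γ α).dom k' →
    f α β γ i j k x - f α β γ i' j' k' x =
      (L α β).trans i i' x + (L β γ).trans j j' x + (L γ α).trans k k' x
  f_const : ∀ α β γ i j k x,
    x ∈ (L α β).dom i → x ∈ (L β γ).dom j → x ∈ (L γ α).dom k →
    HasCircleDerivAt E (f α β γ i j k) x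
      ((L α β).form i x + (L β γ).form j x + (L γ α).form k x)
  /-- `f_αβγ f_βγδ⁻¹ f_γδα f_δαβ⁻¹ = 1`, where `L_γα ⊗ L_αγ` and `L_δβ ⊗ L_βδ` are trivialised
  by `e` -/
  f_cocycle : ∀ α β γ δ i j k l m q r s x,
    x ∈ (L α β).dom i → x ∈ (L β γ).dom j → x ∈ (L γ α).dom k → x ∈ (L γ δ).dom l →
    x ∈ (L δ β).dom m → x ∈ (L δ α).dom q → x ∈ (L α γ).dom r → x ∈ (L β δ).dom s →
    f α β γ i j k x - f β γ δ j l m x + f γ δ α l q r x - f δ α β q i s x =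
      e γ α k r x - e δ β m s x
  B : ι → TwoForm E X
  B_alt : ∀ α, ∀ x ∈ W α, ∀ v, B α x v v = 0
  B_smooth : ∀ α, TwoForm.SmoothOn E (B α) (W α)
  B_glue : ∀ α β i, HasExtDerivOn E ((L α β).form i) (fun x => B α x - B β x) ((L α β).dom i)

section Reduction

variable {J : Type*} [Fintype J]
  {E : Type*} [NormedAddCommGroup E] [NormedSpace ℝ E]
  {M : Type*} [TopologicalSpace M] [ChartedSpace E M]
  {E' : Type*} [NormedAddCommGroup E'] [NormedSpace ℝ E']
  {X : Type*} [TopologicalSpace X] [ChartedSpace E' X]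
  {ι : Type*} {U : ι → Set M}

/-- The torus-invariance of the gerbe connection, `act_t^* B_α = B_α`. -/
def GerbeConn.Invariant [IsManifold 𝓘(ℝ, E') ∞ X] (P : PrincipalTorusBundle J E M E' X U)
    (G : GerbeConn E' X (fun α => P.proj ⁻¹' U α)) : Prop :=
  ∀ α t x, P.proj x ∈ U α → ∀ u v,
    G.B α (P.act t x) (P.actDeriv t x u) (P.actDeriv t x v) = G.B α x u v

/-- The component `B₀^{IJ}` of `B = B₂ + ⟨B₁, Θ⟩ + ½ ⟨B₀, Θ ∧ Θ⟩`, with `B₂`, `B₁` horizontal: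
`B₀^{IJ} = B (∂/∂θ_I, ∂/∂θ_J)`. -/
def compZero (P : PrincipalTorusBundle J E M E' X U) (b : TwoForm E' X) (x : X) :
    Matrix J J ℝ :=
  Matrix.of fun i j => b x (P.fund i x) (P.fund j x)

/-- The component `B₁^I` of `B = B₂ + ⟨B₁, Θ⟩ + ½ ⟨B₀, Θ ∧ Θ⟩`, as a horizontal form on `X`:
`B₁^I = - B (∂/∂θ_I, ·) + ∑_J B₀^{IJ} Θ_J`. -/
def compOne (P : PrincipalTorusBundle J E M E' X U) (Θ : J → OneForm E' X) (b : TwoForm E' X)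
    (i : J) : OneForm E' X :=
  fun x => - b x (P.fund i x) + ∑ j, compZero P b x i j • Θ j x

/-- The `2`-form `½ ∑ n^{IJ} dθ_{αI} ∧ dθ_{αJ}` over `U α`, for a skew-symmetric locally constant
integral matrix `n` on `U α`. -/
def torusTwoForm (P : PrincipalTorusBundle J E M E' X U) (α : ι) (n : M → Matrix J J ℤ) :
    TwoForm E' X :=
  fun x => ∑ i, ∑ j, (n (P.proj x) i j : ℝ) •
    (circleDeriv E' (fun y => P.coord α y i) x).smulRight
      (circleDeriv E' (fun y => P.coord α y j) x)

/-- The curvings `B_α - ½ ⟨n_α, dθ_α ∧ dθ_α⟩`. -/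
def shiftedB [IsManifold 𝓘(ℝ, E') ∞ X] (P : PrincipalTorusBundle J E M E' X U)
    (G : GerbeConn E' X (fun α => P.proj ⁻¹' U α)) (n : ι → M → Matrix J J ℤ) (α : ι) :
    TwoForm E' X :=
  fun x => G.B α x - torusTwoForm P α (n α) x

/-- The cocycle `m_αβ = B₀_α - B₀_β` is the coboundary of the cochain `n` of locally constant
skew-symmetric integral matrices. -/
structure IsCoboundary [IsManifold 𝓘(ℝ, E') ∞ X] (P : PrincipalTorusBundle J E M E' X U)
    (G : GerbeConn E' X (fun α => P.proj ⁻¹' U α)) (n : ι → M → Matrix J J ℤ) : Prop where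
  locally_const : ∀ α, ∀ m ∈ U α, ∀ᶠ m' in 𝓝 m, n α m' = n α m
  skew : ∀ α, ∀ m ∈ U α, (n α m).transpose = - n α m
  coboundary : ∀ α β x, P.proj x ∈ U α → P.proj x ∈ U β →
    compZero P (G.B α) x - compZero P (G.B β) x =
      (n α (P.proj x) - n β (P.proj x)).map (fun k : ℤ => (k : ℝ))

/-- `p : Y → X` is the principal torus bundle defined by the gerbe connection.  Its gluing functions
`lamS_αβ^I(x)` are the holonomies of `L_αβ` around the orbits of the circles
`∂/∂θ_I` through `x`. -/
structure IsCorrespondence [IsManifold 𝓘(ℝ, E') ∞ X] (P : PrincipalTorusBundle J E M E' X U)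
    (G : GerbeConn E' X (fun α => P.proj ⁻¹' U α))
    {E'' : Type*} [NormedAddCommGroup E''] [NormedSpace ℝ E'']
    {Y : Type*} [TopologicalSpace Y] [ChartedSpace E'' Y]
    (Q : PrincipalTorusBundle J E' X E'' Y (fun α => P.proj ⁻¹' U α))
    (lamS : ι → ι → X → Torus J) : Prop where
  gluing : Q.HasGluing lamS
  holonomy : ∀ α β x, P.proj x ∈ U α → P.proj x ∈ U β → ∀ i,
    (G.L α β).IsHolonomy (P.orbit i x) (P.orbitVelocity i x) (lamS α β x i)

end Reduction

/-- `Y`, with the maps `p : Y → X` and `q : Y → X'`, is the fibre product of `π : X → M` and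
`π' : X' → M`: the map `(p, q)` is a smooth bijection onto `{(x, x') | π x = π' x'}` with smooth
inverse. -/
def IsFibreProduct {M : Type*}
    {E₁ : Type*} [NormedAddCommGroup E₁] [NormedSpace ℝ E₁]
    {X : Type*} [TopologicalSpace X] [ChartedSpace E₁ X]
    {E₂ : Type*} [NormedAddCommGroup E₂] [NormedSpace ℝ E₂]
    {X' : Type*} [TopologicalSpace X'] [ChartedSpace E₂ X']
    {E₃ : Type*} [NormedAddCommGroup E₃] [NormedSpace ℝ E₃]
    {Y : Type*} [TopologicalSpace Y] [ChartedSpace E₃ Y]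
    (π : X → M) (π' : X' → M) (p : Y → X) (q : Y → X') : Prop :=
  ContMDiff 𝓘(ℝ, E₃) 𝓘(ℝ, E₁) ∞ p ∧ ContMDiff 𝓘(ℝ, E₃) 𝓘(ℝ, E₂) ∞ q ∧
  (∀ y, π (p y) = π' (q y)) ∧
  ∃ r : X × X' → Y,
    ContMDiffOn (𝓘(ℝ, E₁).prod 𝓘(ℝ, E₂)) 𝓘(ℝ, E₃) ∞ r {z | π z.1 = π' z.2} ∧
    (∀ z, π z.1 = π' z.2 → p (r z) = z.1 ∧ q (r z) = z.2) ∧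
    ∀ y, r (p y, q y) = y

end TorusGerbe

end

open TorusGerbe

/-! The heart of the matter is a formula for the differential of the holonomy. Let the orbits of the
`I`-th circle through the points of a curve sweep out a surface. By Stokes, the holonomy of `L_αβ`
varies at the rate given by integrating its curvature `B_α - B_β` along one orbit, evaluated on the
variation field and the generator `∂_I`. Invariance of the curvings makes the integrand constant, so
the integral disappears and `dλ_#αβ^I = -ι_I (B_α - B_β)`. This is `circleDeriv_holonomy`.

Write `B'_1^I = -ι_I B' + ∑ B'_0^{IJ} Θ_J` for the shifted curvings. The coboundary condition says
precisely that `B'_0` agrees over `U α` and `U β`, so the `Θ`-terms cancel in the difference. The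
remaining terms are `dλ_#αβ` and the differentials of `n_α θ_α` and `n_β θ_β`, whence `d(λ_#αβ + n_α
θ_α - n_β θ_β) = B'_1α - B'_1β` on `X` (`hasCircleDerivAt_dualGluing`). The form `B'_1` is
horizontal and invariant, so it is the pull-back of its own restriction to a local section
(`apply_eq_apply_sect`). A circle-valued function with horizontal differential is constant on the
connected fibres, so the modified gluing function descends to a function `h` on the base
(`dualGluing_eq`).

The rest is formal. Since `θ̃_α - θ̃_β = -h_αβ` depends on the base point only, translating `(θ_α,
θ̃_α)` means the same for every `α`, and this defines the action of the double torus
(`doubleAct_eq`). In the coordinates of `p` the first torus moves `θ_#α` by `n_α s`. The local forms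
`dθ̃_α + B'_1α` agree on overlaps because the change of `B'_1` cancels `dh` (`connForm_eq`). The
functions `h` inherit the cocycle identity from the coordinates on `Y`, hence glue a torus bundle
over the base (`TorusCocycle.bundle`). The map `q` is determined by having fibre coordinate `θ̃_α`,
and `(p, q)` is inverted by recovering `θ_#α = θ̃_α + n_α θ_α` (`isFibreProduct_dualMap`). -/

namespace TorusGerbe

/-! ### Maps to the circle -/

section Circle

theorem circle_norm_coe_le (r : ℝ) : ‖(r : UnitAddCircle)‖ ≤ |r| := by
  rw [UnitAddCircle.norm_eq]
  simpa using round_le r 0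

theorem circle_coe_surjective (c : UnitAddCircle) : ∃ r : ℝ, (r : UnitAddCircle) = c :=
  QuotientAddGroup.mk_surjective c

theorem exists_int_of_circle_coe_eq {a b : ℝ} (h : (a : UnitAddCircle) = b) :
    ∃ k : ℤ, a - b = k := by
  have h0 : ((a - b : ℝ) : UnitAddCircle) = 0 := by rw [AddCircle.coe_sub, h, sub_self]
  obtain ⟨k, hk⟩ := (AddCircle.coe_eq_zero_iff (1 : ℝ)).1 h0
  exact ⟨k, by simpa using hk.symm⟩

/-- Two continuous lifts of a map to the circle differ by a constant. -/
theorem eventually_sub_eq_of_lifts {Z : Type*} [TopologicalSpace Z] {g g' : Z → ℝ} {z : Z}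
    (hg : ContinuousAt g z) (hg' : ContinuousAt g' z)
    (h : ∀ᶠ y in 𝓝 z, (g y : UnitAddCircle) = g' y) :
    ∀ᶠ y in 𝓝 z, g y = g' y + (g z - g' z) := by
  have hc : ContinuousAt (fun y => g y - g' y) z := hg.sub hg'
  -- The difference of the lifts takes integral values near `z`, so staying within distance `1` of
  -- its value at `z` forces equality.
  have h1 : ∀ᶠ y in 𝓝 z, |(g y - g' y) - (g z - g' z)| < 1 := by
    have := Metric.continuousAt_iff'.1 hc 1 one_pos
    simpa only [Real.dist_eq] using this
  obtain ⟨k, hk⟩ := exists_int_of_circle_coe_eq h.self_of_nhds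
  filter_upwards [h, h1] with y hy hy1
  obtain ⟨l, hl⟩ := exists_int_of_circle_coe_eq hy
  rw [hl, hk, ← Int.cast_sub, ← Int.cast_abs] at hy1
  have : |l - k| < 1 := by exact_mod_cast hy1
  have : l = k := by
    have := Int.abs_lt_one_iff.1 this
    omega
  subst this
  linarith

end Circle

/-! ### Differentials of circle-valued functions -/

section Deriv

variable {E : Type*} [NormedAddCommGroup E] [NormedSpace ℝ E]
  {X : Type*} [TopologicalSpace X] [ChartedSpace E X]
  {E' : Type*} [NormedAddCommGroup E'] [NormedSpace ℝ E']
  {X' : Type*} [TopologicalSpace X'] [ChartedSpace E' X']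

/-- Two differentiable lifts differ by a constant near `x`. This makes the choice in `circleDeriv`
harmless, and it is the means by which differentials are later computed: exhibit two of them and
compare. -/
theorem HasCircleDerivAt.unique {f : X → UnitAddCircle} {x : X}
    {f' f'' : TangentSpace 𝓘(ℝ, E) x →L[ℝ] ℝ}
    (h : HasCircleDerivAt E f x f') (h' : HasCircleDerivAt E f x f'') : f' = f'' := by
  obtain ⟨g, hg, hgd⟩ := h
  obtain ⟨k, hk, hkd⟩ := h'
  have e := eventually_sub_eq_of_lifts hgd.continuousAt hkd.continuousAt
    (by filter_upwards [hg, hk] with y h1 h2; rw [← h1, h2])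
  have h2 : HasMFDerivAt 𝓘(ℝ, E) 𝓘(ℝ, ℝ) (k + fun _ => (g x - k x)) x f'' := by
    have h0 : HasMFDerivAt 𝓘(ℝ, E) 𝓘(ℝ, ℝ) (fun _ : X => g x - k x) x
        (0 : TangentSpace 𝓘(ℝ, E) x →L[ℝ] ℝ) := hasMFDerivAt_const (I := 𝓘(ℝ, E)) (g x - k x) x
    have h1 := HasMFDerivAt.add hkd h0
    exact h1.congr_mfderiv (add_zero _)
  have h3 := h2.congr_of_eventuallyEq (f₁ := g) e
  exact hasMFDerivAt_unique hgd h3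

theorem HasCircleDerivAt.circleDeriv_eq {f : X → UnitAddCircle} {x : X}
    {f' : TangentSpace 𝓘(ℝ, E) x →L[ℝ] ℝ} (h : HasCircleDerivAt E f x f') :
    circleDeriv E f x = f' := by
  have hex : ∃ f', HasCircleDerivAt E f x f' := ⟨f', h⟩
  rw [circleDeriv, dif_pos hex]
  exact hex.choose_spec.unique h

theorem HasCircleDerivAt.congr {f f₁ : X → UnitAddCircle} {x : X}
    {f' : TangentSpace 𝓘(ℝ, E) x →L[ℝ] ℝ} (h : HasCircleDerivAt E f x f')
    (h₁ : ∀ᶠ y in 𝓝 x, f₁ y = f y) : HasCircleDerivAt E f₁ x f' := by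
  obtain ⟨g, hg, hgd⟩ := h
  exact ⟨g, by filter_upwards [hg, h₁] with y h1 h2; rw [h2, h1], hgd⟩

theorem HasCircleDerivAt.congr_deriv {f : X → UnitAddCircle} {x : X}
    {f' f'' : TangentSpace 𝓘(ℝ, E) x →L[ℝ] ℝ} (h : HasCircleDerivAt E f x f')
    (h₁ : f' = f'') : HasCircleDerivAt E f x f'' := h₁ ▸ h

theorem HasCircleDerivAt.add {f k : X → UnitAddCircle} {x : X}
    {f' k' : TangentSpace 𝓘(ℝ, E) x →L[ℝ] ℝ} (h : HasCircleDerivAt E f x f')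
    (h' : HasCircleDerivAt E k x k') : HasCircleDerivAt E (fun y => f y + k y) x (f' + k') := by
  obtain ⟨g, hg, hgd⟩ := h
  obtain ⟨l, hl, hld⟩ := h'
  refine ⟨g + l, ?_, hgd.add hld⟩
  filter_upwards [hg, hl] with y h1 h2
  rw [h1, h2, Pi.add_apply, AddCircle.coe_add]

theorem HasCircleDerivAt.neg {f : X → UnitAddCircle} {x : X}
    {f' : TangentSpace 𝓘(ℝ, E) x →L[ℝ] ℝ} (h : HasCircleDerivAt E f x f') :
    HasCircleDerivAt E (fun y => - f y) x (-f') := by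
  obtain ⟨g, hg, hgd⟩ := h
  refine ⟨-g, ?_, hgd.neg⟩
  filter_upwards [hg] with y h1
  rw [h1, Pi.neg_apply, AddCircle.coe_neg]

theorem HasCircleDerivAt.sub {f k : X → UnitAddCircle} {x : X}
    {f' k' : TangentSpace 𝓘(ℝ, E) x →L[ℝ] ℝ} (h : HasCircleDerivAt E f x f')
    (h' : HasCircleDerivAt E k x k') : HasCircleDerivAt E (fun y => f y - k y) x (f' - k') := by
  simpa only [sub_eq_add_neg] using h.add h'.neg

theorem hasCircleDerivAt_const (c : UnitAddCircle) (x : X) :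
    HasCircleDerivAt E (fun _ : X => c) x 0 := by
  obtain ⟨r, rfl⟩ := circle_coe_surjective c
  exact ⟨fun _ => r, Filter.Eventually.of_forall fun _ => rfl, hasMFDerivAt_const (I := 𝓘(ℝ, E)) r x⟩

theorem HasCircleDerivAt.zsmul {f : X → UnitAddCircle} {x : X}
    {f' : TangentSpace 𝓘(ℝ, E) x →L[ℝ] ℝ} (h : HasCircleDerivAt E f x f') (m : ℤ) :
    HasCircleDerivAt E (fun y => m • f y) x ((m : ℝ) • f') := by
  obtain ⟨g, hg, hgd⟩ := h
  refine ⟨(m : ℝ) • g, ?_, hgd.const_smul (m : ℝ)⟩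
  filter_upwards [hg] with y h1
  rw [h1, Pi.smul_apply, ← AddCircle.coe_zsmul]
  simp

theorem HasCircleDerivAt.sum {κ : Type*} (s : Finset κ) {f : κ → X → UnitAddCircle} {x : X}
    {f' : κ → TangentSpace 𝓘(ℝ, E) x →L[ℝ] ℝ} (h : ∀ k ∈ s, HasCircleDerivAt E (f k) x (f' k)) :
    HasCircleDerivAt E (fun y => ∑ k ∈ s, f k y) x (∑ k ∈ s, f' k) := by
  classical
  induction s using Finset.induction_on with
  | empty => simpa using hasCircleDerivAt_const (E := E) 0 x
  | insert a s ha ih =>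
    simp only [Finset.sum_insert ha]
    exact (h a (Finset.mem_insert_self _ _)).add
      (ih fun k hk => h k (Finset.mem_insert_of_mem hk))

theorem HasCircleDerivAt.comp {f : X → UnitAddCircle} {c : X' → X} {z : X'}
    {f' : TangentSpace 𝓘(ℝ, E) (c z) →L[ℝ] ℝ}
    {c' : TangentSpace 𝓘(ℝ, E') z →L[ℝ] TangentSpace 𝓘(ℝ, E) (c z)}
    (h : HasCircleDerivAt E f (c z) f') (hc : HasMFDerivAt 𝓘(ℝ, E') 𝓘(ℝ, E) c z c') :
    HasCircleDerivAt E' (fun y => f (c y)) z (f'.comp c') := by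
  obtain ⟨g, hg, hgd⟩ := h
  exact ⟨g ∘ c, hc.continuousAt.eventually hg, HasMFDerivAt.comp z hgd hc⟩

/-- A circle-valued function on a convex open set of a normed space is constant if its
differential vanishes. -/
theorem eq_of_hasCircleDerivAt_zero {f : E → UnitAddCircle} {S : Set E} (hS : IsOpen S)
    (hS' : Convex ℝ S) (h : ∀ x ∈ S, HasCircleDerivAt E f x 0) {a b : E} (ha : a ∈ S)
    (hb : b ∈ S) : f a = f b := by
  -- This avoids a global lift of `f`. The quotient norm is bounded by the absolute value of a lift,
  -- so the distance to `f b` is a real function whose increments are dominated by those of a local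
  -- lift; it has zero derivative, hence is constant, and it vanishes at `b`.
  have hd : ∀ x ∈ S, HasFDerivAt (fun y => ‖f y - f b‖) (0 : E →L[ℝ] ℝ) x := by
    intro x hx
    obtain ⟨g, hg, hgd⟩ := h x hx
    have hgd : HasFDerivAt g (0 : E →L[ℝ] ℝ) x := hasMFDerivAt_iff_hasFDerivAt.1 hgd
    rw [hasFDerivAt_iff_isLittleO_nhds_zero] at hgd ⊢
    refine Asymptotics.IsBigO.trans_isLittleO ?_ hgd
    refine Asymptotics.IsBigO.of_bound 1 ?_
    have hg' : ∀ᶠ v in 𝓝 (0 : E), f (x + v) = g (x + v) := by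
      have : Filter.Tendsto (fun v : E => x + v) (𝓝 0) (𝓝 x) :=
        (by fun_prop : Continuous fun v : E => x + v).tendsto' 0 x (add_zero x)
      exact this.eventually hg
    filter_upwards [hg'] with v hv
    have e1 : ‖‖f (x + v) - f b‖ - ‖f x - f b‖‖ ≤ ‖f (x + v) - f x‖ := by
      have := abs_norm_sub_norm_le (f (x + v) - f b) (f x - f b)
      simpa using this
    have e2 : ‖f (x + v) - f x‖ ≤ |g (x + v) - g x| := by
      rw [hv, hg.self_of_nhds, ← AddCircle.coe_sub]
      exact circle_norm_coe_le _
    have e3 : (0 : E →L[ℝ] ℝ) v = 0 := rfl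
    change ‖‖f (x + v) - f b‖ - ‖f x - f b‖ - (0 : E →L[ℝ] ℝ) v‖ ≤
      1 * ‖g (x + v) - g x - (0 : E →L[ℝ] ℝ) v‖
    rw [e3, sub_zero, sub_zero, one_mul]
    exact e1.trans e2
  have := hS'.is_const_of_fderivWithin_eq_zero (𝕜 := ℝ) (f := fun y => ‖f y - f b‖)
    (fun x hx => (hd x hx).differentiableAt.differentiableWithinAt)
    (fun x hx => by rw [fderivWithin_of_isOpen hS hx, (hd x hx).fderiv]) ha hb
  simp only [sub_self, norm_zero, norm_eq_zero] at this
  exact sub_eq_zero.1 this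

end Deriv

/-! ### Pointwise smoothness of circle-valued functions -/

section Smooth

variable {F : Type*} [NormedAddCommGroup F] [NormedSpace ℝ F] {H : Type*} [TopologicalSpace H]
  {I : ModelWithCorners ℝ F H} {Z : Type*} [TopologicalSpace Z] [ChartedSpace H Z]
  {F' : Type*} [NormedAddCommGroup F'] [NormedSpace ℝ F'] {H' : Type*} [TopologicalSpace H']
  {I' : ModelWithCorners ℝ F' H'} {Z' : Type*} [TopologicalSpace Z'] [ChartedSpace H' Z']

/-- A map to `ℝ/ℤ` that has near `z` a real-valued lift that is smooth at `z`. -/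
def SmoothCircleAt (I : ModelWithCorners ℝ F H) (f : Z → UnitAddCircle) (z : Z) : Prop :=
  ∃ g : Z → ℝ, ContMDiffAt I 𝓘(ℝ, ℝ) ∞ g z ∧ ∀ᶠ y in 𝓝 z, f y = (g y : UnitAddCircle)

theorem SmoothCircleAt.congr {f f₁ : Z → UnitAddCircle} {z : Z} (h : SmoothCircleAt I f z)
    (h₁ : ∀ᶠ y in 𝓝 z, f₁ y = f y) : SmoothCircleAt I f₁ z := by
  obtain ⟨g, hg, hf⟩ := h
  exact ⟨g, hg, by filter_upwards [hf, h₁] with y h1 h2; rw [h2, h1]⟩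

theorem SmoothCircleAt.comp {f : Z → UnitAddCircle} {c : Z' → Z} {z : Z'}
    (h : SmoothCircleAt I f (c z)) (hc : ContMDiffAt I' I ∞ c z) :
    SmoothCircleAt I' (fun y => f (c y)) z := by
  obtain ⟨g, hg, hf⟩ := h
  exact ⟨g ∘ c, hg.comp z hc, hc.continuousAt.eventually hf⟩

theorem smoothCircleAt_coe {g : Z → ℝ} {z : Z} (h : ContMDiffAt I 𝓘(ℝ, ℝ) ∞ g z) :
    SmoothCircleAt I (fun y => (g y : UnitAddCircle)) z :=
  ⟨g, h, Filter.Eventually.of_forall fun _ => rfl⟩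

theorem smoothCircleAt_const (c : UnitAddCircle) (z : Z) :
    SmoothCircleAt I (fun _ : Z => c) z := by
  obtain ⟨r, rfl⟩ := circle_coe_surjective c
  exact smoothCircleAt_coe contMDiffAt_const

theorem SmoothCircleAt.add {f k : Z → UnitAddCircle} {z : Z} (h : SmoothCircleAt I f z)
    (h' : SmoothCircleAt I k z) : SmoothCircleAt I (fun y => f y + k y) z := by
  obtain ⟨g, hg, hf⟩ := h
  obtain ⟨l, hl, hk⟩ := h'
  refine ⟨fun y => g y + l y, hg.add hl, ?_⟩
  filter_upwards [hf, hk] with y h1 h2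
  rw [h1, h2, AddCircle.coe_add]

theorem SmoothCircleAt.neg {f : Z → UnitAddCircle} {z : Z} (h : SmoothCircleAt I f z) :
    SmoothCircleAt I (fun y => - f y) z := by
  obtain ⟨g, hg, hf⟩ := h
  refine ⟨fun y => - g y, hg.neg, ?_⟩
  filter_upwards [hf] with y h1
  rw [h1, AddCircle.coe_neg]

theorem SmoothCircleAt.sub {f k : Z → UnitAddCircle} {z : Z} (h : SmoothCircleAt I f z)
    (h' : SmoothCircleAt I k z) : SmoothCircleAt I (fun y => f y - k y) z := by
  simpa only [sub_eq_add_neg] using h.add h'.neg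

theorem SmoothCircleAt.zsmul {f : Z → UnitAddCircle} {z : Z} (h : SmoothCircleAt I f z) (m : ℤ) :
    SmoothCircleAt I (fun y => m • f y) z := by
  obtain ⟨g, hg, hf⟩ := h
  refine ⟨fun y => (m : ℝ) * g y, contMDiffAt_const.mul hg, ?_⟩
  filter_upwards [hf] with y h1
  rw [h1, ← AddCircle.coe_zsmul]
  simp

theorem SmoothCircleAt.sum {κ : Type*} (s : Finset κ) {f : κ → Z → UnitAddCircle} {z : Z}
    (h : ∀ k ∈ s, SmoothCircleAt I (f k) z) : SmoothCircleAt I (fun y => ∑ k ∈ s, f k y) z := by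
  classical
  induction s using Finset.induction_on with
  | empty => simpa using smoothCircleAt_const (I := I) 0 z
  | insert a s ha ih =>
    simp only [Finset.sum_insert ha]
    exact (h a (Finset.mem_insert_self _ _)).add
      (ih fun k hk => h k (Finset.mem_insert_of_mem hk))

variable {E : Type*} [NormedAddCommGroup E] [NormedSpace ℝ E]
  {X : Type*} [TopologicalSpace X] [ChartedSpace E X]

theorem SmoothCircleOn.smoothCircleAt {f : X → UnitAddCircle} {S : Set X}
    (h : SmoothCircleOn E f S) {x : X} (hx : x ∈ S) : SmoothCircleAt 𝓘(ℝ, E) f x := by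
  obtain ⟨V, hV, hxV, g, hg, hf⟩ := h x hx
  exact ⟨g, hg.contMDiffAt (hV.mem_nhds hxV), Filter.eventually_of_mem (hV.mem_nhds hxV) hf⟩

/-- A lift that is `C^∞` at one point need not be `C^∞` on a neighbourhood, since the neighbourhood
may shrink with the order. It is however `C^1`, so continuous, nearby; there it differs by a local
constant from the lift supplied at each neighbouring point, and so is smooth at that point too. -/
theorem smoothCircleOn_of_smoothCircleAt [IsManifold 𝓘(ℝ, E) ∞ X] {f : X → UnitAddCircle}
    {S : Set X} (hS : IsOpen S) (h : ∀ x ∈ S, SmoothCircleAt 𝓘(ℝ, E) f x) :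
    SmoothCircleOn E f S := by
  intro x hx
  have : IsManifold 𝓘(ℝ, E) 1 X := IsManifold.of_le (n := ∞) (by simp)
  obtain ⟨g, hg, hf⟩ := h x hx
  have h1 : ∀ᶠ y in 𝓝 x, ContMDiffAt 𝓘(ℝ, E) 𝓘(ℝ, ℝ) 1 g y :=
    (contMDiffAt_iff_contMDiffAt_nhds (by simp)).1 (hg.of_le (by simp))
  obtain ⟨V, hV, hVo, hxV⟩ := eventually_nhds_iff.1 (hf.and (h1.and (hS.mem_nhds hx)))
  refine ⟨V, hVo, hxV, g, fun y hy => ?_, fun y hy => (hV y hy).1⟩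
  obtain ⟨k, hk, hfk⟩ := h y (hV y hy).2.2
  have e := eventually_sub_eq_of_lifts (hV y hy).2.1.continuousAt hk.continuousAt (by
    filter_upwards [hfk, hVo.mem_nhds hy] with z h1 h2
    rw [← (hV z h2).1, h1])
  exact ((hk.add contMDiffAt_const).congr_of_eventuallyEq e).contMDiffWithinAt

theorem SmoothCircleAt.hasCircleDerivAt {f : X → UnitAddCircle} {x : X}
    (h : SmoothCircleAt 𝓘(ℝ, E) f x) : HasCircleDerivAt E f x (circleDeriv E f x) := by
  obtain ⟨g, hg, hf⟩ := h
  have h : HasCircleDerivAt E f x (mfderiv 𝓘(ℝ, E) 𝓘(ℝ, ℝ) g x) :=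
    ⟨g, hf, (hg.mdifferentiableAt (by simp)).hasMFDerivAt⟩
  rwa [h.circleDeriv_eq]

end Smooth

/-! ### Calculus on principal torus bundles -/

section Torus

variable {J : Type*}

@[simp] theorem toTorus_zero : toTorus (0 : J → ℝ) = 0 := by
  ext j; simp [toTorus]

theorem toTorus_add (s t : J → ℝ) : toTorus (s + t) = toTorus s + toTorus t := by
  ext j; simp [toTorus]

theorem toTorus_surjective (c : Torus J) : ∃ t : J → ℝ, toTorus t = c := by
  choose t ht using fun j => circle_coe_surjective (c j)
  exact ⟨t, funext ht⟩

theorem matTorus_add [Fintype J] (A : Matrix J J ℤ) (s t : Torus J) :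
    matTorus A (s + t) = matTorus A s + matTorus A t := by
  ext i; simp [matTorus, Finset.sum_add_distrib]

@[simp] theorem matTorus_zero [Fintype J] (A : Matrix J J ℤ) :
    matTorus A (0 : Torus J) = 0 := by
  ext i; simp [matTorus]

end Torus

namespace PrincipalTorusBundle

variable {J : Type*} [Fintype J]
  {E : Type*} [NormedAddCommGroup E] [NormedSpace ℝ E]
  {M : Type*} [TopologicalSpace M] [ChartedSpace E M]
  {E' : Type*} [NormedAddCommGroup E'] [NormedSpace ℝ E']
  {X : Type*} [TopologicalSpace X] [ChartedSpace E' X]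
  {ι : Type*} {U : ι → Set M}
  (P : PrincipalTorusBundle J E M E' X U)

theorem isOpen_preimage (α : ι) : IsOpen (P.proj ⁻¹' U α) :=
  (P.isOpen_cover α).preimage P.proj_smooth.continuous

/-- The section over `U α` on which the fibre coordinate vanishes. -/
noncomputable def sect (α : ι) : M → X := (P.exists_section α).choose

theorem contMDiffOn_sect (α : ι) : ContMDiffOn 𝓘(ℝ, E) 𝓘(ℝ, E') ∞ (P.sect α) (U α) :=
  (P.exists_section α).choose_spec.1

theorem contMDiffAt_sect {α : ι} {m : M} (hm : m ∈ U α) :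
    ContMDiffAt 𝓘(ℝ, E) 𝓘(ℝ, E') ∞ (P.sect α) m :=
  (P.contMDiffOn_sect α).contMDiffAt ((P.isOpen_cover α).mem_nhds hm)

theorem proj_sect {α : ι} {m : M} (hm : m ∈ U α) : P.proj (P.sect α m) = m :=
  ((P.exists_section α).choose_spec.2 m hm).1

theorem coord_sect {α : ι} {m : M} (hm : m ∈ U α) : P.coord α (P.sect α m) = 0 :=
  ((P.exists_section α).choose_spec.2 m hm).2

theorem act_eq_of_coord {α : ι} {x y : X} (hx : P.proj x ∈ U α) (h : P.proj x = P.proj y) :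
    P.act (P.coord α y - P.coord α x) x = y := by
  refine P.coord_inj α _ _ (by rwa [P.proj_act]) (by rw [P.proj_act, h]) ?_
  rw [P.coord_act α _ _ hx, sub_add_cancel]

theorem act_coord_sect {α : ι} {x : X} (hx : P.proj x ∈ U α) :
    P.act (P.coord α x) (P.sect α (P.proj x)) = x := by
  have := P.act_eq_of_coord (α := α) (x := P.sect α (P.proj x)) (y := x)
    (by rwa [P.proj_sect hx]) (P.proj_sect hx)
  rwa [P.coord_sect hx, sub_zero] at this

theorem smoothCircleAt_coord {α : ι} {x : X} (hx : P.proj x ∈ U α) (j : J) :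
    SmoothCircleAt 𝓘(ℝ, E') (fun x => P.coord α x j) x :=
  (P.coord_smooth α j).smoothCircleAt hx

section Smooth

variable {F : Type*} [NormedAddCommGroup F] [NormedSpace ℝ F] {H : Type*} [TopologicalSpace H]
  {I : ModelWithCorners ℝ F H} {Z : Type*} [TopologicalSpace Z] [ChartedSpace H Z]

/-- Smoothness of the action is given on `ℝ^J` rather than on the torus, so the torus-valued factor
is replaced near `z` by a smooth real lift. -/
theorem contMDiffAt_act {c : Z → Torus J} {f : Z → X} {z : Z}
    (hc : ∀ j, SmoothCircleAt I (fun y => c y j) z) (hf : ContMDiffAt I 𝓘(ℝ, E') ∞ f z) :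
    ContMDiffAt I 𝓘(ℝ, E') ∞ (fun y => P.act (c y) (f y)) z := by
  choose g hg hcg using hc
  have h1 : ContMDiffAt I 𝓘(ℝ, J → ℝ) ∞ (fun y j => g j y) z :=
    contMDiffAt_pi_space.2 hg
  refine ((P.act_smooth.contMDiffAt (x := ((fun j => g j z), f z))).comp z
    (h1.prodMk hf)).congr_of_eventuallyEq ?_
  filter_upwards [Filter.eventually_all.2 hcg] with y hy
  have : c y = toTorus fun j => g j y := funext hy
  simp [this]

end Smooth

theorem contMDiff_act (t : Torus J) : ContMDiff 𝓘(ℝ, E') 𝓘(ℝ, E') ∞ (P.act t) := fun _ =>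
  P.contMDiffAt_act (fun j => smoothCircleAt_const (t j) _) contMDiffAt_id

theorem hasMFDerivAt_act (t : Torus J) (x : X) :
    HasMFDerivAt 𝓘(ℝ, E') 𝓘(ℝ, E') (P.act t) x (P.actDeriv t x) :=
  ((P.contMDiff_act t).mdifferentiable (by simp) x).hasMFDerivAt

theorem contMDiff_act_toTorus (x : X) :
    ContMDiff 𝓘(ℝ, J → ℝ) 𝓘(ℝ, E') ∞ (fun t : J → ℝ => P.act (toTorus t) x) :=
  P.act_smooth.comp (contMDiff_id.prodMk contMDiff_const)

theorem hasMFDerivAt_act_toTorus (x : X) (t : J → ℝ) :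
    HasMFDerivAt 𝓘(ℝ, J → ℝ) 𝓘(ℝ, E') (fun t : J → ℝ => P.act (toTorus t) x) t
      (mfderiv 𝓘(ℝ, J → ℝ) 𝓘(ℝ, E') (fun t : J → ℝ => P.act (toTorus t) x) t) :=
  ((P.contMDiff_act_toTorus x).mdifferentiable (by simp) t).hasMFDerivAt

theorem contMDiff_orbit (j : J) (x : X) : ContMDiff 𝓘(ℝ, ℝ) 𝓘(ℝ, E') ∞ (P.orbit j x) := by
  classical
  have h : ContMDiff 𝓘(ℝ, ℝ) 𝓘(ℝ, J → ℝ) ∞ (fun s : ℝ => s • (Pi.single j (1 : ℝ) : J → ℝ)) :=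
    (contDiff_id.smul contDiff_const).contMDiff
  exact (P.contMDiff_act_toTorus x).comp h

theorem hasMFDerivAt_orbit (j : J) (x : X) (s : ℝ) :
    HasMFDerivAt 𝓘(ℝ, ℝ) 𝓘(ℝ, E') (P.orbit j x) s
      (mfderiv 𝓘(ℝ, ℝ) 𝓘(ℝ, E') (P.orbit j x) s) :=
  ((P.contMDiff_orbit j x).mdifferentiable (by simp) s).hasMFDerivAt

@[simp] theorem orbit_zero (j : J) (x : X) : P.orbit j x 0 = x := by
  simp [orbit, P.act_zero]

theorem orbit_one (j : J) (x : X) : P.orbit j x 1 = x := by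
  classical
  have : toTorus ((1 : ℝ) • Pi.single j (1 : ℝ) : J → ℝ) = 0 := by
    ext k
    by_cases h : k = j
    · subst h; simp [toTorus]
    · simp [toTorus, h]
  unfold orbit
  convert P.act_zero x using 2

theorem proj_orbit (j : J) (x : X) (s : ℝ) : P.proj (P.orbit j x s) = P.proj x :=
  P.proj_act _ _

theorem orbit_act (j : J) (t : Torus J) (x : X) (s : ℝ) :
    P.orbit j (P.act t x) s = P.act t (P.orbit j x s) := by
  simp only [orbit, ← P.act_add, add_comm]

/-- The fundamental vector fields are invariant. -/
theorem fund_act (j : J) (t : Torus J) (x : X) :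
    P.fund j (P.act t x) = P.actDeriv t x (P.fund j x) := by
  have h1 : P.orbit j (P.act t x) = P.act t ∘ P.orbit j x := funext (P.orbit_act j t x)
  have h2 := (P.hasMFDerivAt_act t (P.orbit j x 0)).comp 0 (P.hasMFDerivAt_orbit j x 0)
  rw [← h1] at h2
  have h3 := hasMFDerivAt_unique (P.hasMFDerivAt_orbit j (P.act t x) 0) h2
  have h4 := DFunLike.congr_fun h3 (1 : ℝ)
  -- The chain rule yields derivatives at `orbit j x 0`, which equals `x` only propositionally. All
  -- tangent spaces are `E'`, so one generalises the base point and substitutes; the same device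
  -- recurs below.
  have h5 : ∀ z, z = x → (P.actDeriv t z (P.orbitVelocity j x 0 : E') : E') =
      P.actDeriv t x (P.orbitVelocity j x 0 : E') := by rintro z rfl; rfl
  exact h4.trans (h5 _ (P.orbit_zero j x))

/-- An orbit is an orbit of a one-parameter group: restarting it at time `s` only shifts the
parameter. -/
theorem orbitVelocity_eq (j : J) (x : X) (s : ℝ) :
    P.orbitVelocity j x s = P.fund j (P.orbit j x s) := by
  classical
  have h1 : P.orbit j x = P.orbit j (P.orbit j x s) ∘ fun r => r - s := by
    funext r
    simp only [Function.comp, orbit, ← P.act_add, ← toTorus_add, ← add_smul, sub_add_cancel]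
  have h2 : HasMFDerivAt 𝓘(ℝ, ℝ) 𝓘(ℝ, ℝ) (fun r : ℝ => r - s) s
      (ContinuousLinearMap.id ℝ ℝ) :=
    ((hasFDerivAt_id s).sub_const s).hasMFDerivAt
  have h3 := HasMFDerivAt.comp (f := fun r : ℝ => r - s) s
    (P.hasMFDerivAt_orbit j (P.orbit j x s) (s - s)) h2
  rw [← h1] at h3
  have h4 := DFunLike.congr_fun (hasMFDerivAt_unique (P.hasMFDerivAt_orbit j x s) h3) (1 : ℝ)
  have h5 : ∀ z : ℝ, z = 0 → (P.orbitVelocity j (P.orbit j x s) z : E') =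
      P.fund j (P.orbit j x s) := by rintro z rfl; rfl
  exact h4.trans (h5 _ (sub_self s))

/-- The derivative of `t ↦ t • x` is `w ↦ ∑ w_j ∂/∂θ_j`. -/
theorem mfderiv_act_toTorus (x : X) (t w : J → ℝ) :
    (mfderiv 𝓘(ℝ, J → ℝ) 𝓘(ℝ, E') (fun t : J → ℝ => P.act (toTorus t) x) t w : E') =
      ∑ j, w j • (P.fund j (P.act (toTorus t) x) : E') := by
  classical
  have key : ∀ j, (mfderiv 𝓘(ℝ, J → ℝ) 𝓘(ℝ, E') (fun t : J → ℝ => P.act (toTorus t) x) t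
      (Pi.single j (1 : ℝ) : J → ℝ) : E') = P.fund j (P.act (toTorus t) x) := by
    intro j
    have h1 : P.orbit j (P.act (toTorus t) x) =
        (fun t : J → ℝ => P.act (toTorus t) x) ∘ fun s : ℝ => t + s • Pi.single j (1 : ℝ) := by
      funext s
      simp only [orbit, Function.comp, toTorus_add, ← P.act_add]
      rw [add_comm]
    have h2 : HasMFDerivAt 𝓘(ℝ, ℝ) 𝓘(ℝ, J → ℝ)
        (fun s : ℝ => t + s • (Pi.single j (1 : ℝ) : J → ℝ)) 0
        ((ContinuousLinearMap.id ℝ ℝ).smulRight (Pi.single j (1 : ℝ) : J → ℝ)) :=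
      (((hasFDerivAt_id (0 : ℝ)).smul_const _).const_add t).hasMFDerivAt
    have h3 := (P.hasMFDerivAt_act_toTorus x (t + (0 : ℝ) • Pi.single j (1 : ℝ))).comp 0 h2
    rw [← h1] at h3
    have h4 := DFunLike.congr_fun
      (hasMFDerivAt_unique (P.hasMFDerivAt_orbit j (P.act (toTorus t) x) 0) h3) (1 : ℝ)
    have h5 : ∀ z : J → ℝ, z = t →
      (mfderiv 𝓘(ℝ, J → ℝ) 𝓘(ℝ, E') (fun t : J → ℝ => P.act (toTorus t) x) z
        ((1 : ℝ) • Pi.single j (1 : ℝ) : J → ℝ) : E') =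
      (mfderiv 𝓘(ℝ, J → ℝ) 𝓘(ℝ, E') (fun t : J → ℝ => P.act (toTorus t) x) t
        (Pi.single j (1 : ℝ) : J → ℝ) : E') := by rintro z rfl; rw [one_smul]
    refine (h5 (t + (0 : ℝ) • (Pi.single j (1 : ℝ) : J → ℝ)) (by simp)).symm.trans ?_
    exact h4.symm
  have hw : w = ∑ j, w j • (Pi.single j (1 : ℝ) : J → ℝ) := by
    ext k; simp [Finset.sum_apply, Pi.single_apply]
  let D : (J → ℝ) →L[ℝ] E' :=
    mfderiv 𝓘(ℝ, J → ℝ) 𝓘(ℝ, E') (fun t : J → ℝ => P.act (toTorus t) x) t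
  change D w = _
  conv_lhs => rw [hw]
  rw [map_sum]
  refine Finset.sum_congr rfl fun j _ => ?_
  rw [map_smul]
  exact congrArg _ (key j)

end PrincipalTorusBundle
-- Smooth differential forms
section Forms

variable {E : Type*} [NormedAddCommGroup E] [NormedSpace ℝ E]
  {X : Type*} [TopologicalSpace X] [ChartedSpace E X]
  {E' : Type*} [NormedAddCommGroup E'] [NormedSpace ℝ E']
  {X' : Type*} [TopologicalSpace X'] [ChartedSpace E' X']

theorem OneForm.apply_congr (a : OneForm E X) {x y : X} (h : x = y) (v : E) :
    a x v = a y v := by subst h; rfl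

theorem TwoForm.apply_congr (b : TwoForm E X) {x y : X} (h : x = y) (u v : E) :
    b x u v = b y u v := by subst h; rfl

theorem HasCircleDerivAt.congr_point {f : X → UnitAddCircle} {x y : X} {f' : E →L[ℝ] ℝ}
    (h : HasCircleDerivAt E f x f') (hxy : x = y) : HasCircleDerivAt E f y f' := by
  subst hxy; exact h

variable [IsManifold 𝓘(ℝ, E) ∞ X] [IsManifold 𝓘(ℝ, E') ∞ X']

theorem OneForm.SmoothOn.add {a b : OneForm E X} {S : Set X} (ha : OneForm.SmoothOn E a S)
    (hb : OneForm.SmoothOn E b S) : OneForm.SmoothOn E (fun x => a x + b x) S :=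
  ContMDiffOn.add ha hb

theorem OneForm.SmoothOn.neg {a : OneForm E X} {S : Set X} (ha : OneForm.SmoothOn E a S) :
    OneForm.SmoothOn E (fun x => - a x) S :=
  ContMDiffOn.neg ha

theorem OneForm.smoothOn_zero {S : Set X} :
    OneForm.SmoothOn E (fun x => (0 : TangentSpace 𝓘(ℝ, E) x →L[ℝ] ℝ)) S :=
  contMDiffOn_const (c := (0 : ℝ))

theorem OneForm.SmoothOn.sum {κ : Type*} (s : Finset κ) {a : κ → OneForm E X} {S : Set X}
    (ha : ∀ k ∈ s, OneForm.SmoothOn E (a k) S) :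
    OneForm.SmoothOn E (fun x => ∑ k ∈ s, a k x) S := by
  classical
  induction s using Finset.induction_on with
  | empty => simpa using OneForm.smoothOn_zero
  | insert i s hi ih =>
    simp only [Finset.sum_insert hi]
    exact (ha i (Finset.mem_insert_self _ _)).add
      (ih fun k hk => ha k (Finset.mem_insert_of_mem hk))

theorem OneForm.SmoothOn.smul {a : OneForm E X} {S : Set X} (ha : OneForm.SmoothOn E a S)
    {c : X → ℝ} (hc : ContMDiffOn 𝓘(ℝ, E) 𝓘(ℝ, ℝ) ∞ c S) :
    OneForm.SmoothOn E (fun x => c x • a x) S := by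
  have h1 : ContMDiffOn 𝓘(ℝ, E).tangent 𝓘(ℝ, ℝ) ∞
      (fun v : TangentBundle 𝓘(ℝ, E) X => c v.1) {v | v.1 ∈ S} :=
    hc.comp (Bundle.contMDiff_proj (TangentSpace 𝓘(ℝ, E) (M := X))).contMDiffOn fun v hv => hv
  exact ContMDiffOn.mul h1 ha

theorem OneForm.SmoothOn.congr {a b : OneForm E X} {S : Set X} (ha : OneForm.SmoothOn E a S)
    (h : ∀ x ∈ S, b x = a x) : OneForm.SmoothOn E b S :=
  ContMDiffOn.congr ha fun v hv => by rw [h v.1 hv]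

theorem OneForm.SmoothOn.mono {a : OneForm E X} {S T : Set X} (ha : OneForm.SmoothOn E a S)
    (h : T ⊆ S) : OneForm.SmoothOn E a T :=
  ContMDiffOn.mono ha fun _ hv => h hv

theorem isOpen_over {S : Set X} (hS : IsOpen S) :
    IsOpen {v : TangentBundle 𝓘(ℝ, E) X | v.1 ∈ S} :=
  hS.preimage (Bundle.contMDiff_proj (n := ∞) (IB := 𝓘(ℝ, E))
    (TangentSpace 𝓘(ℝ, E) (M := X))).continuous

theorem OneForm.smoothOn_of_locally {a : OneForm E X} {S : Set X}
    (h : ∀ x ∈ S, ∃ V, IsOpen V ∧ x ∈ V ∧ OneForm.SmoothOn E a V) :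
    OneForm.SmoothOn E a S := by
  intro v hv
  obtain ⟨V, hV, hxV, ha⟩ := h v.1 hv
  exact (ContMDiffOn.contMDiffAt ha ((isOpen_over hV).mem_nhds hxV)).contMDiffWithinAt

theorem contMDiffOn_tangentMap {f : X' → X} {S : Set X'} (hS : IsOpen S)
    (hf : ContMDiffOn 𝓘(ℝ, E') 𝓘(ℝ, E) ∞ f S) :
    ContMDiffOn 𝓘(ℝ, E').tangent 𝓘(ℝ, E).tangent ∞ (tangentMap 𝓘(ℝ, E') 𝓘(ℝ, E) f)
      {v | v.1 ∈ S} := by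
  have := hf.contMDiffOn_tangentMapWithin (m := ∞) (by simp) hS.uniqueMDiffOn
  refine this.congr fun v hv => ?_
  rw [tangentMapWithin, tangentMap, mfderivWithin_of_isOpen hS hv]

theorem OneForm.SmoothOn.pullback {a : OneForm E X} {S : Set X} (ha : OneForm.SmoothOn E a S)
    {f : X' → X} {T : Set X'} (hT : IsOpen T) (hf : ContMDiffOn 𝓘(ℝ, E') 𝓘(ℝ, E) ∞ f T)
    (hTS : ∀ x ∈ T, f x ∈ S) : OneForm.SmoothOn E' (OneForm.pullback E f a) T :=
  ContMDiffOn.comp ha (contMDiffOn_tangentMap hT hf) fun v hv => hTS v.1 hv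

/-- Locally `circleDeriv` is the fibre component of the tangent map of a smooth real lift. -/
theorem SmoothCircleOn.smoothOn_circleDeriv {f : X → UnitAddCircle} {S : Set X}
    (h : SmoothCircleOn E f S) : OneForm.SmoothOn E (circleDeriv E f) S := by
  refine OneForm.smoothOn_of_locally fun x hx => ?_
  obtain ⟨V, hV, hxV, g, hg, hf⟩ := h x hx
  refine ⟨V, hV, hxV, ?_⟩
  have h1 := (contMDiff_snd_tangentBundle_modelSpace (n := ∞) ℝ 𝓘(ℝ, ℝ)).comp_contMDiffOn
    (contMDiffOn_tangentMap hV hg)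
  refine ContMDiffOn.congr h1 fun v hv => ?_
  have h2 : HasCircleDerivAt E f v.1 (mfderiv 𝓘(ℝ, E) 𝓘(ℝ, ℝ) g v.1) :=
    ⟨g, Filter.eventually_of_mem (hV.mem_nhds hv) hf,
      ((hg.contMDiffAt (hV.mem_nhds hv)).mdifferentiableAt (by simp)).hasMFDerivAt⟩
  rw [h2.circleDeriv_eq]
  rfl

/-- The contraction of a smooth `2`-form with a smooth vector field is a smooth `1`-form. -/
theorem TwoForm.SmoothOn.contract {b : TwoForm E X} {S : Set X} (hb : TwoForm.SmoothOn E b S)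
    {ξ : ∀ x : X, TangentSpace 𝓘(ℝ, E) x}
    (hξ : ContMDiff 𝓘(ℝ, E) 𝓘(ℝ, E).tangent ∞
      (fun x => (⟨x, ξ x⟩ : TangentBundle 𝓘(ℝ, E) X))) :
    OneForm.SmoothOn E (fun x => b x (ξ x)) S := by
  have hp : ContMDiff 𝓘(ℝ, E).tangent 𝓘(ℝ, E) ∞ (fun v : TangentBundle 𝓘(ℝ, E) X => v.1) :=
    Bundle.contMDiff_proj (TangentSpace 𝓘(ℝ, E) (M := X))
  intro v hv
  -- Everything is pulled back to the total space of the tangent bundle. There the free argument of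
  -- the form is the tautological section, so the contraction is a smooth bilinear bundle map
  -- applied to two smooth sections.
  have : ContMDiffWithinAt 𝓘(ℝ, E).tangent (𝓘(ℝ, E).prod 𝓘(ℝ, ℝ)) ∞
      (fun v : TangentBundle 𝓘(ℝ, E) X =>
        Bundle.TotalSpace.mk' ℝ (E := Bundle.Trivial X ℝ) v.1 (b v.1 (ξ v.1) v.2))
        {v | v.1 ∈ S} v := by
    apply ContMDiffWithinAt.clm_bundle_apply₂ (F₁ := E) (F₂ := E)
    · exact ContMDiffWithinAt.comp v (hb v.1 hv) hp.contMDiffAt.contMDiffWithinAt fun w hw => hw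
    · exact (hξ.comp hp).contMDiffAt.contMDiffWithinAt
    · exact contMDiffAt_id.contMDiffWithinAt
  simp only [Bundle.contMDiffWithinAt_totalSpace] at this
  exact this.2

theorem OneForm.SmoothOn.contract {a : OneForm E X} {S : Set X} (ha : OneForm.SmoothOn E a S)
    {ξ : ∀ x : X, TangentSpace 𝓘(ℝ, E) x}
    (hξ : ContMDiff 𝓘(ℝ, E) 𝓘(ℝ, E).tangent ∞
      (fun x => (⟨x, ξ x⟩ : TangentBundle 𝓘(ℝ, E) X))) :
    ContMDiffOn 𝓘(ℝ, E) 𝓘(ℝ, ℝ) ∞ (fun x => a x (ξ x)) S :=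
  ContMDiffOn.comp ha hξ.contMDiffOn fun _ hx => hx

end Forms

theorem toTorus_smul_single {J : Type*} [DecidableEq J] (s : ℝ) (j i : J) :
    toTorus (s • (Pi.single j (1 : ℝ) : J → ℝ)) i = ((s * if i = j then 1 else 0 : ℝ) :) := by
  by_cases h : i = j
  · subst h; simp [toTorus]
  · simp [toTorus, h]

/-! ### Fundamental vector fields; horizontal invariant forms -/

namespace PrincipalTorusBundle

variable {J : Type*} [Fintype J]
  {E : Type*} [NormedAddCommGroup E] [NormedSpace ℝ E]
  {M : Type*} [TopologicalSpace M] [ChartedSpace E M]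
  {E' : Type*} [NormedAddCommGroup E'] [NormedSpace ℝ E']
  {X : Type*} [TopologicalSpace X] [ChartedSpace E' X]
  {ι : Type*} {U : ι → Set M}
  (P : PrincipalTorusBundle J E M E' X U)

/-- The fundamental vector fields are smooth. -/
theorem contMDiff_fund [IsManifold 𝓘(ℝ, E') ∞ X] (j : J) :
    ContMDiff 𝓘(ℝ, E') 𝓘(ℝ, E').tangent ∞
      (fun x => (⟨x, P.fund j x⟩ : TangentBundle 𝓘(ℝ, E') X)) := by
  classical
  -- The field is the image of the vectors `(e_j, 0)` at the points `(0, x)` under the tangent map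
  -- of the action, so it is smooth as a composite of smooth maps.
  let F₁ : X → TangentBundle 𝓘(ℝ, J → ℝ) (J → ℝ) × TangentBundle 𝓘(ℝ, E') X :=
    fun x => (Bundle.TotalSpace.mk' (J → ℝ) 0 (Pi.single j (1 : ℝ) : J → ℝ),
      Bundle.TotalSpace.mk' E' x 0)
  have S₁ : ContMDiff 𝓘(ℝ, E') (𝓘(ℝ, J → ℝ).tangent.prod 𝓘(ℝ, E').tangent) ∞ F₁ :=
    contMDiff_const.prodMk (Bundle.contMDiff_zeroSection ℝ (TangentSpace 𝓘(ℝ, E') (M := X)))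
  have S₂ := contMDiff_equivTangentBundleProd_symm (n := ∞) (I := 𝓘(ℝ, J → ℝ)) (M := J → ℝ)
    (I' := 𝓘(ℝ, E')) (M' := X)
  have S₃ := P.act_smooth.contMDiff_tangentMap (m := ∞) (by simp)
  have S := (S₃.comp S₂).comp S₁
  refine S.congr fun x => ?_
  have h0 : P.act (toTorus (0 : J → ℝ)) x = x := by rw [toTorus_zero, P.act_zero]
  have h1 : (mfderiv (𝓘(ℝ, J → ℝ).prod 𝓘(ℝ, E')) 𝓘(ℝ, E')
      (fun p : (J → ℝ) × X => P.act (toTorus p.1) p.2) ((0 : J → ℝ), x)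
      ((Pi.single j (1 : ℝ) : J → ℝ), (0 : E')) : E') = P.fund j x := by
    refine (mfderiv_prod_eq_add_apply (v := ((Pi.single j (1 : ℝ) : J → ℝ), (0 : E')))
      (P.act_smooth.mdifferentiable (by simp) ((0 : J → ℝ), x))).trans ?_
    have h2 := P.mfderiv_act_toTorus x 0 (Pi.single j 1)
    have h3 : (∑ k, (Pi.single j (1 : ℝ) : J → ℝ) k •
        (P.fund k (P.act (toTorus 0) x) : E') : E') = P.fund j x := by
      have e1 : ∀ f : J → E', ∑ k, (Pi.single j (1 : ℝ) : J → ℝ) k • f k = f j := fun f => by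
        rw [Finset.sum_eq_single j (fun k _ hk => by simp [hk]) (by simp)]
        simp
      have e2 : ∀ y, y = x → (P.fund j y : E') = P.fund j x := by rintro y rfl; rfl
      exact (e1 _).trans (e2 _ h0)
    refine (congrArg₂ (· + ·) (h2.trans h3) (map_zero _)).trans (add_zero (P.fund j x : E'))
  refine Bundle.TotalSpace.ext h0.symm ?_
  exact heq_of_eq h1.symm

/-- Along the orbit `f` is affine with slope `r`, and by the chain rule its slope is also `f'` on
the generator; uniqueness of the differential identifies the two. -/
theorem apply_fund_of_orbit {f : X → UnitAddCircle} {x : X}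
    {f' : TangentSpace 𝓘(ℝ, E') x →L[ℝ] ℝ} (h : HasCircleDerivAt E' f x f') {j : J} {r : ℝ}
    (hr : ∀ s : ℝ, f (P.orbit j x s) = f x + ((s * r : ℝ) : UnitAddCircle)) :
    f' (P.fund j x) = r := by
  have h1 := (h.congr_point (P.orbit_zero j x).symm).comp (P.hasMFDerivAt_orbit j x 0)
  obtain ⟨c, hc⟩ := circle_coe_surjective (f x)
  have h2 : HasCircleDerivAt ℝ (fun s => f (P.orbit j x s)) (0 : ℝ)
      ((ContinuousLinearMap.id ℝ ℝ).smulRight r) := by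
    refine ⟨fun s => c + s * r, Filter.Eventually.of_forall fun s => ?_, ?_⟩
    · change f (P.orbit j x s) = ((c + s * r : ℝ) : UnitAddCircle)
      rw [hr, AddCircle.coe_add, hc]
    · exact (((hasFDerivAt_id (0 : ℝ)).smul_const r).const_add c).hasMFDerivAt
  have h3 := DFunLike.congr_fun (h1.unique h2) (1 : ℝ)
  exact h3.trans (one_mul r)

theorem coord_orbit [DecidableEq J] {α : ι} {x : X} (hx : P.proj x ∈ U α) (i j : J) (s : ℝ) :
    P.coord α (P.orbit j x s) i =
      P.coord α x i + ((s * if i = j then 1 else 0 : ℝ) : UnitAddCircle) := by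
  rw [orbit, P.coord_act _ _ _ hx, Pi.add_apply, add_comm, ← toTorus_smul_single]
  congr!

theorem hasCircleDerivAt_coord {α : ι} {x : X} (hx : P.proj x ∈ U α) (i : J) :
    HasCircleDerivAt E' (fun y => P.coord α y i) x
      (circleDeriv E' (fun y => P.coord α y i) x) :=
  (P.smoothCircleAt_coord hx i).hasCircleDerivAt

theorem circleDeriv_coord_fund [DecidableEq J] {α : ι} {x : X} (hx : P.proj x ∈ U α) (i j : J) :
    circleDeriv E' (fun y => P.coord α y i) x (P.fund j x) = if i = j then 1 else 0 :=
  P.apply_fund_of_orbit (P.hasCircleDerivAt_coord hx i) (P.coord_orbit hx i j)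

theorem circleDeriv_coord_act {α : ι} {x : X} (hx : P.proj x ∈ U α) (i : J) (t : Torus J)
    (v : TangentSpace 𝓘(ℝ, E') x) :
    circleDeriv E' (fun y => P.coord α y i) (P.act t x) (P.actDeriv t x v) =
      circleDeriv E' (fun y => P.coord α y i) x v := by
  have h1 := (P.hasCircleDerivAt_coord (x := P.act t x) (by rwa [P.proj_act]) i).comp
    (P.hasMFDerivAt_act t x)
  have h2 := (hasCircleDerivAt_const (E := E') (t i) x).add (P.hasCircleDerivAt_coord hx i)
  have h3 := h1.congr (f₁ := fun y => t i + P.coord α y i) (by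
    filter_upwards [(P.isOpen_preimage α).mem_nhds hx] with y hy
    rw [P.coord_act _ _ _ hy, Pi.add_apply])
  have h4 := DFunLike.congr_fun (h3.unique h2) v
  simpa using h4

theorem hasMFDerivAt_proj (x : X) : HasMFDerivAt 𝓘(ℝ, E') 𝓘(ℝ, E) P.proj x
    (mfderiv 𝓘(ℝ, E') 𝓘(ℝ, E) P.proj x) :=
  (P.proj_smooth.mdifferentiable (by simp) x).hasMFDerivAt

theorem mfderiv_proj_fund (j : J) (x : X) :
    mfderiv 𝓘(ℝ, E') 𝓘(ℝ, E) P.proj x (P.fund j x) = 0 := by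
  have h1 := (P.hasMFDerivAt_proj (P.orbit j x 0)).comp 0 (P.hasMFDerivAt_orbit j x 0)
  have h2 : P.proj ∘ P.orbit j x = fun _ => P.proj x := funext (P.proj_orbit j x)
  rw [h2] at h1
  have h3 := DFunLike.congr_fun
    (hasMFDerivAt_unique h1 (hasMFDerivAt_const (I := 𝓘(ℝ, ℝ)) (P.proj x) (0 : ℝ))) (1 : ℝ)
  have h4 : ∀ y, y = x → (mfderiv 𝓘(ℝ, E') 𝓘(ℝ, E) P.proj y
    (P.orbitVelocity j x 0 : E') : E) = mfderiv 𝓘(ℝ, E') 𝓘(ℝ, E) P.proj x (P.fund j x) := by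
    rintro y rfl; rfl
  exact (h4 _ (P.orbit_zero j x)).symm.trans h3

theorem mfderiv_proj_act (t : Torus J) (x : X) (v : TangentSpace 𝓘(ℝ, E') x) :
    (mfderiv 𝓘(ℝ, E') 𝓘(ℝ, E) P.proj (P.act t x) (P.actDeriv t x v) : E) =
      mfderiv 𝓘(ℝ, E') 𝓘(ℝ, E) P.proj x v := by
  have h1 := (P.hasMFDerivAt_proj (P.act t x)).comp x (P.hasMFDerivAt_act t x)
  have h2 : P.proj ∘ P.act t = P.proj := funext (P.proj_act t)
  rw [h2] at h1
  exact DFunLike.congr_fun (hasMFDerivAt_unique h1 (P.hasMFDerivAt_proj x)) v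

/-- A `1`-form over `U α` that is horizontal and invariant is determined by its restriction to
the section. -/
theorem apply_eq_apply_sect {η : OneForm E' X} {α : ι}
    (h0 : ∀ y k, P.proj y ∈ U α → η y (P.fund k y) = 0)
    (hinv : ∀ t y v, P.proj y ∈ U α → η (P.act t y) (P.actDeriv t y v) = η y v)
    {x : X} (hx : P.proj x ∈ U α) :
    OneForm.pullback E P.proj (OneForm.pullback E' (P.sect α) η) x = η x := by
  choose g hg hcg using fun j => P.smoothCircleAt_coord hx j
  have h1 : ContMDiffAt 𝓘(ℝ, E') 𝓘(ℝ, J → ℝ) ∞ (fun y j => g j y) x :=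
    contMDiffAt_pi_space.2 hg
  have hx' : P.proj x ∈ U α := hx
  have h2 := (((P.contMDiffAt_sect hx').mdifferentiableAt (by simp)).hasMFDerivAt).comp x
    (P.hasMFDerivAt_proj x)
  have h3 := (h1.mdifferentiableAt (by simp)).hasMFDerivAt.prodMk h2
  have h4 := ((P.act_smooth.mdifferentiable (by simp)
    ((fun j => g j x), P.sect α (P.proj x))).hasMFDerivAt).comp x h3
  -- The identity is written near `x` as the action, by the fibre coordinate, on the point of the
  -- section below. Differentiating this expression splits a tangent vector.
  have heq : ∀ᶠ y in 𝓝 x, P.act (toTorus fun j => g j y) (P.sect α (P.proj y)) = y := by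
    filter_upwards [Filter.eventually_all.2 hcg, (P.isOpen_preimage α).mem_nhds hx] with y hy hyU
    have : P.coord α y = toTorus fun j => g j y := funext hy
    rw [← this, P.act_coord_sect hyU]
  have h5 := h4.congr_of_eventuallyEq (f₁ := id) (by
    filter_upwards [heq] with y hy
    exact hy.symm)
  have hx0 := heq.self_of_nhds
  ext v
  have h6 := DFunLike.congr_fun (hasMFDerivAt_unique (hasMFDerivAt_id x) h5) v
  set y₀ := P.sect α (P.proj x) with hy₀
  set t₀ : J → ℝ := fun j => g j x with ht₀
  have hz : P.proj (P.act (toTorus t₀) y₀) ∈ U α := by rwa [hx0]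
  have hy : P.proj y₀ ∈ U α := by rwa [P.proj_sect hx']
  let w : J → ℝ := mfderiv 𝓘(ℝ, E') 𝓘(ℝ, J → ℝ) (fun y j => g j y) x v
  let u : E' := mfderiv 𝓘(ℝ, E) 𝓘(ℝ, E') (P.sect α) (P.proj x)
    (mfderiv 𝓘(ℝ, E') 𝓘(ℝ, E) P.proj x v)
  -- The first summand is vertical and is killed by `η`; the second is the translate of a vector
  -- tangent to the section, on which invariance applies.
  have h7 : (v : E') = (∑ j, w j • (P.fund j (P.act (toTorus t₀) y₀) : E')) +
      (P.actDeriv (toTorus t₀) y₀ u : E') := by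
    refine Eq.trans h6 ?_
    refine Eq.trans (mfderiv_prod_eq_add_apply (v := (w, u))
      (P.act_smooth.mdifferentiable (by simp) (t₀, y₀))) ?_
    exact congrArg (· + (P.actDeriv (toTorus t₀) y₀ u : E')) (P.mfderiv_act_toTorus y₀ t₀ w)
  have h8 : η (P.act (toTorus t₀) y₀) (v : E') = η y₀ u := by
    have e1 : ∀ (A : E' →L[ℝ] ℝ) (f : J → E') (z z' : E'), z = (∑ j, w j • f j) + z' →
        (∀ j, A (f j) = 0) → A z = A z' := fun A f z z' hz hA => by
      rw [hz, map_add, map_sum, Finset.sum_eq_zero fun j _ => by rw [map_smul, hA, smul_zero],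
        zero_add]
    exact (e1 _ _ _ _ h7 fun j => h0 _ j hz).trans (hinv _ _ _ hy)
  exact (h8.symm.trans (OneForm.apply_congr η hx0 v))

end PrincipalTorusBundle
/-! ### Variation of the holonomy -/

/-- Infinitesimal Stokes on a thin rectangle. For a `1`-form `A ds + b de` whose exterior derivative
at `e = 0` has coefficient `c` on `de ∧ ds`, one has `∂_e A = c + ∂_s b`. Differentiation under the
integral followed by the fundamental theorem of calculus leaves `c` times the length plus the
boundary terms of `b`. The size `δ` is that of a closed box inside `O`, where compactness bounds
`∂_e A`. -/
theorem exists_hasDerivAt_integral {A A' : ℝ × ℝ → ℝ} {b : ℝ → ℝ} {O : Set (ℝ × ℝ)}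
    (hO : IsOpen O) (hA : ContinuousOn A O) (hA' : ContinuousOn A' O)
    (hd : ∀ e s, (e, s) ∈ O → HasDerivAt (fun e => A (e, s)) (A' (e, s)) e)
    {s₀ c : ℝ} (h0 : ((0 : ℝ), s₀) ∈ O)
    (hb : ∀ s, ((0 : ℝ), s) ∈ O → HasDerivAt b (A' (0, s) - c) s) :
    ∃ δ > 0, (∀ e s : ℝ, |e| < δ → |s - s₀| < δ → (e, s) ∈ O) ∧
      ∀ s s' : ℝ, |s - s₀| < δ → |s' - s₀| < δ →
        HasDerivAt (fun e => ∫ r in s'..s, A (e, r)) (c * (s - s') + (b s - b s')) 0 := by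
  obtain ⟨δ, hδ, hsub⟩ := Metric.nhds_basis_closedBall.mem_iff.1 (hO.mem_nhds h0)
  have hmem : ∀ e s : ℝ, |e| ≤ δ → |s - s₀| ≤ δ → (e, s) ∈ Metric.closedBall ((0 : ℝ), s₀) δ := by
    intro e s he hs
    rw [Metric.mem_closedBall, Prod.dist_eq]
    exact max_le (by simpa [Real.dist_eq] using he) (by simpa [Real.dist_eq] using hs)
  obtain ⟨C, hC⟩ := (isCompact_closedBall ((0 : ℝ), s₀) δ).exists_bound_of_continuousOn
    (hA'.mono hsub)
  refine ⟨δ, hδ, fun e s he hs => hsub (hmem e s he.le hs.le), fun s s' hs hs' => ?_⟩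
  have huIcc : ∀ r ∈ Set.uIcc s' s, |r - s₀| ≤ δ := by
    intro r hr
    have h1 := abs_lt.1 hs
    have h2 := abs_lt.1 hs'
    rw [Set.mem_uIcc] at hr
    rw [abs_le]
    rcases hr with hr | hr <;> constructor <;> linarith
  have hr0 : ∀ r ∈ Set.uIcc s' s, ((0 : ℝ), r) ∈ O := fun r hr =>
    hsub (hmem 0 r (by simpa using hδ.le) (huIcc r hr))
  have hball : ∀ e ∈ Metric.ball (0 : ℝ) δ, |e| ≤ δ := fun e he => by
    simpa [Real.dist_eq] using (Metric.mem_ball.1 he).le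
  have hline : ∀ e : ℝ, |e| ≤ δ → ContinuousOn (fun r : ℝ => A (e, r)) (Set.uIcc s' s) :=
    fun e he => hA.comp (by fun_prop) fun r hr => hsub (hmem e r he (huIcc r hr))
  have hline' : ContinuousOn (fun r : ℝ => A' (0, r)) (Set.uIcc s' s) :=
    hA'.comp (by fun_prop) hr0
  have key := intervalIntegral.hasDerivAt_integral_of_dominated_loc_of_deriv_le
    (μ := MeasureTheory.volume) (a := s') (b := s) (bound := fun _ => C)
    (F := fun e r => A (e, r)) (F' := fun e r => A' (e, r))
    (x₀ := (0 : ℝ)) (Metric.ball_mem_nhds (0 : ℝ) hδ)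
    (by
      filter_upwards [Metric.ball_mem_nhds (0 : ℝ) hδ] with e he
      exact ((hline e (hball e he)).mono Set.uIoc_subset_uIcc).aestronglyMeasurable
        measurableSet_uIoc)
    (hline 0 (by simpa using hδ.le)).intervalIntegrable
    ((hline'.mono Set.uIoc_subset_uIcc).aestronglyMeasurable measurableSet_uIoc)
    (Filter.Eventually.of_forall fun r hr e he =>
      hC _ (hmem e r (hball e he) (huIcc r (Set.uIoc_subset_uIcc hr))))
    (by simp)
    (Filter.Eventually.of_forall fun r hr e he =>
      hd e r (hsub (hmem e r (hball e he) (huIcc r (Set.uIoc_subset_uIcc hr)))))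
  have hFTC : ∫ r in s'..s, A' (0, r) = (c * s + b s) - (c * s' + b s') := by
    refine intervalIntegral.integral_eq_sub_of_hasDerivAt
      (f := fun r => c * r + b r) (fun r hr => ?_) hline'.intervalIntegrable
    refine (((hasDerivAt_id r).const_mul c).add (hb r (hr0 r hr))).congr_deriv ?_
    ring
  refine key.2.congr_deriv ?_
  rw [hFTC]
  ring

/-! ### Naturality of the exterior derivative -/

section Naturality

variable {E : Type*} [NormedAddCommGroup E] [NormedSpace ℝ E]
  {X : Type*} [TopologicalSpace X] [ChartedSpace E X] [IsManifold 𝓘(ℝ, E) ∞ X]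
  {F : Type*} [NormedAddCommGroup F] [NormedSpace ℝ F]

/-- In finite dimension a map into the dual is smooth once its value on each fixed vector is. That
value is the form, a smooth function on the tangent bundle, composed with the tangent map of the
inverse chart. -/
theorem OneForm.SmoothOn.contDiffOn_inChart [FiniteDimensional ℝ E] {a : OneForm E X} {S : Set X}
    (ha : OneForm.SmoothOn E a S) (x₀ : X) :
    ContDiffOn ℝ ∞ (OneForm.inChart E a x₀)
      ((chartAt E x₀).target ∩ (chartAt E x₀).symm ⁻¹' S) := by
  refine contDiffOn_clm_apply.2 fun u => ?_
  have h1 : ContMDiff 𝓘(ℝ, E) 𝓘(ℝ, E).tangent ∞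
      (fun z : E => (⟨z, u⟩ : TangentBundle 𝓘(ℝ, E) E)) :=
    contMDiff_vectorSpace_iff_contDiff.2 contDiff_const
  have h2 := contMDiffOn_tangentMap (chartAt E x₀).open_target
    (contMDiffOn_chart_symm (I := 𝓘(ℝ, E)) (n := ∞) (x := x₀))
  have h3 := ContMDiffOn.comp ha (h2.mono (fun v (hv : v.1 ∈ (chartAt E x₀).target ∩
    (chartAt E x₀).symm ⁻¹' S) => hv.1)) fun v hv => hv.2
  exact (h3.comp h1.contMDiffOn fun z hz => hz).contDiffOn

/-- The exterior derivative commutes with the pull-back to a vector space. -/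
theorem HasExtDerivOn.pullback [FiniteDimensional ℝ E] {a : OneForm E X} {b : TwoForm E X}
    {S : Set X} (hS : IsOpen S) (hab : HasExtDerivOn E a b S) (ha : OneForm.SmoothOn E a S)
    {Γ : F → X} {O : Set F} (hO : IsOpen O) (hΓ : ContMDiffOn 𝓘(ℝ, F) 𝓘(ℝ, E) ∞ Γ O)
    (hOS : ∀ q ∈ O, Γ q ∈ S) :
    ∃ p : F → F →L[ℝ] ℝ,
      (∀ q h, p q h = a (Γ q) (mfderiv 𝓘(ℝ, F) 𝓘(ℝ, E) Γ q h)) ∧ ContDiffOn ℝ ∞ p O ∧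
      ∀ q ∈ O, ∀ h k : F, fderiv ℝ p q h k - fderiv ℝ p q k h =
        b (Γ q) (mfderiv 𝓘(ℝ, F) 𝓘(ℝ, E) Γ q h) (mfderiv 𝓘(ℝ, F) 𝓘(ℝ, E) Γ q k) := by
  let P : F → F →L[ℝ] ℝ := fun q => OneForm.pullback E Γ a q
  -- The claim is local, so near `q₀` the pull-back is computed through the single chart at `Γ q₀`.
  have main : ∀ q₀ ∈ O, ∃ p : F → F →L[ℝ] ℝ, ContDiffAt ℝ ∞ p q₀ ∧
      (∀ᶠ q in 𝓝 q₀, P q = p q) ∧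
      ∀ h k : F, fderiv ℝ p q₀ h k - fderiv ℝ p q₀ k h =
        b (Γ q₀) (mfderiv 𝓘(ℝ, F) 𝓘(ℝ, E) Γ q₀ h) (mfderiv 𝓘(ℝ, F) 𝓘(ℝ, E) Γ q₀ k) := by
    intro q₀ hq₀
    set φ := chartAt E (Γ q₀) with hφ
    have hΓc : ContinuousAt Γ q₀ := (hΓ.contMDiffAt (hO.mem_nhds hq₀)).continuousAt
    obtain ⟨O', hO'sub, hO', hq₀'⟩ := mem_nhds_iff.1 (Filter.inter_mem (hO.mem_nhds hq₀)
      (hΓc.preimage_mem_nhds (φ.open_source.mem_nhds (mem_chart_source E (Γ q₀)))))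
    have hΓO' : ContMDiffOn 𝓘(ℝ, F) 𝓘(ℝ, E) ∞ Γ O' := hΓ.mono fun q hq => (hO'sub hq).1
    have hG : ContDiffOn ℝ ∞ (φ ∘ Γ) O' :=
      ((contMDiffOn_chart (I := 𝓘(ℝ, E)) (n := ∞) (x := Γ q₀)).comp hΓO'
        fun q hq => (hO'sub hq).2).contDiffOn
    have hGd : ∀ q ∈ O', HasFDerivAt (φ ∘ Γ) (fderiv ℝ (φ ∘ Γ) q) q := fun q hq =>
      ((hG.contDiffAt (hO'.mem_nhds hq)).differentiableAt (by simp)).hasFDerivAt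
    have hsymm : ∀ q ∈ O', φ.symm (φ (Γ q)) = Γ q := fun q hq => φ.left_inv (hO'sub hq).2
    have htgt : ∀ q ∈ O', φ (Γ q) ∈ φ.target := fun q hq => φ.map_source (hO'sub hq).2
    have hmf : ∀ q ∈ O', ∀ h : F, (mfderiv 𝓘(ℝ, F) 𝓘(ℝ, E) Γ q h : E) =
        chartInvDeriv E (Γ q₀) (φ (Γ q)) (fderiv ℝ (φ ∘ Γ) q h) := by
      intro q hq h
      have e1 : HasMFDerivAt 𝓘(ℝ, E) 𝓘(ℝ, E) φ.symm (φ (Γ q))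
          (mfderiv 𝓘(ℝ, E) 𝓘(ℝ, E) φ.symm (φ (Γ q))) :=
        (((contMDiffOn_chart_symm (I := 𝓘(ℝ, E)) (n := ∞) (x := Γ q₀)).contMDiffAt
          (φ.open_target.mem_nhds (htgt q hq))).mdifferentiableAt (by simp)).hasMFDerivAt
      have e2 := HasMFDerivAt.comp (f := φ ∘ Γ) q e1 (hGd q hq).hasMFDerivAt
      have e3 := e2.congr_of_eventuallyEq (f₁ := Γ) (by
        filter_upwards [hO'.mem_nhds hq] with r hr
        exact (hsymm r hr).symm)
      rw [e3.mfderiv]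
      rfl
    refine ⟨fun q => (OneForm.inChart E a (Γ q₀) (φ (Γ q))).comp (fderiv ℝ (φ ∘ Γ) q), ?_, ?_, ?_⟩
    · have hT : IsOpen (φ.target ∩ φ.symm ⁻¹' S) := φ.isOpen_inter_preimage_symm hS
      have e1 : ContDiffAt ℝ ∞ (OneForm.inChart E a (Γ q₀)) ((φ ∘ Γ) q₀) :=
        (ha.contDiffOn_inChart (Γ q₀)).contDiffAt (hT.mem_nhds
          ⟨htgt _ hq₀', by
            change φ.symm (φ (Γ q₀)) ∈ S
            rw [hsymm _ hq₀']; exact hOS _ hq₀⟩)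
      have e2 := hG.contDiffAt (hO'.mem_nhds hq₀')
      exact (e1.comp q₀ e2).clm_comp (e2.fderiv_right (m := ∞) (by simp))
    · filter_upwards [hO'.mem_nhds hq₀'] with q hq
      ext h
      refine (OneForm.apply_congr a (hsymm q hq).symm _).trans ?_
      exact congrArg (a (φ.symm (φ (Γ q)))) (hmf q hq h)
    · intro h k
      have hT : IsOpen (φ.target ∩ φ.symm ⁻¹' S) := φ.isOpen_inter_preimage_symm hS
      have hmem : φ (Γ q₀) ∈ φ.target ∩ φ.symm ⁻¹' S := ⟨htgt _ hq₀', by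
            change φ.symm (φ (Γ q₀)) ∈ S
            rw [hsymm _ hq₀']; exact hOS _ hq₀⟩
      have e1 : HasFDerivAt (OneForm.inChart E a (Γ q₀))
          (fderiv ℝ (OneForm.inChart E a (Γ q₀)) (φ (Γ q₀))) (φ (Γ q₀)) :=
        (((ha.contDiffOn_inChart (Γ q₀)).contDiffAt (hT.mem_nhds hmem)).differentiableAt
          (by simp)).hasFDerivAt
      have e2 := hG.contDiffAt (hO'.mem_nhds hq₀')
      have e3 : HasFDerivAt (fderiv ℝ (φ ∘ Γ)) (fderiv ℝ (fderiv ℝ (φ ∘ Γ)) q₀) q₀ :=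
        ((e2.fderiv_right (m := ∞) (by simp)).differentiableAt (by simp)).hasFDerivAt
      have e4 := (HasFDerivAt.comp (f := φ ∘ Γ) q₀ e1 (hGd q₀ hq₀')).clm_comp e3
      -- The product rule produces a term with the second derivative of `φ ∘ Γ`. Its symmetry makes
      -- that term drop out of the antisymmetrised derivative.
      have e5 : fderiv ℝ (fderiv ℝ (φ ∘ Γ)) q₀ h k = fderiv ℝ (fderiv ℝ (φ ∘ Γ)) q₀ k h :=
        (e2.isSymmSndFDerivAt (by simp; exact WithTop.coe_le_coe.2 le_top)) h k
      have e6 : ∀ h k, fderiv ℝ (fun q => (OneForm.inChart E a (Γ q₀) (φ (Γ q))).comp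
          (fderiv ℝ (φ ∘ Γ) q)) q₀ h k =
          OneForm.inChart E a (Γ q₀) (φ (Γ q₀)) (fderiv ℝ (fderiv ℝ (φ ∘ Γ)) q₀ h k) +
          fderiv ℝ (OneForm.inChart E a (Γ q₀)) (φ (Γ q₀)) (fderiv ℝ (φ ∘ Γ) q₀ h)
            (fderiv ℝ (φ ∘ Γ) q₀ k) := fun h k => by
        exact DFunLike.congr_fun (DFunLike.congr_fun e4.fderiv h) k
      rw [e6, e6, e5, add_sub_add_left_eq_sub]
      refine (hab (Γ q₀) (φ (Γ q₀)) (htgt _ hq₀') hmem.2 _ _).trans ?_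
      refine Eq.trans ?_ (TwoForm.apply_congr b (hsymm _ hq₀') _ _)
      exact (congrArg₂ (fun u v : E => b (φ.symm (φ (Γ q₀))) u v) (hmf q₀ hq₀' h)
        (hmf q₀ hq₀' k)).symm
  refine ⟨P, fun _ _ => rfl, fun q hq => ?_, fun q hq h k => ?_⟩
  · obtain ⟨p, hp, heq, -⟩ := main q hq
    exact (hp.congr_of_eventuallyEq heq).contDiffWithinAt
  · obtain ⟨p, hp, heq, hd⟩ := main q hq
    rw [Filter.EventuallyEq.fderiv_eq heq]
    exact hd h k

end Naturality

/-! ### Curves, and slopes of circle-valued functions along them -/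

section Curve

variable {E : Type*} [NormedAddCommGroup E] [NormedSpace ℝ E]
  {X : Type*} [TopologicalSpace X] [ChartedSpace E X] [IsManifold 𝓘(ℝ, E) ∞ X]

/-- Every tangent vector is the velocity of a smooth curve. -/
theorem exists_curve (x : X) (v : TangentSpace 𝓘(ℝ, E) x) {W : Set X} (hW : IsOpen W)
    (hx : x ∈ W) : ∃ (c : ℝ → X) (T : Set ℝ), IsOpen T ∧ (0 : ℝ) ∈ T ∧
      ContMDiffOn 𝓘(ℝ, ℝ) 𝓘(ℝ, E) ∞ c T ∧ (∀ e ∈ T, c e ∈ W) ∧ c 0 = x ∧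
      (mfderiv 𝓘(ℝ, ℝ) 𝓘(ℝ, E) c 0 (1 : ℝ) : E) = v := by
  set φ := chartAt E x with hφ
  have hxs : x ∈ φ.source := mem_chart_source E x
  let w : E := mfderiv 𝓘(ℝ, E) 𝓘(ℝ, E) φ x v
  -- In the chart the curve is the straight line in the direction of the image of `v`, restricted to
  -- the parameters for which it stays in `φ.target` and in the preimage of `W`.
  let l : ℝ → E := fun e => φ x + e • w
  have hl : ContDiff ℝ ∞ l := contDiff_const.add (contDiff_id.smul contDiff_const)
  have hl0 : l 0 = φ x := by simp [l]
  have hc0 : φ.symm (l 0) = x := by rw [hl0, φ.left_inv hxs]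
  refine ⟨φ.symm ∘ l, l ⁻¹' (φ.target ∩ φ.symm ⁻¹' W),
    (φ.isOpen_inter_preimage_symm hW).preimage hl.continuous,
    ⟨by rw [hl0]; exact φ.map_source hxs, by simpa only [Set.mem_preimage, hc0] using hx⟩,
    (contMDiffOn_chart_symm (I := 𝓘(ℝ, E)) (n := ∞) (x := x)).comp hl.contMDiff.contMDiffOn
      fun e he => he.1, fun e he => he.2, hc0, ?_⟩
  have h1 : HasMFDerivAt 𝓘(ℝ, E) 𝓘(ℝ, E) φ.symm (φ x)
      (mfderiv 𝓘(ℝ, E) 𝓘(ℝ, E) φ.symm (φ x)) :=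
    (((contMDiffOn_chart_symm (I := 𝓘(ℝ, E)) (n := ∞) (x := x)).contMDiffAt
      (φ.open_target.mem_nhds (φ.map_source hxs))).mdifferentiableAt (by simp)).hasMFDerivAt
  have h2 : HasMFDerivAt 𝓘(ℝ, E) 𝓘(ℝ, E) φ x (mfderiv 𝓘(ℝ, E) 𝓘(ℝ, E) φ x) :=
    (((contMDiffOn_chart (I := 𝓘(ℝ, E)) (n := ∞) (x := x)).contMDiffAt
      (φ.open_source.mem_nhds hxs)).mdifferentiableAt (by simp)).hasMFDerivAt
  have h3 := (h1.comp x h2).congr_of_eventuallyEq (f₁ := id) (by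
    filter_upwards [φ.open_source.mem_nhds hxs] with y hy
    exact (φ.left_inv hy).symm)
  have h4 := DFunLike.congr_fun (hasMFDerivAt_unique (hasMFDerivAt_id x) h3) v
  have h5 : HasMFDerivAt 𝓘(ℝ, ℝ) 𝓘(ℝ, E) l 0 ((ContinuousLinearMap.id ℝ ℝ).smulRight w) :=
    (((hasFDerivAt_id (0 : ℝ)).smul_const w).const_add (φ x)).hasMFDerivAt
  rw [← hl0] at h1
  rw [(h1.comp 0 h5).mfderiv]
  have h6 : ∀ z : E, z = φ x → (mfderiv 𝓘(ℝ, E) 𝓘(ℝ, E) φ.symm z ((1 : ℝ) • w : E) : E) =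
      mfderiv 𝓘(ℝ, E) 𝓘(ℝ, E) φ.symm (φ x) w := by rintro z rfl; rw [one_smul]
  exact (h6 _ hl0).trans h4.symm

end Curve

/-- The circle-valued function `f` of a real variable has derivative `r` at `s`. -/
def HasCircleSlopeAt (f : ℝ → UnitAddCircle) (r s : ℝ) : Prop :=
  HasCircleDerivAt ℝ f s ((ContinuousLinearMap.id ℝ ℝ).smulRight r)

namespace HasCircleSlopeAt

variable {f k : ℝ → UnitAddCircle} {r r' s : ℝ}

theorem add (h : HasCircleSlopeAt f r s) (h' : HasCircleSlopeAt k r' s) :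
    HasCircleSlopeAt (fun e => f e + k e) (r + r') s :=
  (HasCircleDerivAt.add h h').congr_deriv (by
    ext; exact (mul_add (1 : ℝ) r r').symm)

theorem neg (h : HasCircleSlopeAt f r s) : HasCircleSlopeAt (fun e => - f e) (-r) s :=
  (HasCircleDerivAt.neg h).congr_deriv (by
    ext; exact (mul_neg (1 : ℝ) r).symm)

theorem sub (h : HasCircleSlopeAt f r s) (h' : HasCircleSlopeAt k r' s) :
    HasCircleSlopeAt (fun e => f e - k e) (r - r') s := by
  simpa only [sub_eq_add_neg] using h.add h'.neg

theorem congr (h : HasCircleSlopeAt f r s) (h₁ : ∀ᶠ e in 𝓝 s, k e = f e) :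
    HasCircleSlopeAt k r s := HasCircleDerivAt.congr h h₁

theorem congr_slope (h : HasCircleSlopeAt f r s) (h₁ : r = r') : HasCircleSlopeAt f r' s := h₁ ▸ h

theorem unique (h : HasCircleSlopeAt f r s) (h' : HasCircleSlopeAt f r' s) : r = r' := by
  have h1 : (1 : ℝ) * r = 1 * r' := DFunLike.congr_fun (HasCircleDerivAt.unique h h') (1 : ℝ)
  simpa using h1

end HasCircleSlopeAt

theorem hasCircleSlopeAt_coe {g : ℝ → ℝ} {r s : ℝ} (h : HasDerivAt g r s) :
    HasCircleSlopeAt (fun e => (g e : UnitAddCircle)) r s := by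
  refine ⟨g, Filter.Eventually.of_forall fun _ => rfl, ?_⟩
  have h1 : (ContinuousLinearMap.id ℝ ℝ).smulRight r = ContinuousLinearMap.toSpanSingleton ℝ r := by
    ext; simp
  rw [h1]
  exact h.hasFDerivAt.hasMFDerivAt

theorem hasCircleSlopeAt_const (c : UnitAddCircle) (s : ℝ) :
    HasCircleSlopeAt (fun _ => c) 0 s :=
  (hasCircleDerivAt_const c s).congr_deriv (by ext; exact (mul_zero (1 : ℝ)).symm)

theorem HasCircleDerivAt.hasCircleSlopeAt {E : Type*} [NormedAddCommGroup E] [NormedSpace ℝ E]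
    {X : Type*} [TopologicalSpace X] [ChartedSpace E X] {f : X → UnitAddCircle} {c : ℝ → X} {s : ℝ}
    {f' : TangentSpace 𝓘(ℝ, E) (c s) →L[ℝ] ℝ}
    {c' : TangentSpace 𝓘(ℝ, ℝ) s →L[ℝ] TangentSpace 𝓘(ℝ, E) (c s)}
    (h : HasCircleDerivAt E f (c s) f') (hc : HasMFDerivAt 𝓘(ℝ, ℝ) 𝓘(ℝ, E) c s c') :
    HasCircleSlopeAt (fun e => f (c e)) (f' (c' (1 : ℝ))) s :=
  (h.comp hc).congr_deriv (by ext; exact (one_mul _).symm)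

theorem eq_of_hasCircleSlopeAt_zero {f : ℝ → UnitAddCircle} {S : Set ℝ} (hS : IsOpen S)
    (hS' : Convex ℝ S) (h : ∀ s ∈ S, HasCircleSlopeAt f 0 s) {a b : ℝ} (ha : a ∈ S)
    (hb : b ∈ S) : f a = f b :=
  eq_of_hasCircleDerivAt_zero hS hS'
    (fun s hs => (h s hs).congr_deriv (by ext; exact mul_zero (1 : ℝ))) ha hb

/-! ### The derivative of the holonomy -/

namespace PrincipalTorusBundle

variable {J : Type*} [Fintype J]
  {E : Type*} [NormedAddCommGroup E] [NormedSpace ℝ E]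
  {M : Type*} [TopologicalSpace M] [ChartedSpace E M]
  {E' : Type*} [NormedAddCommGroup E'] [NormedSpace ℝ E'] [FiniteDimensional ℝ E']
  {X : Type*} [TopologicalSpace X] [ChartedSpace E' X] [IsManifold 𝓘(ℝ, E') ∞ X]
  {ι : Type*} {U : ι → Set M}
  (P : PrincipalTorusBundle J E M E' X U)

/-- The derivative of the holonomy around the orbits of a circle is the contraction of the
curvature with the generator of that circle. -/
theorem circleDeriv_holonomy {W : Set X} (hW : IsOpen W) (hWact : ∀ t, ∀ x ∈ W, P.act t x ∈ W)
    (L : LineBundleConn E' X W) {b : TwoForm E' X}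
    (hb : ∀ i, HasExtDerivOn E' (L.form i) b (L.dom i))
    (hinv : ∀ t, ∀ x ∈ W, ∀ u v, b (P.act t x) (P.actDeriv t x u) (P.actDeriv t x v) = b x u v)
    (j : J) {lam : X → UnitAddCircle}
    (hol : ∀ x ∈ W, L.IsHolonomy (P.orbit j x) (P.orbitVelocity j x) (lam x))
    {x : X} (hx : x ∈ W) (hlam : SmoothCircleAt 𝓘(ℝ, E') lam x) (v : TangentSpace 𝓘(ℝ, E') x) :
    circleDeriv E' lam x v = b x v (P.fund j x) := by
  classical
  obtain ⟨c, T, hT, h0T, hc, hcW, hc0, hcv⟩ := exists_curve x v hW hx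
  set C : ℝ := b x v (P.fund j x) with hC
  -- The surface swept out by the orbits: `e` labels the loop through `c e`, and `s` is time along
  -- it.
  let Γ : ℝ × ℝ → X := fun q => P.orbit j (c q.1) q.2
  have hO : IsOpen {q : ℝ × ℝ | q.1 ∈ T} := hT.preimage continuous_fst
  have hΓ : ContMDiffOn 𝓘(ℝ, ℝ × ℝ) 𝓘(ℝ, E') ∞ Γ {q | q.1 ∈ T} := by
    intro q hq
    refine ContMDiffAt.contMDiffWithinAt ?_
    refine P.contMDiffAt_act (I := 𝓘(ℝ, ℝ × ℝ)) (c := fun q : ℝ × ℝ => toTorus (q.2 • Pi.single j (1 : ℝ)))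
      (f := fun q => c q.1) (fun k => ?_) ?_
    · have h1 : ContDiff ℝ ∞ (fun q : ℝ × ℝ => (q.2 • (Pi.single j (1 : ℝ) : J → ℝ)) k) := by
        simp only [Pi.smul_apply, smul_eq_mul]
        exact contDiff_snd.mul contDiff_const
      have h2 : ContMDiff 𝓘(ℝ, ℝ × ℝ) 𝓘(ℝ, ℝ) ∞ _ := h1.contMDiff
      exact smoothCircleAt_coe h2.contMDiffAt
    · have h1 : ContMDiff 𝓘(ℝ, ℝ × ℝ) 𝓘(ℝ, ℝ) ∞ (fun q : ℝ × ℝ => q.1) := contDiff_fst.contMDiff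
      exact ContMDiffAt.comp q (hc.contMDiffAt (hT.mem_nhds hq)) h1.contMDiffAt
  have hΓd : ∀ q : ℝ × ℝ, q.1 ∈ T → HasMFDerivAt 𝓘(ℝ, ℝ × ℝ) 𝓘(ℝ, E') Γ q
      (mfderiv 𝓘(ℝ, ℝ × ℝ) 𝓘(ℝ, E') Γ q) := fun q hq =>
    ((hΓ.contMDiffAt (hO.mem_nhds hq)).mdifferentiableAt (by simp)).hasMFDerivAt
  -- the partial derivatives of `Γ`
  have hΓs : ∀ e s : ℝ, e ∈ T → (mfderiv 𝓘(ℝ, ℝ × ℝ) 𝓘(ℝ, E') Γ (e, s) ((0 : ℝ), (1 : ℝ)) : E') =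
      P.orbitVelocity j (c e) s := by
    intro e s he
    have h1 : HasMFDerivAt 𝓘(ℝ, ℝ) 𝓘(ℝ, ℝ × ℝ) (fun s : ℝ => (e, s)) s
        (ContinuousLinearMap.inr ℝ ℝ ℝ) := (hasFDerivAt_prodMk_right e s).hasMFDerivAt
    have h2 := HasMFDerivAt.comp (f := fun s : ℝ => (e, s)) s (hΓd (e, s) he) h1
    exact (DFunLike.congr_fun (hasMFDerivAt_unique (P.hasMFDerivAt_orbit j (c e) s) h2) (1 : ℝ)).symm
  let G : ℝ → ℝ → X := fun s e => P.orbit j (c e) s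
  have hGd : ∀ s : ℝ, HasMFDerivAt 𝓘(ℝ, ℝ) 𝓘(ℝ, E') (G s) 0 (mfderiv 𝓘(ℝ, ℝ) 𝓘(ℝ, E') (G s) 0) ∧
      (mfderiv 𝓘(ℝ, ℝ × ℝ) 𝓘(ℝ, E') Γ (0, s) ((1 : ℝ), (0 : ℝ)) : E') =
      mfderiv 𝓘(ℝ, ℝ) 𝓘(ℝ, E') (G s) 0 (1 : ℝ) := by
    intro s
    have h1 : HasMFDerivAt 𝓘(ℝ, ℝ) 𝓘(ℝ, ℝ × ℝ) (fun e : ℝ => (e, s)) 0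
        (ContinuousLinearMap.inl ℝ ℝ ℝ) := (hasFDerivAt_prodMk_left (0 : ℝ) s).hasMFDerivAt
    have h2 := HasMFDerivAt.comp (f := fun e : ℝ => (e, s)) 0 (hΓd (0, s) h0T) h1
    have h3 : HasMFDerivAt 𝓘(ℝ, ℝ) 𝓘(ℝ, E') (G s) 0 _ := h2
    refine ⟨h3.mdifferentiableAt.hasMFDerivAt, ?_⟩
    rw [h3.mfderiv]
    rfl
  have hcd : HasMFDerivAt 𝓘(ℝ, ℝ) 𝓘(ℝ, E') c 0 (mfderiv 𝓘(ℝ, ℝ) 𝓘(ℝ, E') c 0) :=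
    ((hc.contMDiffAt (hT.mem_nhds h0T)).mdifferentiableAt (by simp)).hasMFDerivAt
  -- Along the orbit of `c 0`, both the variation field and the orbit velocity are the translates of
  -- their values at time `0`. Invariance of `b` therefore makes the curvature on this pair a
  -- constant.
  have hbC : ∀ s : ℝ, b (Γ (0, s)) (mfderiv 𝓘(ℝ, ℝ × ℝ) 𝓘(ℝ, E') Γ (0, s) ((1 : ℝ), (0 : ℝ)))
      (mfderiv 𝓘(ℝ, ℝ × ℝ) 𝓘(ℝ, E') Γ (0, s) ((0 : ℝ), (1 : ℝ))) = C := by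
    intro s
    set t : Torus J := toTorus (s • Pi.single j (1 : ℝ)) with ht
    have h1 : (mfderiv 𝓘(ℝ, ℝ) 𝓘(ℝ, E') (G s) 0 (1 : ℝ) : E') =
        P.actDeriv t (c 0) (mfderiv 𝓘(ℝ, ℝ) 𝓘(ℝ, E') c 0 (1 : ℝ)) :=
      DFunLike.congr_fun ((P.hasMFDerivAt_act t (c 0)).comp 0 hcd).mfderiv (1 : ℝ)
    have h2 : (P.orbitVelocity j (c 0) s : E') = P.actDeriv t (c 0) (P.fund j (c 0)) :=
      (P.orbitVelocity_eq j (c 0) s).trans (P.fund_act j t (c 0))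
    have h3 := hinv t (c 0) (hcW 0 h0T) (mfderiv 𝓘(ℝ, ℝ) 𝓘(ℝ, E') c 0 (1 : ℝ)) (P.fund j (c 0))
    refine (congrArg₂ (fun u w : E' => b (Γ (0, s)) u w) (((hGd s).2).trans h1)
      ((hΓs 0 s h0T).trans h2)).trans (h3.trans ?_)
    have h4 : ∀ y, y = x → b y (mfderiv 𝓘(ℝ, ℝ) 𝓘(ℝ, E') c 0 (1 : ℝ) : E') (P.fund j y) =
        b x (v : E') (P.fund j x) := by
      rintro y rfl
      exact congrArg (fun u : E' => b y u (P.fund j y)) hcv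
    exact h4 _ hc0
  -- the horizontal lifts, normalised
  have hu : ∀ e : ℝ, ∃ u : L.idx → ℝ → UnitAddCircle, e ∈ T →
      (∀ i k s, Γ (e, s) ∈ L.dom i → Γ (e, s) ∈ L.dom k →
        u i s - u k s = - L.trans i k (Γ (e, s))) ∧
      (∀ i s, Γ (e, s) ∈ L.dom i → HasCircleSlopeAt (u i)
        (- L.form i (Γ (e, s)) (P.orbitVelocity j (c e) s)) s) ∧
      (∀ i, Γ (e, 0) ∈ L.dom i → u i 1 = u i 0 - lam (c e)) := by
    intro e
    by_cases he : e ∈ T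
    · obtain ⟨u, h1, h2, h3⟩ := hol (c e) (hcW e he)
      refine ⟨u, fun _ => ⟨h1, fun i s hs => ?_, h3⟩⟩
      obtain ⟨g, hg, hgd⟩ := h2 i s hs
      exact (hasCircleSlopeAt_coe hgd).congr hg
    · exact ⟨fun _ _ => 0, fun h => absurd h he⟩
  choose u hu using hu
  have hdom : ∀ s : ℝ, ∃ i, Γ (0, s) ∈ L.dom i := by
    intro s
    have : Γ (0, s) ∈ ⋃ i, L.dom i := by
      rw [L.iUnion_dom]
      exact hWact _ _ (hcW 0 h0T)
    simpa using this
  obtain ⟨i₀, hi₀⟩ := hdom 0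
  let κ : L.idx → (ℝ → X) → ℝ := fun i g => L.form i (g 0) (mfderiv 𝓘(ℝ, ℝ) 𝓘(ℝ, E') g 0 (1 : ℝ))
  let w₀ : ℝ := κ i₀ (G 0)
  -- The statement carried along the loop. The lifts are chosen separately for each `e` and need not
  -- depend on `e` regularly, so only their increment from time `0` has a slope. With `κ` the
  -- connection form on the variation field, Stokes on the strip from time `0` to `s` gives `κ` at
  -- time `0`, minus `C * s`, minus `κ` at time `s`.
  let D : L.idx → ℝ → Prop := fun i s =>
    HasCircleSlopeAt (fun e => u e i s - u e i₀ 0) (w₀ - C * s - κ i (G s)) 0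
  have hnear : ∀ i s, Γ (0, s) ∈ L.dom i → ∀ᶠ e in 𝓝 (0 : ℝ), e ∈ T ∧ Γ (e, s) ∈ L.dom i := by
    intro i s hs
    have h1 : ContinuousAt (G s) 0 := (hGd s).1.continuousAt
    filter_upwards [hT.mem_nhds h0T, h1.preimage_mem_nhds ((L.isOpen_dom i).mem_nhds hs)]
      with e he he'
    exact ⟨he, he'⟩
  -- change of frame
  have hframe : ∀ i k s, Γ (0, s) ∈ L.dom i → Γ (0, s) ∈ L.dom k → D k s → D i s := by
    intro i k s hi hk hD
    have h2 : HasCircleSlopeAt (fun e => L.trans i k (G s e)) (κ i (G s) - κ k (G s)) 0 :=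
      (L.form_glue i k (Γ (0, s)) hi hk).hasCircleSlopeAt (c := G s) (hGd s).1
    refine (((show HasCircleSlopeAt _ _ _ from hD).sub h2).congr
      (k := fun e => u e i s - u e i₀ 0) ?_).congr_slope (by ring)
    filter_upwards [hnear i s hi, hnear k s hk] with e h3 h4
    have h5 := (hu e h3.1).1 i k s h3.2 h4.2
    have h6 : L.trans i k (G s e) = - (u e i s - u e k s) := by rw [h5, neg_neg]
    rw [h6]
    abel
  -- transport along the orbit
  have hlocal : ∀ i s₀, Γ (0, s₀) ∈ L.dom i →
      ∀ᶠ s in 𝓝 s₀, Γ (0, s) ∈ L.dom i ∧ (D i s ↔ D i s₀) := by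
    intro i s₀ hs₀
    have hOi : IsOpen ({q : ℝ × ℝ | q.1 ∈ T} ∩ Γ ⁻¹' L.dom i) :=
      hΓ.continuousOn.isOpen_inter_preimage hO (L.isOpen_dom i)
    obtain ⟨p, hpΓ, hp, hpd⟩ := (hb i).pullback (L.isOpen_dom i) (L.form_smooth i) hOi
      (hΓ.mono Set.inter_subset_left) fun q hq => hq.2
    have hpdiff : ∀ q ∈ {q : ℝ × ℝ | q.1 ∈ T} ∩ Γ ⁻¹' L.dom i, HasFDerivAt p (fderiv ℝ p q) q :=
      fun q hq => ((hp.contDiffAt (hOi.mem_nhds hq)).differentiableAt (by simp)).hasFDerivAt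
    have hdp : ContinuousOn (fun q => fderiv ℝ p q) ({q : ℝ × ℝ | q.1 ∈ T} ∩ Γ ⁻¹' L.dom i) :=
      hp.continuousOn_fderiv_of_isOpen hOi (by simp)
    -- Here `A` is the component of the pulled-back connection form along the orbits and `b` its
    -- component along the variation. The equation relating them is the exterior derivative, whose
    -- value on the coordinate vectors at `e = 0` is `C`.
    obtain ⟨δ, hδ, hδO, hint⟩ := exists_hasDerivAt_integral (A := fun q => p q (0, 1))
      (A' := fun q => fderiv ℝ p q (1, 0) (0, 1)) (b := fun s => p (0, s) (1, 0)) (c := C)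
      (s₀ := s₀) hOi (hp.continuousOn.clm_apply continuousOn_const)
      ((hdp.clm_apply continuousOn_const).clm_apply continuousOn_const)
      (fun e s hes => by
        have h2 : HasDerivAt (fun e : ℝ => (e, s)) ((1 : ℝ), (0 : ℝ)) e :=
          (hasDerivAt_id e).prodMk (hasDerivAt_const e s)
        have h3 := (hpdiff _ hes).comp_hasDerivAt e h2
        have h4 := ((ContinuousLinearMap.apply ℝ ℝ ((0 : ℝ), (1 : ℝ))).hasFDerivAt
          (x := p (e, s))).comp_hasDerivAt e h3
        exact h4)
      ⟨h0T, hs₀⟩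
      (fun s hs => by
        have h2 : HasDerivAt (fun s : ℝ => ((0 : ℝ), s)) ((0 : ℝ), (1 : ℝ)) s :=
          (hasDerivAt_const s (0 : ℝ)).prodMk (hasDerivAt_id s)
        have h3 := (hpdiff _ hs).comp_hasDerivAt s h2
        have h4 := ((ContinuousLinearMap.apply ℝ ℝ ((1 : ℝ), (0 : ℝ))).hasFDerivAt
          (x := p (0, s))).comp_hasDerivAt s h3
        have h5 := (hpd _ hs (1, 0) (0, 1)).trans (hbC s)
        refine h4.congr_deriv ?_
        change fderiv ℝ p (0, s) (0, 1) (1, 0) = fderiv ℝ p (0, s) (1, 0) (0, 1) - C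
        rw [← h5]
        ring)
    have hκ : ∀ s, p (0, s) (1, 0) = κ i (G s) := fun s =>
      (hpΓ (0, s) (1, 0)).trans (congrArg (fun w : E' => L.form i (Γ (0, s)) w) (hGd s).2)
    have hstep : ∀ s s', |s - s₀| < δ → |s' - s₀| < δ → D i s' → D i s := by
      intro s s' hs hs' hD
      have h1 : ∀ e : ℝ, |e| < δ →
          u e i s = u e i s' - ((∫ r in s'..s, p (e, r) (0, 1) : ℝ) : UnitAddCircle) := by
        intro e he
        have heT : e ∈ T := (hδO e s he hs).1
        have hmem : ∀ r ∈ Metric.ball s₀ δ, (e, r) ∈ {q : ℝ × ℝ | q.1 ∈ T} ∩ Γ ⁻¹' L.dom i :=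
          fun r hr => hδO e r he (by simpa [Real.dist_eq] using hr)
        have hcont : ContinuousOn (fun r : ℝ => p (e, r) (0, 1)) (Metric.ball s₀ δ) :=
          (hp.continuousOn.clm_apply (continuousOn_const (c := ((0 : ℝ), (1 : ℝ))))).comp
            (f := fun r : ℝ => (e, r)) (by fun_prop) hmem
        have hs'b : s' ∈ Metric.ball s₀ δ := by simpa [Real.dist_eq] using hs'
        have hsb : s ∈ Metric.ball s₀ δ := by simpa [Real.dist_eq] using hs
        have hconv : Convex ℝ (Metric.ball s₀ δ) := convex_ball s₀ δ
        -- Horizontality means that the fibre coordinate plus the integral of the connection form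
        -- has slope zero, so the increment of the lift is minus that integral in `ℝ/ℤ`.
        have h2 : ∀ r ∈ Metric.ball s₀ δ, HasCircleSlopeAt
            (fun r => u e i r + ((∫ r in s'..r, p (e, r) (0, 1) : ℝ) : UnitAddCircle)) 0 r := by
          intro r hr
          have h3 := (hu e heT).2.1 i r (hmem r hr).2
          have h4 : HasDerivAt (fun r => ∫ r in s'..r, p (e, r) (0, 1)) (p (e, r) (0, 1)) r := by
            refine intervalIntegral.integral_hasDerivAt_right ?_ ?_ ?_
            · exact (hcont.mono (hconv.ordConnected.uIcc_subset hs'b hr)).intervalIntegrable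
            · exact hcont.stronglyMeasurableAtFilter Metric.isOpen_ball r hr
            · exact hcont.continuousAt (Metric.isOpen_ball.mem_nhds hr)
          have h5 : p (e, r) (0, 1) = L.form i (Γ (e, r)) (P.orbitVelocity j (c e) r) :=
            (hpΓ (e, r) (0, 1)).trans
              (congrArg (fun w : E' => L.form i (Γ (e, r)) w) (hΓs e r heT))
          exact (h3.add (hasCircleSlopeAt_coe h4)).congr_slope (by rw [h5, neg_add_cancel])
        have h3 := eq_of_hasCircleSlopeAt_zero Metric.isOpen_ball hconv h2 hsb hs'b
        simp only [intervalIntegral.integral_same, AddCircle.coe_zero, add_zero] at h3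
        rw [← h3, add_sub_cancel_right]
      refine (((show HasCircleSlopeAt _ _ _ from hD).sub
        (hasCircleSlopeAt_coe (hint s s' hs hs'))).congr
        (k := fun e => u e i s - u e i₀ 0) ?_).congr_slope (by simp only [hκ]; ring)
      filter_upwards [Metric.ball_mem_nhds (0 : ℝ) hδ] with e he
      rw [h1 e (by simpa [Real.dist_eq] using he)]
      abel
    filter_upwards [Metric.ball_mem_nhds s₀ hδ] with s hs
    have hs' : |s - s₀| < δ := by simpa [Real.dist_eq] using hs
    have hs₀' : |s₀ - s₀| < δ := by simpa using hδ
    exact ⟨(hδO 0 s (by simpa using hδ) hs').2, hstep _ _ hs₀' hs', hstep _ _ hs' hs₀'⟩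
  -- Change of frame removes the dependence on `i`, and local transport works in both directions.
  -- Connectedness of `ℝ` then carries the formula from time `0` to time `1`, in place of a finite
  -- subdivision of the loop by frames.
  have hconst : IsLocallyConstant fun s : ℝ => ∃ i, Γ (0, s) ∈ L.dom i ∧ D i s := by
    rw [IsLocallyConstant.iff_eventually_eq]
    intro s₀
    obtain ⟨i, hi⟩ := hdom s₀
    filter_upwards [hlocal i s₀ hi] with s hs
    refine propext ⟨?_, ?_⟩
    · rintro ⟨k, hk, hD⟩
      exact ⟨i, hi, hs.2.1 (hframe i k s hs.1 hk hD)⟩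
    · rintro ⟨k, hk, hD⟩
      exact ⟨i, hs.1, hs.2.2 (hframe i k s₀ hi hk hD)⟩
  have h01 := hconst.apply_eq_of_isPreconnected isPreconnected_univ (Set.mem_univ 0) (Set.mem_univ 1)
  have hD0 : D i₀ 0 :=
    ((hasCircleSlopeAt_const 0 0).congr (k := fun e => u e i₀ 0 - u e i₀ 0)
      (Filter.Eventually.of_forall fun e => sub_self _)).congr_slope (by simp [w₀])
  obtain ⟨k, hk, hDk⟩ := h01.mp ⟨i₀, hi₀, hD0⟩
  have hΓ1 : Γ (0, 1) = Γ (0, 0) := (P.orbit_one j (c 0)).trans (P.orbit_zero j (c 0)).symm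
  have hD1 : D i₀ 1 := hframe i₀ k 1 (by rw [hΓ1]; exact hi₀) hk hDk
  have hG1 : G 1 = G 0 := funext fun e => (P.orbit_one j (c e)).trans (P.orbit_zero j (c e)).symm
  -- At time `1` the loop has closed up, so the two values of `κ` cancel and the increment of the
  -- lift, which is `- lam (c e)`, has slope `-C`.
  have h1 : HasCircleSlopeAt (fun e => lam (c e)) C 0 := by
    refine ((show HasCircleSlopeAt _ _ _ from hD1).neg.congr (k := fun e => lam (c e))
      ?_).congr_slope (by rw [hG1]; simp [w₀])
    filter_upwards [hnear i₀ 0 hi₀] with e he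
    rw [(hu e he.1).2.2 i₀ he.2]
    abel
  have h2 := (hlam.hasCircleDerivAt.congr_point hc0.symm).hasCircleSlopeAt hcd
  have h4 : circleDeriv E' lam x (mfderiv 𝓘(ℝ, ℝ) 𝓘(ℝ, E') c 0 (1 : ℝ) : E') =
      circleDeriv E' lam x v := congrArg (fun w : E' => circleDeriv E' lam x w) hcv
  exact h4.symm.trans (h2.unique h1)

end PrincipalTorusBundle
-- Horizontal functions and the `B₁`-component of the shifted curving
section Basic

variable {J : Type*} [Fintype J]
  {E : Type*} [NormedAddCommGroup E] [NormedSpace ℝ E]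
  {M : Type*} [TopologicalSpace M] [ChartedSpace E M]
  {E' : Type*} [NormedAddCommGroup E'] [NormedSpace ℝ E']
  {X : Type*} [TopologicalSpace X] [ChartedSpace E' X]
  {ι : Type*} {U : ι → Set M}

namespace PrincipalTorusBundle

variable (P : PrincipalTorusBundle J E M E' X U)

/-- The gluing functions are smooth. -/
theorem smoothCircleAt_gluing {lam : ι → ι → M → Torus J} (hlam : P.HasGluing lam) {α β : ι} {m : M}
    (hα : m ∈ U α) (hβ : m ∈ U β) (j : J) :
    SmoothCircleAt 𝓘(ℝ, E) (fun m => lam α β m j) m := by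
  -- On the section over `U α` the coordinate `θ_α` vanishes, so the gluing function is simply `θ_β`
  -- there.
  have h1 : SmoothCircleAt 𝓘(ℝ, E') (fun x => P.coord β x j) (P.sect α m) :=
    P.smoothCircleAt_coord (by rwa [P.proj_sect hα]) j
  refine (h1.comp (P.contMDiffAt_sect hα)).congr ?_
  filter_upwards [(P.isOpen_cover α).mem_nhds hα, (P.isOpen_cover β).mem_nhds hβ] with y hy hy'
  have := congrFun (hlam α β (P.sect α y) (by rwa [P.proj_sect hy]) (by rwa [P.proj_sect hy])) j
  rw [P.coord_sect hy, P.proj_sect hy] at this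
  simpa using this.symm

/-- A circle-valued function whose differential is horizontal is constant on the fibres. -/
theorem apply_act_eq_of_horizontal {f : X → UnitAddCircle} {a : OneForm E' X} {S : Set M}
    (hf : ∀ y, P.proj y ∈ S → HasCircleDerivAt E' f y (a y))
    (ha : ∀ y k, P.proj y ∈ S → a y (P.fund k y) = 0) {x : X} (hx : P.proj x ∈ S) (t : Torus J) :
    f (P.act t x) = f x := by
  obtain ⟨r, rfl⟩ := toTorus_surjective t
  -- Pulled back to the covering `ℝ^J` of the fibre, `f` has zero differential, because the
  -- derivative of the orbit map is spanned by the fundamental fields.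
  have h1 : ∀ s : J → ℝ, HasCircleDerivAt (J → ℝ) (fun s => f (P.act (toTorus s) x)) s 0 := by
    intro s
    have hs : P.proj (P.act (toTorus s) x) ∈ S := by rwa [P.proj_act]
    refine (HasCircleDerivAt.comp (c := fun s : J → ℝ => P.act (toTorus s) x) (hf _ hs)
      (P.hasMFDerivAt_act_toTorus x s)).congr_deriv ?_
    ext w
    have e1 : ∀ (A : E' →L[ℝ] ℝ) (g : J → E') (z : E') (w : J → ℝ), z = (∑ j, w j • g j) →
        (∀ j, A (g j) = 0) → A z = 0 := fun A g z w hz hA => by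
      rw [hz, map_sum]
      exact Finset.sum_eq_zero fun j _ => by rw [map_smul, hA, smul_zero]
    exact e1 _ _ _ w (P.mfderiv_act_toTorus x s w) fun j => ha _ j hs
  have h2 := eq_of_hasCircleDerivAt_zero (a := r) (b := 0) isOpen_univ convex_univ
    (fun s _ => h1 s) (Set.mem_univ _) (Set.mem_univ _)
  simpa [P.act_zero] using h2

theorem apply_eq_of_horizontal {f : X → UnitAddCircle} {a : OneForm E' X} {S : Set M}
    (hf : ∀ y, P.proj y ∈ S → HasCircleDerivAt E' f y (a y))
    (ha : ∀ y k, P.proj y ∈ S → a y (P.fund k y) = 0) {x y : X} (hx : P.proj x ∈ S)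
    (hxy : P.proj x = P.proj y) : f x = f y := by
  obtain ⟨α, hα⟩ := P.cover (P.proj x)
  rw [← P.act_eq_of_coord hα hxy]
  exact (P.apply_act_eq_of_horizontal hf ha hx _).symm

theorem hasCircleDerivAt_matTorus_coord {α : ι} {n : M → Matrix J J ℤ}
    (hn : ∀ m ∈ U α, ∀ᶠ m' in 𝓝 m, n m' = n m) {x : X} (hx : P.proj x ∈ U α) (i : J) :
    HasCircleDerivAt E' (fun y => matTorus (n (P.proj y)) (P.coord α y) i) x
      (∑ j, (n (P.proj x) i j : ℝ) • circleDeriv E' (fun y => P.coord α y j) x) := by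
  refine (HasCircleDerivAt.sum Finset.univ fun j _ =>
    (P.hasCircleDerivAt_coord hx j).zsmul (n (P.proj x) i j)).congr ?_
  filter_upwards [P.proj_smooth.continuous.continuousAt.eventually (hn _ hx)] with y hy
  simp only [matTorus, hy]

theorem smoothCircleAt_matTorus_coord {α : ι} {n : M → Matrix J J ℤ}
    (hn : ∀ m ∈ U α, ∀ᶠ m' in 𝓝 m, n m' = n m) {x : X} (hx : P.proj x ∈ U α) (i : J) :
    SmoothCircleAt 𝓘(ℝ, E') (fun y => matTorus (n (P.proj y)) (P.coord α y) i) x := by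
  refine (SmoothCircleAt.sum Finset.univ fun j _ =>
    (P.smoothCircleAt_coord hx j).zsmul (n (P.proj x) i j)).congr ?_
  filter_upwards [P.proj_smooth.continuous.continuousAt.eventually (hn _ hx)] with y hy
  simp only [matTorus, hy]

end PrincipalTorusBundle

theorem torusTwoForm_fund {P : PrincipalTorusBundle J E M E' X U} {α : ι} {x : X} (hx : P.proj x ∈ U α) (n : M → Matrix J J ℤ) (i : J)
    (v : TangentSpace 𝓘(ℝ, E') x) : torusTwoForm P α n x (P.fund i x) v =
      ∑ j, (n (P.proj x) i j : ℝ) * circleDeriv E' (fun y => P.coord α y j) x v := by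
  classical
  have h1 : torusTwoForm P α n x (P.fund i x) v = ∑ k, ∑ j, (n (P.proj x) k j : ℝ) *
      (circleDeriv E' (fun y => P.coord α y k) x (P.fund i x) *
        circleDeriv E' (fun y => P.coord α y j) x v) := by
    simp only [torusTwoForm, sum_apply]
    rfl
  rw [h1, Finset.sum_eq_single i]
  · simp [P.circleDeriv_coord_fund hx]
  · intro k _ hk
    simp [P.circleDeriv_coord_fund hx, hk]
  · simp

variable [IsManifold 𝓘(ℝ, E') ∞ X]
  {P : PrincipalTorusBundle J E M E' X U} {Θ : J → OneForm E' X}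
  {G : GerbeConn E' X (fun α => P.proj ⁻¹' U α)} {N : ι → M → Matrix J J ℤ}

/-- The working form of `B'_1`, namely `-ι_i B + n dθ + (B_0 - n) Θ`. It shows at once why `B'_1` is
horizontal, since the three terms cancel on `∂_k`, and why only the first two terms survive in a
difference over an overlap, where `B_0 - n` agrees. -/
theorem compOne_shiftedB_apply {α : ι} {x : X} (hx : P.proj x ∈ U α) (i : J)
    (v : TangentSpace 𝓘(ℝ, E') x) :
    compOne P Θ (shiftedB P G N α) i x v = - G.B α x (P.fund i x) v +
      ∑ j, (N α (P.proj x) i j : ℝ) * circleDeriv E' (fun y => P.coord α y j) x v +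
      ∑ j, (G.B α x (P.fund i x) (P.fund j x) - (N α (P.proj x) i j : ℝ)) * Θ j x v := by
  classical
  have h0 : ∀ w, shiftedB P G N α x (P.fund i x) w = G.B α x (P.fund i x) w -
      ∑ j, (N α (P.proj x) i j : ℝ) * circleDeriv E' (fun y => P.coord α y j) x w := fun w => by
    rw [← torusTwoForm_fund hx]
    rfl
  have h1 : compOne P Θ (shiftedB P G N α) i x v = - shiftedB P G N α x (P.fund i x) v +
      ∑ j, shiftedB P G N α x (P.fund i x) (P.fund j x) * Θ j x v := by
    simp only [compOne, add_apply, sum_apply]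
    rfl
  rw [h1, h0]
  have h2 : ∀ j, shiftedB P G N α x (P.fund i x) (P.fund j x) =
      G.B α x (P.fund i x) (P.fund j x) - (N α (P.proj x) i j : ℝ) := fun j => by
    rw [h0]
    simp [P.circleDeriv_coord_fund hx]
  simp only [h2]
  ring

theorem compOne_shiftedB_fund (hΘ : P.IsConnection Θ) {α : ι} {x : X} (hx : P.proj x ∈ U α)
    (i k : J) : compOne P Θ (shiftedB P G N α) i x (P.fund k x) = 0 := by
  classical
  rw [compOne_shiftedB_apply hx]
  have h1 : ∀ j, Θ j x (P.fund k x) = if j = k then 1 else 0 := fun j => by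
    by_cases h : j = k
    · subst h; simpa using hΘ.vertical_self j x
    · simpa [h] using hΘ.vertical_ne j k x h
  simp [P.circleDeriv_coord_fund hx, h1]

theorem compOne_shiftedB_act (hΘ : P.IsConnection Θ) (hG : G.Invariant P) {α : ι} {x : X}
    (hx : P.proj x ∈ U α) (i : J) (t : Torus J) (v : TangentSpace 𝓘(ℝ, E') x) :
    compOne P Θ (shiftedB P G N α) i (P.act t x) (P.actDeriv t x v) =
      compOne P Θ (shiftedB P G N α) i x v := by
  rw [compOne_shiftedB_apply hx, compOne_shiftedB_apply (by rwa [P.proj_act])]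
  simp only [P.fund_act, hG α t x hx, P.proj_act, P.circleDeriv_coord_act hx, hΘ.invariant]

theorem smoothOn_compOne_shiftedB (hΘ : P.IsConnection Θ) {α : ι}
    (hN : ∀ m ∈ U α, ∀ᶠ m' in 𝓝 m, N α m' = N α m) (i : J) :
    OneForm.SmoothOn E' (compOne P Θ (shiftedB P G N α) i) (P.proj ⁻¹' U α) := by
  have hNs : ∀ j, ContMDiffOn 𝓘(ℝ, E') 𝓘(ℝ, ℝ) ∞ (fun x => (N α (P.proj x) i j : ℝ))
      (P.proj ⁻¹' U α) := by
    intro j x hx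
    refine ContMDiffAt.contMDiffWithinAt ?_
    refine (contMDiffAt_const (c := (N α (P.proj x) i j : ℝ))).congr_of_eventuallyEq ?_
    filter_upwards [P.proj_smooth.continuous.continuousAt.eventually (hN _ hx)] with y hy
    rw [hy]
  have hB := (G.B_smooth α).contract (P.contMDiff_fund i)
  have h1 : OneForm.SmoothOn E' (fun x => (- G.B α x (P.fund i x) +
      ∑ j, (N α (P.proj x) i j : ℝ) • circleDeriv E' (fun y => P.coord α y j) x) +
      ∑ j, (G.B α x (P.fund i x) (P.fund j x) - (N α (P.proj x) i j : ℝ)) • Θ j x)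
      (P.proj ⁻¹' U α) := by
    refine (hB.neg.add (OneForm.SmoothOn.sum _ fun j _ =>
      ((P.coord_smooth α j).smoothOn_circleDeriv).smul (hNs j))).add
      (OneForm.SmoothOn.sum _ fun j _ => ((hΘ.smooth j).mono (Set.subset_univ _)).smul ?_)
    exact (hB.contract (P.contMDiff_fund j)).sub (hNs j)
  refine h1.congr fun x hx => ?_
  ext v
  rw [compOne_shiftedB_apply hx]
  simp only [add_apply, sum_apply]
  rfl

end Basic

/-! ### The gluing functions of the dual torus, on `X` -/

section Dual

variable {J : Type*} [Fintype J]
  {E : Type*} [NormedAddCommGroup E] [NormedSpace ℝ E]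
  {M : Type*} [TopologicalSpace M] [ChartedSpace E M]
  {E' : Type*} [NormedAddCommGroup E'] [NormedSpace ℝ E']
  {X : Type*} [TopologicalSpace X] [ChartedSpace E' X] [IsManifold 𝓘(ℝ, E') ∞ X]
  {E'' : Type*} [NormedAddCommGroup E''] [NormedSpace ℝ E'']
  {Y : Type*} [TopologicalSpace Y] [ChartedSpace E'' Y]
  {ι : Type*} {U : ι → Set M}
  {P : PrincipalTorusBundle J E M E' X U} {Θ : J → OneForm E' X}
  {G : GerbeConn E' X (fun α => P.proj ⁻¹' U α)} {N : ι → M → Matrix J J ℤ}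
  {Q : PrincipalTorusBundle J E' X E'' Y (fun α => P.proj ⁻¹' U α)}
  {lamS : ι → ι → X → Torus J}

variable (P N lamS) in
/-- The gluing functions of the dual torus bundle, before their descent to the base. -/
def dualGluing (α β : ι) (x : X) : Torus J :=
  lamS α β x + matTorus (N α (P.proj x)) (P.coord α x) - matTorus (N β (P.proj x)) (P.coord β x)

theorem smoothCircleAt_dualGluing (hQ : IsCorrespondence P G Q lamS) (hN : IsCoboundary P G N)
    {α β : ι} {x : X} (hα : P.proj x ∈ U α) (hβ : P.proj x ∈ U β) (i : J) :
    SmoothCircleAt 𝓘(ℝ, E') (fun x => dualGluing P N lamS α β x i) x :=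
  ((Q.smoothCircleAt_gluing hQ.gluing hα hβ i).add
    (P.smoothCircleAt_matTorus_coord (hN.locally_const α) hα i)).sub
    (P.smoothCircleAt_matTorus_coord (hN.locally_const β) hβ i)

variable [FiniteDimensional ℝ E']

/-- The holonomy contributes the contraction of `B_α - B_β` with the generator, and the terms `n θ`
contribute `n dθ`, the matrices being locally constant. By the coboundary condition the coefficients
of `Θ` in the two copies of `B'_1` coincide, so the connection may be inserted on the right at no
cost. -/
theorem hasCircleDerivAt_dualGluing (hG : G.Invariant P) (hQ : IsCorrespondence P G Q lamS)
    (hN : IsCoboundary P G N) {α β : ι} {x : X} (hα : P.proj x ∈ U α) (hβ : P.proj x ∈ U β)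
    (i : J) :
    HasCircleDerivAt E' (fun x => dualGluing P N lamS α β x i) x
      (compOne P Θ (shiftedB P G N α) i x - compOne P Θ (shiftedB P G N β) i x) := by
  have hs := Q.smoothCircleAt_gluing hQ.gluing (m := x) hα hβ i
  refine ((hs.hasCircleDerivAt.add
    (P.hasCircleDerivAt_matTorus_coord (hN.locally_const α) hα i)).sub
    (P.hasCircleDerivAt_matTorus_coord (hN.locally_const β) hβ i)).congr_deriv ?_
  have hW : IsOpen (P.proj ⁻¹' U α ∩ P.proj ⁻¹' U β) :=
    (P.isOpen_preimage α).inter (P.isOpen_preimage β)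
  ext v
  have h1 := P.circleDeriv_holonomy hW
    (fun t x hx => by
      simp only [Set.mem_inter_iff, Set.mem_preimage, P.proj_act]
      exact hx)
    (G.L α β) (b := fun x => G.B α x - G.B β x) (G.B_glue α β)
    (fun t x hx u v =>
      congrArg₂ (fun a b : ℝ => a - b) (hG α t x hx.1 u v) (hG β t x hx.2 u v))
    i (fun x hx => hQ.holonomy α β x hx.1 hx.2 i) ⟨hα, hβ⟩ hs v
  -- Polarisation. It moves the generator from the second slot, where the holonomy formula has it,
  -- to the first, where `compOne` has it.
  have hskew : ∀ γ, P.proj x ∈ U γ → ∀ u w : E', G.B γ x u w = - G.B γ x w u := by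
    intro γ hγ u w
    have e1 := G.B_alt γ x hγ (u + w : E')
    have e2 : ∀ (A : E' →L[ℝ] E' →L[ℝ] ℝ), A u u = 0 → A w w = 0 → A (u + w) (u + w) = 0 →
        A u w = - A w u := fun A h1 h2 h3 => by
      simp only [map_add, add_apply, h1, h2] at h3
      linarith
    exact e2 (G.B γ x) (G.B_alt γ x hγ u) (G.B_alt γ x hγ w) e1
  have h2 : circleDeriv E' (fun x => lamS α β x i) x v =
      - G.B α x (P.fund i x) v + G.B β x (P.fund i x) v := by
    refine h1.trans ?_
    refine Eq.trans (congrArg₂ (fun a b : ℝ => a - b) (hskew α hα v (P.fund i x))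
      (hskew β hβ v (P.fund i x))) ?_
    ring
  have h3 : ∀ j, G.B α x (P.fund i x) (P.fund j x) - (N α (P.proj x) i j : ℝ) =
      G.B β x (P.fund i x) (P.fund j x) - (N β (P.proj x) i j : ℝ) := by
    intro j
    have := congrFun (congrFun (hN.coboundary α β x hα hβ) i) j
    simp only [compZero, Matrix.sub_apply, Matrix.of_apply, Matrix.map_apply,
      Int.cast_sub] at this
    linarith
  have h4 : ∀ γ, (∑ j, (N γ (P.proj x) i j : ℝ) • circleDeriv E' (fun y => P.coord γ y j) x) v =
      ∑ j, (N γ (P.proj x) i j : ℝ) * circleDeriv E' (fun y => P.coord γ y j) x v := fun γ => by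
    simp only [sum_apply]
    rfl
  have h5 : circleDeriv E' (fun x => lamS α β x i) x v +
      (∑ j, (N α (P.proj x) i j : ℝ) • circleDeriv E' (fun y => P.coord α y j) x) v -
      (∑ j, (N β (P.proj x) i j : ℝ) • circleDeriv E' (fun y => P.coord β y j) x) v =
      compOne P Θ (shiftedB P G N α) i x v - compOne P Θ (shiftedB P G N β) i x v := by
    rw [h4, h4, h2, compOne_shiftedB_apply hα, compOne_shiftedB_apply hβ]
    simp only [h3]
    ring
  exact h5

/-- The differential is a difference of two horizontal forms, and the fibres are orbits of a
connected group. -/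
theorem dualGluing_eq (hΘ : P.IsConnection Θ) (hG : G.Invariant P)
    (hQ : IsCorrespondence P G Q lamS) (hN : IsCoboundary P G N) {α β : ι} {x y : X}
    (hα : P.proj x ∈ U α) (hβ : P.proj x ∈ U β) (hxy : P.proj x = P.proj y) :
    dualGluing P N lamS α β x = dualGluing P N lamS α β y := by
  funext i
  refine P.apply_eq_of_horizontal (S := U α ∩ U β) (f := fun x => dualGluing P N lamS α β x i)
    (fun z hz => hasCircleDerivAt_dualGluing (Θ := Θ) hG hQ hN hz.1 hz.2 i)
    (fun z k hz => ?_) ⟨hα, hβ⟩ hxy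
  have := congrArg₂ (fun a b : ℝ => a - b) (compOne_shiftedB_fund (G := G) (N := N) hΘ hz.1 i k)
    (compOne_shiftedB_fund (G := G) (N := N) hΘ hz.2 i k)
  exact this.trans (sub_zero 0)

end Dual

/-! ### Descent to the base -/

section Descent

variable {J : Type*} [Fintype J]
  {E : Type*} [NormedAddCommGroup E] [NormedSpace ℝ E]
  {M : Type*} [TopologicalSpace M] [ChartedSpace E M]
  {E' : Type*} [NormedAddCommGroup E'] [NormedSpace ℝ E']
  {X : Type*} [TopologicalSpace X] [ChartedSpace E' X] [IsManifold 𝓘(ℝ, E') ∞ X]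
  {E'' : Type*} [NormedAddCommGroup E''] [NormedSpace ℝ E'']
  {Y : Type*} [TopologicalSpace Y] [ChartedSpace E'' Y]
  {ι : Type*} {U : ι → Set M}
  {P : PrincipalTorusBundle J E M E' X U} {Θ : J → OneForm E' X}
  {G : GerbeConn E' X (fun α => P.proj ⁻¹' U α)} {N : ι → M → Matrix J J ℤ}
  {Q : PrincipalTorusBundle J E' X E'' Y (fun α => P.proj ⁻¹' U α)}
  {lamS : ι → ι → X → Torus J}

variable (P N lamS) in
/-- The gluing functions of the dual torus bundle. -/
noncomputable def baseGluing (α β : ι) (m : M) : Torus J := dualGluing P N lamS α β (P.sect α m)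

variable (P Θ G N) in
/-- The form on the base that pulls back to the `B₁`-component of the shifted curving. -/
noncomputable def baseOneForm (α : ι) (i : J) : OneForm E M :=
  OneForm.pullback E' (P.sect α) (compOne P Θ (shiftedB P G N α) i)

theorem baseGluing_proj [FiniteDimensional ℝ E'] (hΘ : P.IsConnection Θ) (hG : G.Invariant P)
    (hQ : IsCorrespondence P G Q lamS) (hN : IsCoboundary P G N) {α β : ι} {x : X}
    (hα : P.proj x ∈ U α) (hβ : P.proj x ∈ U β) :
    baseGluing P N lamS α β (P.proj x) = dualGluing P N lamS α β x :=
  (dualGluing_eq hΘ hG hQ hN hα hβ (P.proj_sect hα).symm).symm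

theorem smoothCircleOn_baseGluing [IsManifold 𝓘(ℝ, E) ∞ M] (hQ : IsCorrespondence P G Q lamS) (hN : IsCoboundary P G N)
    (α β : ι) (i : J) :
    SmoothCircleOn E (fun m => baseGluing P N lamS α β m i) (U α ∩ U β) := by
  refine smoothCircleOn_of_smoothCircleAt ((P.isOpen_cover α).inter (P.isOpen_cover β))
    fun m hm => ?_
  exact (smoothCircleAt_dualGluing hQ hN (x := P.sect α m) (by rw [P.proj_sect hm.1]; exact hm.1)
    (by rw [P.proj_sect hm.1]; exact hm.2) i).comp (P.contMDiffAt_sect hm.1)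

theorem smoothOn_baseOneForm [IsManifold 𝓘(ℝ, E) ∞ M] (hΘ : P.IsConnection Θ) (hN : IsCoboundary P G N) (α : ι) (i : J) :
    OneForm.SmoothOn E (baseOneForm P Θ G N α i) (U α) :=
  (smoothOn_compOne_shiftedB hΘ (hN.locally_const α) i).pullback (P.isOpen_cover α)
    (P.contMDiffOn_sect α) fun m hm => by
      rw [Set.mem_preimage, P.proj_sect hm]; exact hm

theorem pullback_baseOneForm (hΘ : P.IsConnection Θ) (hG : G.Invariant P) {α : ι} (i : J) {x : X}
    (hx : P.proj x ∈ U α) : OneForm.pullback E P.proj (baseOneForm P Θ G N α i) x =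
      compOne P Θ (shiftedB P G N α) i x :=
  P.apply_eq_apply_sect (fun _ k hy => compOne_shiftedB_fund hΘ hy i k)
    (fun t _ v hy => compOne_shiftedB_act hΘ hG hy i t v) hx

/-- Differentiation takes place along the section of `α`, whereas the form of index `β` was defined
through the section of `β`. The mismatch disappears because that form pulls back to `B'_1` on all of
`X` over `U β`, and projection after section is the identity. -/
theorem hasCircleDerivAt_baseGluing [FiniteDimensional ℝ E'] (hΘ : P.IsConnection Θ) (hG : G.Invariant P)
    (hQ : IsCorrespondence P G Q lamS) (hN : IsCoboundary P G N) {α β : ι} (i : J) {m : M}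
    (hα : m ∈ U α) (hβ : m ∈ U β) :
    HasCircleDerivAt E (fun m => baseGluing P N lamS α β m i) m
      (baseOneForm P Θ G N α i m - baseOneForm P Θ G N β i m) := by
  have hα' : P.proj (P.sect α m) ∈ U α := by rwa [P.proj_sect hα]
  have hβ' : P.proj (P.sect α m) ∈ U β := by rwa [P.proj_sect hα]
  have hσ := ((P.contMDiffAt_sect hα).mdifferentiableAt (by simp)).hasMFDerivAt
  refine (HasCircleDerivAt.comp (c := P.sect α)
    (hasCircleDerivAt_dualGluing (Θ := Θ) hG hQ hN hα' hβ' i) hσ).congr_deriv ?_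
  have h1 : ∀ w : E, (mfderiv 𝓘(ℝ, E') 𝓘(ℝ, E) P.proj (P.sect α m)
      (mfderiv 𝓘(ℝ, E) 𝓘(ℝ, E') (P.sect α) m w) : E) = w := by
    intro w
    have e1 := ((P.hasMFDerivAt_proj (P.sect α m)).comp m hσ).congr_of_eventuallyEq (f₁ := id) (by
      filter_upwards [(P.isOpen_cover α).mem_nhds hα] with y hy
      exact (P.proj_sect hy).symm)
    exact (DFunLike.congr_fun (hasMFDerivAt_unique (hasMFDerivAt_id m) e1) w).symm
  ext w
  have h2 : compOne P Θ (shiftedB P G N β) i (P.sect α m)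
      (mfderiv 𝓘(ℝ, E) 𝓘(ℝ, E') (P.sect α) m w) = baseOneForm P Θ G N β i m w := by
    rw [← pullback_baseOneForm hΘ hG i hβ']
    refine Eq.trans (congrArg (fun w : E => baseOneForm P Θ G N β i (P.proj (P.sect α m)) w)
      (h1 w)) ?_
    exact OneForm.apply_congr (baseOneForm P Θ G N β i) (P.proj_sect hα) w
  exact congrArg (fun r : ℝ => baseOneForm P Θ G N α i m w - r) h2

end Descent

/-! ### The double torus bundle -/

section Double

variable {J : Type*} [Fintype J]
  {E : Type*} [NormedAddCommGroup E] [NormedSpace ℝ E]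
  {M : Type*} [TopologicalSpace M] [ChartedSpace E M]
  {E' : Type*} [NormedAddCommGroup E'] [NormedSpace ℝ E']
  {X : Type*} [TopologicalSpace X] [ChartedSpace E' X]
  {E'' : Type*} [NormedAddCommGroup E''] [NormedSpace ℝ E'']
  {Y : Type*} [TopologicalSpace Y] [ChartedSpace E'' Y]
  {ι : Type*} {U : ι → Set M}
  (P : PrincipalTorusBundle J E M E' X U)
  (Q : PrincipalTorusBundle J E' X E'' Y (fun α => P.proj ⁻¹' U α))
  (N : ι → M → Matrix J J ℤ)

/-- The coordinates `θ̃_α = θ_#α - n_α θ_α`. -/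
def twistedCoord (α : ι) (y : Y) : Torus J :=
  Q.coord α y - matTorus (N α (P.proj (Q.proj y))) (P.coord α (Q.proj y))

/-- The action of the double torus in the coordinates over `U α`. -/
noncomputable def doubleActOn (α : ι) (s t : Torus J) (y : Y) : Y :=
  Q.act (Q.coord α y + matTorus (N α (P.proj (Q.proj y))) s + t) (Q.sect α (P.act s (Q.proj y)))

theorem act_mem_preimage {P : PrincipalTorusBundle J E M E' X U} {α : ι} {x : X}
    (hx : P.proj x ∈ U α) (s : Torus J) : P.act s x ∈ P.proj ⁻¹' U α := by
  rwa [Set.mem_preimage, P.proj_act]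

variable {P Q} in
theorem proj_doubleActOn {α : ι} {y : Y} (hy : P.proj (Q.proj y) ∈ U α) (s t : Torus J) :
    Q.proj (doubleActOn P Q N α s t y) = P.act s (Q.proj y) := by
  rw [doubleActOn, Q.proj_act, Q.proj_sect (act_mem_preimage hy s)]

variable {P Q} in
-- The summand `n_α s` in the action exists for this: it offsets the change of `n_α θ_α` when `θ_α`
-- moves by `s`, so `θ̃_α` moves by `t` alone.
theorem twistedCoord_doubleActOn {α : ι} {y : Y} (hy : P.proj (Q.proj y) ∈ U α) (s t : Torus J) :
    twistedCoord P Q N α (doubleActOn P Q N α s t y) = t + twistedCoord P Q N α y := by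
  have h1 : Q.coord α (doubleActOn P Q N α s t y) =
      Q.coord α y + matTorus (N α (P.proj (Q.proj y))) s + t := by
    rw [doubleActOn, Q.coord_act _ _ _ (by
      rw [Q.proj_sect (act_mem_preimage hy s)]; exact act_mem_preimage hy s),
      Q.coord_sect (act_mem_preimage hy s), add_zero]
  rw [twistedCoord, twistedCoord, h1, proj_doubleActOn N hy, P.proj_act, P.coord_act _ _ _ hy,
    matTorus_add]
  abel

variable {P Q} in
-- For given `θ_α`, replacing `θ_#α` by `θ̃_α` is a translation, so `(θ_α, θ̃_α)` still separates
-- points. The identities between points of `Y` below are checked in these coordinates.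
theorem eq_of_twistedCoord_eq {α : ι} {y z : Y} (hy : P.proj (Q.proj y) ∈ U α)
    (hyz : P.proj (Q.proj y) = P.proj (Q.proj z))
    (h1 : P.coord α (Q.proj y) = P.coord α (Q.proj z))
    (h2 : twistedCoord P Q N α y = twistedCoord P Q N α z) : y = z := by
  have h3 : Q.proj y = Q.proj z := P.coord_inj α _ _ hy hyz h1
  refine Q.coord_inj α _ _ hy h3 ?_
  rw [twistedCoord, twistedCoord, ← h1, ← hyz] at h2
  exact sub_left_inj.1 h2

variable {N}

/-- The action of the double torus. -/
noncomputable def doubleAct (u : Torus (J ⊕ J)) (y : Y) : Y :=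
  doubleActOn P Q N (P.cover (P.proj (Q.proj y))).choose (fun j => u (Sum.inl j))
    (fun j => u (Sum.inr j)) y

section Glued

variable {P Q} {h : ι → ι → M → Torus J}

/-- The functions `θ̃_α` and `θ̃_β` differ by a function of the base point, which the action
preserves. Translating one by `t` therefore translates the other by `t`, and the frame chosen in
`doubleAct` is immaterial. -/
theorem doubleAct_eq
    (hh : ∀ α β y, P.proj (Q.proj y) ∈ U α → P.proj (Q.proj y) ∈ U β →
      twistedCoord P Q N α y - twistedCoord P Q N β y = - h α β (P.proj (Q.proj y)))
    {α : ι} {y : Y} (hy : P.proj (Q.proj y) ∈ U α) (u : Torus (J ⊕ J)) :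
    doubleAct P Q (N := N) u y =
      doubleActOn P Q N α (fun j => u (Sum.inl j)) (fun j => u (Sum.inr j)) y := by
  have hβ := (P.cover (P.proj (Q.proj y))).choose_spec
  set β := (P.cover (P.proj (Q.proj y))).choose with hβdef
  set s : Torus J := fun j => u (Sum.inl j)
  set t : Torus J := fun j => u (Sum.inr j)
  change doubleActOn P Q N β s t y = _
  have e1 : P.proj (Q.proj (doubleActOn P Q N β s t y)) = P.proj (Q.proj y) := by
    rw [proj_doubleActOn N hβ, P.proj_act]
  have e2 : P.proj (Q.proj (doubleActOn P Q N α s t y)) = P.proj (Q.proj y) := by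
    rw [proj_doubleActOn N hy, P.proj_act]
  refine eq_of_twistedCoord_eq N (α := α) (by rwa [e1]) (e1.trans e2.symm)
    (by rw [proj_doubleActOn N hβ, proj_doubleActOn N hy]) ?_
  have e3 := hh α β (doubleActOn P Q N β s t y) (by rwa [e1]) (by rwa [e1])
  have e4 := hh α β y hy hβ
  rw [e1, twistedCoord_doubleActOn N hβ, ← e4] at e3
  rw [twistedCoord_doubleActOn N hy, sub_eq_iff_eq_add.1 e3]
  abel

variable (P Q N) in
/-- The total space of a torus bundle over a torus bundle, as a principal bundle over the base. -/
noncomputable def doubleBundle [IsManifold 𝓘(ℝ, E'') ∞ Y]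
    (hN : ∀ α, ∀ m ∈ U α, ∀ᶠ m' in 𝓝 m, N α m' = N α m)
    (hh : ∀ α β y, P.proj (Q.proj y) ∈ U α → P.proj (Q.proj y) ∈ U β →
      twistedCoord P Q N α y - twistedCoord P Q N β y = - h α β (P.proj (Q.proj y))) :
    PrincipalTorusBundle (J ⊕ J) E M E'' Y U where
  isOpen_cover := P.isOpen_cover
  cover := P.cover
  proj := P.proj ∘ Q.proj
  proj_smooth := P.proj_smooth.comp Q.proj_smooth
  act := doubleAct P Q (N := N)
  act_zero y := by
    obtain ⟨α, hα⟩ := P.cover (P.proj (Q.proj y))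
    rw [doubleAct_eq hh hα]
    have e1 := proj_doubleActOn (Q := Q) N hα (fun _ => 0) (fun _ => 0)
    have e0 : Q.proj (doubleActOn P Q N α (fun _ => 0) (fun _ => 0) y) = Q.proj y :=
      e1.trans (P.act_zero _)
    refine eq_of_twistedCoord_eq (P := P) (Q := Q) N (α := α) ?_ ?_ ?_ ?_
    · change P.proj (Q.proj (doubleActOn P Q N α (fun _ => 0) (fun _ => 0) y)) ∈ _
      rwa [e0]
    · exact congrArg P.proj e0
    · exact congrArg (P.coord α) e0
    · exact (twistedCoord_doubleActOn N hα _ _).trans (zero_add _)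
  act_add u v y := by
    obtain ⟨α, hα⟩ := P.cover (P.proj (Q.proj y))
    have e1 : ∀ w : Torus (J ⊕ J), Q.proj (doubleAct P Q (N := N) w y) =
        P.act (fun j => w (Sum.inl j)) (Q.proj y) := fun w => by
      rw [doubleAct_eq hh hα, proj_doubleActOn N hα]
    have e2 : ∀ w : Torus (J ⊕ J), P.proj (Q.proj (doubleAct P Q (N := N) w y)) ∈ U α :=
      fun w => by rw [e1, P.proj_act]; exact hα
    have e3 : Q.proj (doubleAct P Q (N := N) u (doubleAct P Q (N := N) v y)) =
        Q.proj (doubleAct P Q (N := N) (u + v) y) := by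
      rw [e1, doubleAct_eq hh (e2 v), proj_doubleActOn N (e2 v), e1, ← P.act_add]
      rfl
    refine eq_of_twistedCoord_eq (P := P) (Q := Q) N (α := α) (e2 _) (congrArg P.proj e3.symm)
      (congrArg (P.coord α) e3.symm) ?_
    rw [doubleAct_eq hh hα, twistedCoord_doubleActOn N hα, doubleAct_eq hh (e2 v),
      twistedCoord_doubleActOn N (e2 v), doubleAct_eq hh hα, twistedCoord_doubleActOn N hα,
      ← add_assoc]
    rfl
  act_smooth := by
    rintro ⟨r₀, y₀⟩
    obtain ⟨α, hα⟩ := P.cover (P.proj (Q.proj y₀))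
    have hopen : IsOpen {p : (J ⊕ J → ℝ) × Y | P.proj (Q.proj p.2) ∈ U α} :=
      ((Q.isOpen_preimage α).preimage continuous_snd)
    have hcoe : ∀ k : J ⊕ J, SmoothCircleAt (𝓘(ℝ, J ⊕ J → ℝ).prod 𝓘(ℝ, E''))
        (fun p : (J ⊕ J → ℝ) × Y => toTorus p.1 k) (r₀, y₀) := fun k => by
      have e1 : ContMDiff 𝓘(ℝ, J ⊕ J → ℝ) 𝓘(ℝ, ℝ) ∞ (fun r : J ⊕ J → ℝ => r k) :=
        (contDiff_apply ℝ ℝ k).contMDiff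
      exact smoothCircleAt_coe ((e1.comp contMDiff_fst).contMDiffAt)
    have hY : ContMDiffAt (𝓘(ℝ, J ⊕ J → ℝ).prod 𝓘(ℝ, E'')) 𝓘(ℝ, E'') ∞
        (fun p : (J ⊕ J → ℝ) × Y => p.2) (r₀, y₀) := contMDiffAt_snd
    have hX := Q.proj_smooth.contMDiffAt.comp (r₀, y₀) hY
    have hM := P.proj_smooth.contMDiffAt.comp (r₀, y₀) hX
    have h1 : ContMDiffAt (𝓘(ℝ, J ⊕ J → ℝ).prod 𝓘(ℝ, E'')) 𝓘(ℝ, E') ∞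
        (fun p : (J ⊕ J → ℝ) × Y => P.act (fun j => toTorus p.1 (Sum.inl j)) (Q.proj p.2))
        (r₀, y₀) := P.contMDiffAt_act (fun j => hcoe (Sum.inl j)) hX
    have h2 : P.act (fun j => toTorus r₀ (Sum.inl j)) (Q.proj y₀) ∈ P.proj ⁻¹' U α :=
      act_mem_preimage hα _
    have h3 := ContMDiffAt.comp (r₀, y₀)
      (g := Q.sect α)
      (f := fun p : (J ⊕ J → ℝ) × Y => P.act (fun j => toTorus p.1 (Sum.inl j)) (Q.proj p.2))
      (Q.contMDiffAt_sect h2) h1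
    have h4 := Q.contMDiffAt_act (z := (r₀, y₀)) (c := fun p : (J ⊕ J → ℝ) × Y => Q.coord α p.2 +
      matTorus (N α (P.proj (Q.proj p.2))) (fun j => toTorus p.1 (Sum.inl j)) +
      fun j => toTorus p.1 (Sum.inr j)) (fun j => by
        refine (SmoothCircleAt.add (SmoothCircleAt.comp (c := fun p : (J ⊕ J → ℝ) × Y => p.2)
          (Q.smoothCircleAt_coord (x := y₀) hα j) hY) ?_).add (hcoe (Sum.inr j))
        refine (SmoothCircleAt.sum Finset.univ fun k _ =>
          (hcoe (Sum.inl k)).zsmul (N α (P.proj (Q.proj y₀)) j k)).congr ?_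
        filter_upwards [hM.continuousAt.eventually (hN α _ hα)] with p hp
        have hp' : N α (P.proj (Q.proj p.2)) = N α (P.proj (Q.proj y₀)) := hp
        simp only [matTorus, hp']) h3
    -- The frame chosen in `doubleAct` may jump from point to point; near `y₀` it is exchanged for
    -- the fixed `α`, for which smoothness was just shown.
    refine h4.congr_of_eventuallyEq ?_
    filter_upwards [hopen.mem_nhds hα] with p hp
    exact doubleAct_eq hh hp _
  proj_act u y := by
    obtain ⟨α, hα⟩ := P.cover (P.proj (Q.proj y))
    rw [Function.comp, doubleAct_eq hh hα, proj_doubleActOn N hα, P.proj_act]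
    rfl
  coord α y := Sum.elim (P.coord α (Q.proj y)) (twistedCoord P Q N α y)
  coord_smooth α j := by
    refine smoothCircleOn_of_smoothCircleAt (Q.isOpen_preimage α) fun y hy => ?_
    have hy' : P.proj (Q.proj y) ∈ U α := hy
    rcases j with j | j
    · exact (P.smoothCircleAt_coord hy' j).comp Q.proj_smooth.contMDiffAt
    · exact (Q.smoothCircleAt_coord (x := y) hy' j).sub
        ((P.smoothCircleAt_matTorus_coord (hN α) hy' j).comp Q.proj_smooth.contMDiffAt)
  coord_act α u y hy := by
    have hy' : P.proj (Q.proj y) ∈ U α := hy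
    rw [doubleAct_eq hh hy', proj_doubleActOn N hy', P.coord_act _ _ _ hy',
      twistedCoord_doubleActOn N hy']
    funext j
    rcases j with j | j <;> rfl
  coord_inj α y z hy hyz hc :=
    eq_of_twistedCoord_eq N hy hyz (funext fun j => congrFun hc (Sum.inl j))
      (funext fun j => congrFun hc (Sum.inr j))
  exists_section α := by
    refine ⟨Q.sect α ∘ P.sect α, fun m hm => ?_, fun m hm => ?_⟩
    · have hm' : P.sect α m ∈ P.proj ⁻¹' U α := by rwa [Set.mem_preimage, P.proj_sect hm]
      exact ((Q.contMDiffAt_sect hm').comp m (P.contMDiffAt_sect hm)).contMDiffWithinAt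
    · have hm' : P.sect α m ∈ P.proj ⁻¹' U α := by rwa [Set.mem_preimage, P.proj_sect hm]
      simp only [Function.comp, twistedCoord, Q.proj_sect hm', Q.coord_sect hm', P.proj_sect hm,
        P.coord_sect hm, matTorus_zero, sub_zero]
      refine ⟨trivial, funext fun j => ?_⟩
      rcases j with j | j <;> rfl

end Glued

end Double

/-! ### Connections from local data -/

namespace PrincipalTorusBundle

variable {K : Type*} [Fintype K]
  {E : Type*} [NormedAddCommGroup E] [NormedSpace ℝ E]
  {M : Type*} [TopologicalSpace M] [ChartedSpace E M]
  {E' : Type*} [NormedAddCommGroup E'] [NormedSpace ℝ E']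
  {X : Type*} [TopologicalSpace X] [ChartedSpace E' X]
  {ι : Type*} {U : ι → Set M}
  (P : PrincipalTorusBundle K E M E' X U)

/-- The form `dθ_α + B_α`, for `1`-forms `B_α` on the base. -/
noncomputable def connForm (k : K) (B : ι → OneForm E M) : OneForm E' X := fun x =>
  circleDeriv E' (fun y => P.coord (P.cover (P.proj x)).choose y k) x +
    OneForm.pullback E P.proj (B (P.cover (P.proj x)).choose) x

section Glued

variable {P} {g : ι → ι → M → Torus K} {k : K} {B : ι → OneForm E M}

/-- Differentiating `θ_α - θ_β = -g_αβ` gives minus the pull-back of `B_α - B_β`, so the sum `dθ_α +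
B_α` is the same for all members of the cover. -/
theorem connForm_eq (hg : P.HasGluing g)
    (hB : ∀ α β m, m ∈ U α → m ∈ U β → HasCircleDerivAt E (fun m => g α β m k) m (B α m - B β m))
    {α : ι} {x : X} (hx : P.proj x ∈ U α) :
    P.connForm k B x = circleDeriv E' (fun y => P.coord α y k) x +
      OneForm.pullback E P.proj (B α) x := by
  have hβ := (P.cover (P.proj x)).choose_spec
  set β := (P.cover (P.proj x)).choose with hβdef
  have h1 := (P.hasCircleDerivAt_coord hx k).sub (P.hasCircleDerivAt_coord hβ k)
  have h2 := ((hB α β _ hx hβ).comp (P.hasMFDerivAt_proj x)).neg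
  have h3 := h1.unique (h2.congr (by
    filter_upwards [(P.isOpen_preimage α).mem_nhds hx, (P.isOpen_preimage β).mem_nhds hβ]
      with y hy hy'
    exact congrFun (hg α β y hy hy') k))
  ext v
  have h4 : circleDeriv E' (fun y => P.coord α y k) x v - circleDeriv E' (fun y => P.coord β y k) x v
      = - (OneForm.pullback E P.proj (B α) x v - OneForm.pullback E P.proj (B β) x v) :=
    DFunLike.congr_fun h3 v
  change circleDeriv E' (fun y => P.coord β y k) x v + OneForm.pullback E P.proj (B β) x v =
    circleDeriv E' (fun y => P.coord α y k) x v + OneForm.pullback E P.proj (B α) x v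
  linarith

theorem smoothOn_connForm [IsManifold 𝓘(ℝ, E) ∞ M] [IsManifold 𝓘(ℝ, E') ∞ X] (hg : P.HasGluing g)
    (hB : ∀ α β m, m ∈ U α → m ∈ U β → HasCircleDerivAt E (fun m => g α β m k) m (B α m - B β m))
    (hBs : ∀ α, OneForm.SmoothOn E (B α) (U α)) :
    OneForm.SmoothOn E' (P.connForm k B) Set.univ := by
  refine OneForm.smoothOn_of_locally fun x _ => ?_
  obtain ⟨α, hα⟩ := P.cover (P.proj x)
  refine ⟨P.proj ⁻¹' U α, P.isOpen_preimage α, hα, ?_⟩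
  exact (((P.coord_smooth α k).smoothOn_circleDeriv).add
    ((hBs α).pullback (P.isOpen_preimage α) P.proj_smooth.contMDiffOn fun _ hy => hy)).congr
    fun y hy => connForm_eq hg hB hy

theorem connForm_fund [DecidableEq K] (hg : P.HasGluing g)
    (hB : ∀ α β m, m ∈ U α → m ∈ U β → HasCircleDerivAt E (fun m => g α β m k) m (B α m - B β m))
    (l : K) (x : X) : P.connForm k B x (P.fund l x) = if k = l then 1 else 0 := by
  obtain ⟨α, hα⟩ := P.cover (P.proj x)
  rw [connForm_eq hg hB hα]
  have h1 : OneForm.pullback E P.proj (B α) x (P.fund l x) = 0 :=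
    (congrArg (fun w : E => B α (P.proj x) w) (P.mfderiv_proj_fund l x)).trans
      (map_zero (B α (P.proj x)))
  rw [add_apply, P.circleDeriv_coord_fund hα, h1, add_zero]

theorem connForm_act (hg : P.HasGluing g)
    (hB : ∀ α β m, m ∈ U α → m ∈ U β → HasCircleDerivAt E (fun m => g α β m k) m (B α m - B β m))
    (t : Torus K) (x : X) (v : TangentSpace 𝓘(ℝ, E') x) :
    P.connForm k B (P.act t x) (P.actDeriv t x v) = P.connForm k B x v := by
  obtain ⟨α, hα⟩ := P.cover (P.proj x)
  rw [connForm_eq hg hB hα, connForm_eq hg hB (α := α) (by rwa [P.proj_act])]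
  rw [add_apply, add_apply, P.circleDeriv_coord_act hα]
  have h1 : OneForm.pullback E P.proj (B α) (P.act t x) (P.actDeriv t x v) =
      OneForm.pullback E P.proj (B α) x v :=
    (congrArg (fun w : E => B α (P.proj (P.act t x)) w) (P.mfderiv_proj_act t x v)).trans
      (OneForm.apply_congr (B α) (P.proj_act t x) _)
  rw [h1]

theorem hasCircleDerivAt_coord_connForm (hg : P.HasGluing g)
    (hB : ∀ α β m, m ∈ U α → m ∈ U β → HasCircleDerivAt E (fun m => g α β m k) m (B α m - B β m))
    {α : ι} {x : X} (hx : P.proj x ∈ U α) :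
    HasCircleDerivAt E' (fun y => P.coord α y k) x
      (P.connForm k B x - OneForm.pullback E P.proj (B α) x) :=
  (P.hasCircleDerivAt_coord hx k).congr_deriv (by
    rw [connForm_eq hg hB hx]
    exact (add_sub_cancel_right _ _).symm)

end Glued

variable {F : Type*} [NormedAddCommGroup F] [NormedSpace ℝ F]
  {Z : Type*} [TopologicalSpace Z] [ChartedSpace F Z]

/-- This reduces the differential of an equivariant map on a fundamental field to identifying the
image of an orbit. -/
theorem mfderiv_fund {f : X → Z} {x : X} (hf : MDifferentiableAt 𝓘(ℝ, E') 𝓘(ℝ, F) f x) (k : K) :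
    (mfderiv 𝓘(ℝ, E') 𝓘(ℝ, F) f x (P.fund k x) : F) =
      mfderiv 𝓘(ℝ, ℝ) 𝓘(ℝ, F) (fun s => f (P.orbit k x s)) 0 (1 : ℝ) := by
  have h0 : ∀ y, y = x → HasMFDerivAt 𝓘(ℝ, E') 𝓘(ℝ, F) f y
      (mfderiv 𝓘(ℝ, E') 𝓘(ℝ, F) f y) := by rintro y rfl; exact hf.hasMFDerivAt
  have h1 := HasMFDerivAt.comp (f := P.orbit k x) 0 (h0 _ (P.orbit_zero k x))
    (P.hasMFDerivAt_orbit k x 0)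
  have h2 : ∀ y, y = x → (mfderiv 𝓘(ℝ, E') 𝓘(ℝ, F) f y (P.orbitVelocity k x 0 : E') : F) =
      mfderiv 𝓘(ℝ, E') 𝓘(ℝ, F) f x (P.fund k x) := by rintro y rfl; rfl
  exact (h2 _ (P.orbit_zero k x)).symm.trans (DFunLike.congr_fun h1.mfderiv (1 : ℝ)).symm

end PrincipalTorusBundle

/-! ### The connection on the double torus bundle -/

section DoubleConnection

variable {J : Type*} [Fintype J]
  {E : Type*} [NormedAddCommGroup E] [NormedSpace ℝ E]
  {M : Type*} [TopologicalSpace M] [ChartedSpace E M] [IsManifold 𝓘(ℝ, E) ∞ M]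
  {E' : Type*} [NormedAddCommGroup E'] [NormedSpace ℝ E']
  {X : Type*} [TopologicalSpace X] [ChartedSpace E' X] [IsManifold 𝓘(ℝ, E') ∞ X]
  {E'' : Type*} [NormedAddCommGroup E''] [NormedSpace ℝ E'']
  {Y : Type*} [TopologicalSpace Y] [ChartedSpace E'' Y] [IsManifold 𝓘(ℝ, E'') ∞ Y]
  {ι : Type*} {U : ι → Set M}
  {P : PrincipalTorusBundle J E M E' X U}
  {Q : PrincipalTorusBundle J E' X E'' Y (fun α => P.proj ⁻¹' U α)}
  {D : PrincipalTorusBundle (J ⊕ J) E M E'' Y U}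

/-- The pull-back of a connection on `X` and a connection form for the second torus form
a connection of the double bundle. -/
theorem isConnection_double {Θ : J → OneForm E' X} (hΘ : P.IsConnection Θ)
    (hact : ∀ u y, Q.proj (D.act u y) = P.act (fun j => u (Sum.inl j)) (Q.proj y))
    {g : ι → ι → M → Torus (J ⊕ J)} (hg : D.HasGluing g) {B : ι → J → OneForm E M}
    (hB : ∀ j α β m, m ∈ U α → m ∈ U β →
      HasCircleDerivAt E (fun m => g α β m (Sum.inr j)) m (B α j m - B β j m))
    (hBs : ∀ α j, OneForm.SmoothOn E (B α j) (U α)) :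
    D.IsConnection (Sum.elim (fun j => OneForm.pullback E' Q.proj (Θ j))
      (fun j => D.connForm (Sum.inr j) fun α => B α j)) := by
  classical
  have hQd : ∀ y, MDifferentiableAt 𝓘(ℝ, E'') 𝓘(ℝ, E') Q.proj y := fun y =>
    Q.proj_smooth.mdifferentiable (by simp) y
  -- By equivariance `p` carries orbits of the first torus to orbits in `X` and contracts those of
  -- the second to points, so `p^*Θ` has the required values on both kinds of generators.
  have hinl : ∀ k y, (mfderiv 𝓘(ℝ, E'') 𝓘(ℝ, E') Q.proj y (D.fund (Sum.inl k) y) : E') =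
      P.fund k (Q.proj y) := by
    intro k y
    have h1 : (fun s => Q.proj (D.orbit (Sum.inl k) y s)) = P.orbit k (Q.proj y) := by
      funext s
      rw [PrincipalTorusBundle.orbit, hact, PrincipalTorusBundle.orbit]
      congr 1
      funext j
      refine (@toTorus_smul_single _ (fun a b => Classical.propDecidable (a = b)) s (Sum.inl k) (Sum.inl j)).trans
        (Eq.trans ?_ (toTorus_smul_single s k j).symm)
      simp
    refine (D.mfderiv_fund (hQd y) (Sum.inl k)).trans ?_
    have h2 : ∀ c : ℝ → X, c = P.orbit k (Q.proj y) →
        (mfderiv 𝓘(ℝ, ℝ) 𝓘(ℝ, E') c 0 (1 : ℝ) : E') = P.fund k (Q.proj y) := by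
      rintro c rfl; rfl
    exact h2 _ h1
  have hinr : ∀ k y, (mfderiv 𝓘(ℝ, E'') 𝓘(ℝ, E') Q.proj y (D.fund (Sum.inr k) y) : E') = 0 := by
    intro k y
    have h1 : (fun s => Q.proj (D.orbit (Sum.inr k) y s)) = fun _ => Q.proj y := by
      funext s
      rw [PrincipalTorusBundle.orbit, hact]
      convert P.act_zero (Q.proj y) using 2
      funext j
      refine (@toTorus_smul_single _ (fun a b => Classical.propDecidable (a = b)) s (Sum.inr k) (Sum.inl j)).trans ?_
      simp
    refine (D.mfderiv_fund (hQd y) (Sum.inr k)).trans ?_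
    have h2 : ∀ c : ℝ → X, (c = fun _ => Q.proj y) →
        (mfderiv 𝓘(ℝ, ℝ) 𝓘(ℝ, E') c 0 (1 : ℝ) : E') = 0 := by
      rintro c rfl
      rw [mfderiv_const]
      rfl
    exact h2 _ h1
  refine ⟨?_, ?_, ?_, ?_⟩
  · rintro (j | j)
    · exact (hΘ.smooth j).pullback isOpen_univ Q.proj_smooth.contMDiffOn fun _ _ => trivial
    · exact PrincipalTorusBundle.smoothOn_connForm hg (hB j) fun α => hBs α j
  · rintro (j | j) y
    · exact (congrArg (fun w : E' => Θ j (Q.proj y) w) (hinl j y)).trans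
        (hΘ.vertical_self j (Q.proj y))
    · exact (PrincipalTorusBundle.connForm_fund hg (hB j) (Sum.inr j) y).trans (by simp)
  · rintro (j | j) (k | k) y hjk
    · exact (congrArg (fun w : E' => Θ j (Q.proj y) w) (hinl k y)).trans
        (hΘ.vertical_ne j k (Q.proj y) fun h => hjk (by rw [h]))
    · exact (congrArg (fun w : E' => Θ j (Q.proj y) w) (hinr k y)).trans (map_zero _)
    · exact (PrincipalTorusBundle.connForm_fund hg (hB j) (Sum.inl k) y).trans (by simp)
    · exact (PrincipalTorusBundle.connForm_fund hg (hB j) (Sum.inr k) y).trans (if_neg hjk)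
  · rintro (j | j) u y v
    · set s : Torus J := fun j => u (Sum.inl j) with hs
      have h1 := (Q.hasMFDerivAt_proj (D.act u y)).comp y (D.hasMFDerivAt_act u y)
      have h2 := (P.hasMFDerivAt_act s (Q.proj y)).comp y (Q.hasMFDerivAt_proj y)
      have h3 : Q.proj ∘ D.act u = P.act s ∘ Q.proj := funext (hact u)
      have h4 : ∀ c : Y → X, c = P.act s ∘ Q.proj → ∀ A : E'' →L[ℝ] E',
          HasMFDerivAt 𝓘(ℝ, E'') 𝓘(ℝ, E') c y A →
          (A v : E') = P.actDeriv s (Q.proj y) (mfderiv 𝓘(ℝ, E'') 𝓘(ℝ, E') Q.proj y v) := by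
        rintro c rfl A hA
        exact DFunLike.congr_fun (hasMFDerivAt_unique hA h2) v
      refine Eq.trans (congrArg (fun w : E' => Θ j (Q.proj (D.act u y)) w) (h4 _ h3 _ h1)) ?_
      exact (OneForm.apply_congr (Θ j) (hact u y) _).trans (hΘ.invariant j s (Q.proj y) _)
    · exact PrincipalTorusBundle.connForm_act hg (hB j) u y v

end DoubleConnection

/-! ### The principal torus bundle glued from a smooth cocycle -/

section Lift

/-- The inverse of `ℝ → ℝ/ℤ` with values in `(a, a + 1)`, away from the class of `a`. -/
noncomputable def circleLift (a : ℝ) : UnitAddCircle → ℝ :=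
  (AddCircle.openPartialHomeomorphCoe (1 : ℝ) a).symm

theorem circleLift_mem {a : ℝ} {c : UnitAddCircle} (hc : c ≠ a) :
    circleLift a c ∈ Set.Ioo a (a + 1) :=
  (AddCircle.openPartialHomeomorphCoe (1 : ℝ) a).map_target hc

theorem coe_circleLift {a : ℝ} {c : UnitAddCircle} (hc : c ≠ a) :
    (circleLift a c : UnitAddCircle) = c :=
  (AddCircle.openPartialHomeomorphCoe (1 : ℝ) a).right_inv hc

theorem circleLift_coe {a r : ℝ} (hr : r ∈ Set.Ioo a (a + 1)) : circleLift a r = r :=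
  (AddCircle.openPartialHomeomorphCoe (1 : ℝ) a).left_inv hr

theorem coe_ne_of_mem_Ioo {a r : ℝ} (hr : r ∈ Set.Ioo a (a + 1)) : (r : UnitAddCircle) ≠ a :=
  (AddCircle.openPartialHomeomorphCoe (1 : ℝ) a).map_source hr

theorem continuousAt_circleLift {a : ℝ} {c : UnitAddCircle} (hc : c ≠ a) :
    ContinuousAt (circleLift a) c :=
  (AddCircle.openPartialHomeomorphCoe (1 : ℝ) a).continuousAt_symm hc

/-- One of `0` and `1/2` serves. Rational cut points keep the family of fibre charts countable,
which second countability of the total space relies on. -/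
theorem exists_rat_ne (c : UnitAddCircle) : ∃ a : ℚ, c ≠ ((a : ℝ) : UnitAddCircle) := by
  by_contra! h
  have h1 := (h 0).symm.trans (h (1 / 2))
  obtain ⟨k, hk⟩ := exists_int_of_circle_coe_eq h1.symm
  have h2 : ((2 * k : ℤ) : ℝ) = ((1 : ℤ) : ℝ) := by
    push_cast at hk ⊢
    linarith
  have h3 := Int.cast_injective h2
  omega

variable {F : Type*} [NormedAddCommGroup F] [NormedSpace ℝ F] {H : Type*} [TopologicalSpace H]
  {I : ModelWithCorners ℝ F H} {Z : Type*} [TopologicalSpace Z] [ChartedSpace H Z]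

theorem SmoothCircleAt.continuousAt {f : Z → UnitAddCircle} {z : Z} (h : SmoothCircleAt I f z) :
    ContinuousAt f z := by
  obtain ⟨g, hg, hf⟩ := h
  exact ((AddCircle.continuous_mk' (1 : ℝ)).continuousAt.comp hg.continuousAt).congr
    (hf.mono fun _ hy => hy.symm)

/-- The branch `circleLift a` is continuous away from the cut, so after composition with `f` it
differs by a local constant from a smooth lift of `f`. -/
theorem SmoothCircleAt.contMDiffAt_circleLift {f : Z → UnitAddCircle} {z : Z} {a : ℝ}
    (h : SmoothCircleAt I f z) (ha : f z ≠ a) :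
    ContMDiffAt I 𝓘(ℝ, ℝ) ∞ (fun y => circleLift a (f y)) z := by
  have hfc := h.continuousAt
  obtain ⟨g, hg, hf⟩ := h
  have h1 : ∀ᶠ y in 𝓝 z, (circleLift a (f y) : UnitAddCircle) = g y := by
    filter_upwards [hf, hfc.eventually_ne ha] with y h1 h2
    rw [coe_circleLift h2, h1]
  have h2 : ContinuousAt (fun y => circleLift a (f y)) z :=
    ContinuousAt.comp (f := f) (continuousAt_circleLift ha) hfc
  exact (hg.add contMDiffAt_const).congr_of_eventuallyEq
    (eventually_sub_eq_of_lifts h2 hg.continuousAt h1)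

end Lift

/-- A smooth cocycle of torus-valued functions, relative to an open cover. -/
structure TorusCocycle (J : Type*) [Fintype J]
    (E : Type*) [NormedAddCommGroup E] [NormedSpace ℝ E]
    (M : Type uM) [TopologicalSpace M] [ChartedSpace E M] {ι : Type*} (U : ι → Set M) where
  isOpen_cover : ∀ α, IsOpen (U α)
  cover : ∀ m : M, ∃ α, m ∈ U α
  /-- the gluing functions -/
  fn : ι → ι → M → Torus J
  smooth : ∀ α β j, SmoothCircleOn E (fun m => fn α β m j) (U α ∩ U β)
  cocycle : ∀ α β γ m, m ∈ U α → m ∈ U β → m ∈ U γ → fn α β m + fn β γ m = fn α γ m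

namespace TorusCocycle

variable {J : Type*} [Fintype J]
  {E : Type*} [NormedAddCommGroup E] [NormedSpace ℝ E]
  {M : Type uM} [TopologicalSpace M] [ChartedSpace E M] {ι : Type*} {U : ι → Set M}
  (c : TorusCocycle J E M U)

/-- The total space of the bundle: a point over `m` is given by its coordinate with respect to a
chosen member of the cover that contains `m`. -/
def Total (_ : TorusCocycle J E M U) : Type _ := M × Torus J

/-- The chosen member of the cover at `m`. -/
noncomputable def frame (m : M) : ι := (c.cover m).choose

theorem frame_mem (m : M) : m ∈ U (c.frame m) := (c.cover m).choose_spec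

variable {c} in
/-- The projection. -/
def Total.base (x : c.Total) : M := x.1

variable {c} in
/-- The fibre coordinate over `U α`. -/
noncomputable def Total.coord (x : c.Total) (α : ι) : Torus J :=
  x.2 - c.fn α (c.frame x.1) x.1

/-- The point over `m` with coordinate `t` over `U α`. -/
noncomputable def point (α : ι) (m : M) (t : Torus J) : c.Total :=
  (m, t + c.fn α (c.frame m) m)

@[simp] theorem base_point (α : ι) (m : M) (t : Torus J) : (c.point α m t).base = m := rfl

@[simp] theorem coord_point (α : ι) (m : M) (t : Torus J) : (c.point α m t).coord α = t := by
  simp [Total.coord, point]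

@[simp] theorem point_coord (α : ι) (x : c.Total) : c.point α x.base (x.coord α) = x := by
  simp only [Total.coord, point, Total.base, sub_add_cancel]
  rfl

theorem coord_sub_coord {α β : ι} {x : c.Total} (hα : x.base ∈ U α) (hβ : x.base ∈ U β) :
    x.coord α - x.coord β = - c.fn α β x.base := by
  rw [Total.coord, Total.coord,
    ← c.cocycle α β (c.frame x.1) x.1 hα hβ (c.frame_mem x.1)]
  change _ = - c.fn α β x.1
  abel

theorem coord_eq {α β : ι} {x : c.Total} (hα : x.base ∈ U α) (hβ : x.base ∈ U β) :
    x.coord β = x.coord α + c.fn α β x.base := by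
  rw [← sub_eq_iff_eq_add', ← neg_sub, c.coord_sub_coord hα hβ, neg_neg]

theorem ext_of_coord {x y : c.Total} (α : ι) (h : x.base = y.base)
    (h' : x.coord α = y.coord α) : x = y := by
  rw [← c.point_coord α x, ← c.point_coord α y, h, h']

/-- The chart given by the member `α` of the cover, the chart of the base at `m₀`, and the
lifts of the coordinates to the intervals `(a j, a j + 1)`. -/
noncomputable def chart (α : ι) (m₀ : M) (a : J → ℚ) : PartialEquiv c.Total (E × (J → ℝ)) where
  toFun x := (chartAt E m₀ x.base, fun j => circleLift (a j) (x.coord α j))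
  invFun z := c.point α ((chartAt E m₀).symm z.1) (toTorus z.2)
  source := {x | x.base ∈ U α ∧ x.base ∈ (chartAt E m₀).source ∧
    ∀ j, x.coord α j ≠ ((a j : ℝ) : UnitAddCircle)}
  target := {z | (chartAt E m₀).symm z.1 ∈ U α ∧ z.1 ∈ (chartAt E m₀).target ∧
    ∀ j, z.2 j ∈ Set.Ioo (a j : ℝ) (a j + 1)}
  map_source' x hx := by
    refine ⟨?_, (chartAt E m₀).map_source hx.2.1, fun j => circleLift_mem (hx.2.2 j)⟩
    change (chartAt E m₀).symm (chartAt E m₀ x.base) ∈ U α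
    rw [(chartAt E m₀).left_inv hx.2.1]
    exact hx.1
  map_target' z hz := by
    refine ⟨hz.1, (chartAt E m₀).map_target hz.2.1, fun j => ?_⟩
    rw [coord_point]
    exact coe_ne_of_mem_Ioo (hz.2.2 j)
  left_inv' x hx := by
    refine c.ext_of_coord α ((chartAt E m₀).left_inv hx.2.1) ?_
    rw [coord_point]
    exact funext fun j => coe_circleLift (hx.2.2 j)
  right_inv' z hz := by
    rw [base_point, (chartAt E m₀).right_inv hz.2.1, coord_point]
    exact Prod.ext rfl (funext fun j => circleLift_coe (hz.2.2 j))

variable {c} in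
theorem exists_mem_chart_source {α : ι} {x : c.Total} (hx : x.base ∈ U α) {m₀ : M}
    (hm : x.base ∈ (chartAt E m₀).source) : ∃ a, x ∈ (c.chart α m₀ a).source := by
  choose a ha using fun j => exists_rat_ne (x.coord α j)
  exact ⟨a, hx, hm, ha⟩

section Transition

variable {α : ι} {m₀ : M} {a : J → ℚ} {z : E × (J → ℝ)}

theorem contMDiffAt_chart_symm_fst [IsManifold 𝓘(ℝ, E) ∞ M] (hz : z ∈ (c.chart α m₀ a).target) :
    ContMDiffAt 𝓘(ℝ, E × (J → ℝ)) 𝓘(ℝ, E) ∞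
      (fun z : E × (J → ℝ) => (chartAt E m₀).symm z.1) z := by
  have h1 : ContMDiff 𝓘(ℝ, E × (J → ℝ)) 𝓘(ℝ, E) ∞ (fun z : E × (J → ℝ) => z.1) :=
    contDiff_fst.contMDiff
  have h2 : ContMDiffAt 𝓘(ℝ, E) 𝓘(ℝ, E) ∞ (chartAt E m₀).symm z.1 :=
    (contMDiffOn_chart_symm (I := 𝓘(ℝ, E)) (x := m₀)).contMDiffAt
      ((chartAt E m₀).open_target.mem_nhds hz.2.1)
  exact h2.comp z h1.contMDiffAt

/-- In the chart of `α` the coordinate of index `β` reads `t + g_αβ(m)`. This is where smoothness of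
the cocycle enters the atlas; the arbitrary choice of frame in `Total` does not appear. -/
theorem smoothCircleAt_coord_chart_symm [IsManifold 𝓘(ℝ, E) ∞ M]
    (hz : z ∈ (c.chart α m₀ a).target) {β : ι} (hβ : (chartAt E m₀).symm z.1 ∈ U β) (j : J) :
    SmoothCircleAt 𝓘(ℝ, E × (J → ℝ))
      (fun z => ((c.chart α m₀ a).symm z).coord β j) z := by
  have h0 := c.contMDiffAt_chart_symm_fst hz
  have h1 : ContMDiff 𝓘(ℝ, E × (J → ℝ)) 𝓘(ℝ, ℝ) ∞ (fun z : E × (J → ℝ) => z.2 j) :=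
    ((contDiff_apply ℝ ℝ j).comp contDiff_snd).contMDiff
  refine ((smoothCircleAt_coe h1.contMDiffAt).add (SmoothCircleAt.comp
    (c := fun z : E × (J → ℝ) => (chartAt E m₀).symm z.1)
    ((c.smooth α β j).smoothCircleAt ⟨hz.1, hβ⟩) h0)).congr ?_
  filter_upwards [h0.continuousAt.eventually ((c.isOpen_cover α).mem_nhds hz.1),
    h0.continuousAt.eventually ((c.isOpen_cover β).mem_nhds hβ)] with y hα' hβ'
  have := c.coord_eq (x := (c.chart α m₀ a).symm y) hα' hβ'
  rw [this]
  exact congrArg (fun t : Torus J => t j + c.fn α β ((chartAt E m₀).symm y.1) j)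
    (c.coord_point α ((chartAt E m₀).symm y.1) (toTorus y.2))

theorem isOpen_chart_target (α : ι) (m₀ : M) (a : J → ℚ) : IsOpen (c.chart α m₀ a).target := by
  have h1 : IsOpen ((chartAt E m₀).target ∩ (chartAt E m₀).symm ⁻¹' U α) :=
    (chartAt E m₀).isOpen_inter_preimage_symm (c.isOpen_cover α)
  have h2 : IsOpen {r : J → ℝ | ∀ j, r j ∈ Set.Ioo (a j : ℝ) (a j + 1)} := by
    have : {r : J → ℝ | ∀ j, r j ∈ Set.Ioo (a j : ℝ) (a j + 1)} =
        Set.univ.pi fun j => Set.Ioo (a j : ℝ) (a j + 1) := by ext; simp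
    rw [this]
    exact isOpen_set_pi Set.finite_univ fun _ _ => isOpen_Ioo
  convert h1.prod h2 using 1
  ext z
  simp only [chart, Set.mem_ofPred_eq, Set.mem_prod, Set.mem_inter_iff, Set.mem_preimage]
  tauto

theorem isOpen_transition_source [IsManifold 𝓘(ℝ, E) ∞ M] (α : ι) (m₀ : M) (a : J → ℚ)
    (β : ι) (m₁ : M) (b : J → ℚ) :
    IsOpen ((c.chart α m₀ a).symm.trans (c.chart β m₁ b)).source := by
  rw [isOpen_iff_mem_nhds]
  rintro z ⟨hz, hβ, hm, hb⟩
  have hz' : z ∈ (c.chart α m₀ a).target := hz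
  have h0 := (c.contMDiffAt_chart_symm_fst hz').continuousAt
  filter_upwards [(c.isOpen_chart_target α m₀ a).mem_nhds hz',
    h0.eventually ((c.isOpen_cover β).mem_nhds hβ),
    h0.eventually ((chartAt E m₁).open_source.mem_nhds hm),
    Filter.eventually_all.2 fun j =>
      (c.smoothCircleAt_coord_chart_symm hz' hβ j).continuousAt.eventually_ne (hb j)]
    with y h1 h2 h3 h4
  exact ⟨h1, h2, h3, h4⟩

theorem contDiffOn_transition [IsManifold 𝓘(ℝ, E) ∞ M] (α : ι) (m₀ : M) (a : J → ℚ)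
    (β : ι) (m₁ : M) (b : J → ℚ) :
    ContDiffOn ℝ ∞ ((c.chart α m₀ a).symm.trans (c.chart β m₁ b))
      ((c.chart α m₀ a).symm.trans (c.chart β m₁ b)).source := by
  rintro z ⟨hz, hβ, hm, hb⟩
  have hz' : z ∈ (c.chart α m₀ a).target := hz
  have h0 := c.contMDiffAt_chart_symm_fst hz'
  have h1 : ContMDiffAt 𝓘(ℝ, E) 𝓘(ℝ, E) ∞ (chartAt E m₁) ((chartAt E m₀).symm z.1) :=
    (contMDiffOn_chart (I := 𝓘(ℝ, E)) (x := m₁)).contMDiffAt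
      ((chartAt E m₁).open_source.mem_nhds hm)
  have h2 : ContMDiffAt 𝓘(ℝ, E × (J → ℝ)) 𝓘(ℝ, J → ℝ) ∞
      (fun z j => circleLift (b j) (((c.chart α m₀ a).symm z).coord β j)) z :=
    contMDiffAt_pi_space.2 fun j =>
      (c.smoothCircleAt_coord_chart_symm hz' hβ j).contMDiffAt_circleLift (hb j)
  exact ((h1.comp z h0).contDiffAt.prodMk h2.contDiffAt).contDiffWithinAt

end Transition

/-- The charts of the total space. -/
noncomputable def core [IsManifold 𝓘(ℝ, E) ∞ M] : ChartedSpaceCore (E × (J → ℝ)) c.Total where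
  atlas := {e | ∃ α m₀ a, e = c.chart α m₀ a}
  chartAt x := c.chart (c.frame x.base) x.base
    fun j => (exists_rat_ne (x.coord (c.frame x.base) j)).choose
  mem_chart_source x := ⟨c.frame_mem x.base, mem_chart_source E x.base,
    fun j => (exists_rat_ne (x.coord (c.frame x.base) j)).choose_spec⟩
  chart_mem_atlas x := ⟨_, _, _, rfl⟩
  open_source := by
    rintro _ _ ⟨α, m₀, a, rfl⟩ ⟨β, m₁, b, rfl⟩
    exact c.isOpen_transition_source α m₀ a β m₁ b
  continuousOn_toFun := by
    rintro _ _ ⟨α, m₀, a, rfl⟩ ⟨β, m₁, b, rfl⟩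
    exact (c.contDiffOn_transition α m₀ a β m₁ b).continuousOn

variable [IsManifold 𝓘(ℝ, E) ∞ M]

noncomputable instance : TopologicalSpace c.Total := c.core.toTopologicalSpace

noncomputable instance : ChartedSpace (E × (J → ℝ)) c.Total := c.core.toChartedSpace

/-- The chart `chart α m₀ a` as a partial homeomorphism. -/
noncomputable def chartHomeo (α : ι) (m₀ : M) (a : J → ℚ) :
    OpenPartialHomeomorph c.Total (E × (J → ℝ)) :=
  c.core.openPartialHomeomorph (c.chart α m₀ a) ⟨α, m₀, a, rfl⟩

theorem mem_atlas_iff {e : OpenPartialHomeomorph c.Total (E × (J → ℝ))} :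
    e ∈ atlas (E × (J → ℝ)) c.Total ↔ ∃ α m₀ a, e = c.chartHomeo α m₀ a := by
  change e ∈ ⋃ (e : PartialEquiv c.Total (E × (J → ℝ))) (he : e ∈ c.core.atlas),
    {c.core.openPartialHomeomorph e he} ↔ _
  simp only [Set.mem_iUnion, Set.mem_singleton_iff]
  constructor
  · rintro ⟨_, ⟨α, m₀, a, rfl⟩, rfl⟩
    exact ⟨α, m₀, a, rfl⟩
  · rintro ⟨α, m₀, a, rfl⟩
    exact ⟨_, ⟨α, m₀, a, rfl⟩, rfl⟩

instance : IsManifold 𝓘(ℝ, E × (J → ℝ)) ∞ c.Total := by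
  refine isManifold_of_contDiffOn _ _ _ fun e e' he he' => ?_
  obtain ⟨α, m₀, a, rfl⟩ := c.mem_atlas_iff.1 he
  obtain ⟨β, m₁, b, rfl⟩ := c.mem_atlas_iff.1 he'
  refine (c.contDiffOn_transition α m₀ a β m₁ b).mono ?_
  rintro z ⟨hz, -⟩
  exact hz

theorem chartHomeo_mem_maximalAtlas (α : ι) (m₀ : M) (a : J → ℚ) :
    c.chartHomeo α m₀ a ∈ IsManifold.maximalAtlas 𝓘(ℝ, E × (J → ℝ)) ∞ c.Total :=
  IsManifold.subset_maximalAtlas (c.mem_atlas_iff.2 ⟨α, m₀, a, rfl⟩)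

end TorusCocycle

namespace TorusCocycle

variable {J : Type*} [Fintype J]
  {E : Type*} [NormedAddCommGroup E] [NormedSpace ℝ E]
  {M : Type uM} [TopologicalSpace M] [ChartedSpace E M] {ι : Type*} {U : ι → Set M}
  [IsManifold 𝓘(ℝ, E) ∞ M] (c : TorusCocycle J E M U)

variable {c} in
theorem contMDiffAt_chart {α : ι} {m₀ : M} {a : J → ℚ} {x : c.Total}
    (hx : x ∈ (c.chart α m₀ a).source) :
    ContMDiffAt 𝓘(ℝ, E × (J → ℝ)) 𝓘(ℝ, E × (J → ℝ)) ∞ (c.chart α m₀ a) x :=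
  (contMDiffOn_of_mem_maximalAtlas (c.chartHomeo_mem_maximalAtlas α m₀ a)).contMDiffAt
    ((c.chartHomeo α m₀ a).open_source.mem_nhds hx)

variable {c} in
theorem contMDiffAt_chart_symm {α : ι} {m₀ : M} {a : J → ℚ} {z : E × (J → ℝ)}
    (hz : z ∈ (c.chart α m₀ a).target) :
    ContMDiffAt 𝓘(ℝ, E × (J → ℝ)) 𝓘(ℝ, E × (J → ℝ)) ∞ (c.chart α m₀ a).symm z :=
  (contMDiffOn_symm_of_mem_maximalAtlas (c.chartHomeo_mem_maximalAtlas α m₀ a)).contMDiffAt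
    ((c.chartHomeo α m₀ a).open_target.mem_nhds hz)

theorem contMDiff_base :
    ContMDiff 𝓘(ℝ, E × (J → ℝ)) 𝓘(ℝ, E) ∞ (Total.base : c.Total → M) := by
  intro x
  obtain ⟨a, ha⟩ := exists_mem_chart_source (c.frame_mem x.base) (mem_chart_source E x.base)
  have h1 : ContMDiff 𝓘(ℝ, E × (J → ℝ)) 𝓘(ℝ, E) ∞ (fun z : E × (J → ℝ) => z.1) :=
    contDiff_fst.contMDiff
  have h2 : ContMDiffAt 𝓘(ℝ, E) 𝓘(ℝ, E) ∞ (chartAt E x.base).symm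
      (chartAt E x.base x.base) :=
    (contMDiffOn_chart_symm (I := 𝓘(ℝ, E)) (x := x.base)).contMDiffAt
      ((chartAt E x.base).open_target.mem_nhds (mem_chart_target E x.base))
  have h3 := h1.contMDiffAt.comp x (contMDiffAt_chart ha)
  refine (ContMDiffAt.comp x h2 h3).congr_of_eventuallyEq ?_
  filter_upwards [(c.chartHomeo _ _ a).open_source.mem_nhds ha] with y hy
  exact ((chartAt E x.base).left_inv hy.2.1).symm

theorem isOpen_base_preimage (α : ι) : IsOpen ((Total.base : c.Total → M) ⁻¹' U α) :=
  (c.isOpen_cover α).preimage c.contMDiff_base.continuous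

variable {c} in
theorem smoothCircleAt_coord {α : ι} {x : c.Total} (hx : x.base ∈ U α) (j : J) :
    SmoothCircleAt 𝓘(ℝ, E × (J → ℝ)) (fun x : c.Total => x.coord α j) x := by
  obtain ⟨a, ha⟩ := exists_mem_chart_source hx (mem_chart_source E x.base)
  have h1 : ContMDiff 𝓘(ℝ, E × (J → ℝ)) 𝓘(ℝ, ℝ) ∞ (fun z : E × (J → ℝ) => z.2 j) :=
    ((contDiff_apply ℝ ℝ j).comp contDiff_snd).contMDiff
  refine (smoothCircleAt_coe (h1.contMDiffAt.comp x (contMDiffAt_chart ha))).congr ?_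
  filter_upwards [(c.chartHomeo _ _ a).open_source.mem_nhds ha] with y hy
  exact (coe_circleLift (hy.2.2 j)).symm

section MapsTo

variable {F : Type*} [NormedAddCommGroup F] [NormedSpace ℝ F] {H : Type*} [TopologicalSpace H]
  {I : ModelWithCorners ℝ F H} {Z : Type*} [TopologicalSpace Z] [ChartedSpace H Z]

variable {c} in
/-- A map to the total space is smooth if its projection and its fibre coordinates are. -/
theorem contMDiffAt_of_coord {f : Z → c.Total} {z : Z} {α : ι} (hz : (f z).base ∈ U α)
    (hb : ContMDiffAt I 𝓘(ℝ, E) ∞ (fun y => (f y).base) z)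
    (hc : ∀ j, SmoothCircleAt I (fun y => (f y).coord α j) z) :
    ContMDiffAt I 𝓘(ℝ, E × (J → ℝ)) ∞ f z := by
  obtain ⟨a, ha⟩ := exists_mem_chart_source hz (mem_chart_source E (f z).base)
  have h1 : ContMDiffAt I 𝓘(ℝ, E) ∞ (fun y => chartAt E (f z).base (f y).base) z :=
    ContMDiffAt.comp (g := chartAt E (f z).base) (f := fun y => (f y).base) z
      ((contMDiffOn_chart (I := 𝓘(ℝ, E)) (x := (f z).base)).contMDiffAt
        ((chartAt E (f z).base).open_source.mem_nhds (mem_chart_source E _))) hb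
  have h2 : ContMDiffAt I 𝓘(ℝ, J → ℝ) ∞ (fun y j => circleLift (a j) ((f y).coord α j)) z :=
    contMDiffAt_pi_space.2 fun j => (hc j).contMDiffAt_circleLift (ha.2.2 j)
  have h3 : ContMDiffAt I 𝓘(ℝ, E × (J → ℝ)) ∞
      (fun y => c.chart α (f z).base a (f y)) z := h1.prodMk_space h2
  refine (ContMDiffAt.comp z (contMDiffAt_chart_symm
    ((c.chart α (f z).base a).map_source ha)) h3).congr_of_eventuallyEq ?_
  filter_upwards [hb.continuousAt.eventually ((c.isOpen_cover α).mem_nhds hz),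
    hb.continuousAt.eventually ((chartAt E (f z).base).open_source.mem_nhds
      (mem_chart_source E _)),
    Filter.eventually_all.2 fun j => (hc j).continuousAt.eventually_ne (ha.2.2 j)] with y h1 h2 h3
  exact ((c.chart α (f z).base a).left_inv ⟨h1, h2, h3⟩).symm

end MapsTo

/-- Points over different base points are separated in `M`; points of one fibre are separated in the
torus by the coordinate of a common frame. -/
instance [T2Space M] : T2Space c.Total := by
  refine ⟨fun x y hxy => ?_⟩
  by_cases hb : x.base = y.base
  · have hx := c.frame_mem x.base
    set α := c.frame x.base
    have hc : x.coord α ≠ y.coord α := fun h => hxy (c.ext_of_coord α hb h)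
    have hcont : ContinuousOn (fun x : c.Total => x.coord α) (Total.base ⁻¹' U α) :=
      fun z hz => (continuousAt_pi.2 fun j =>
        (smoothCircleAt_coord hz j).continuousAt).continuousWithinAt
    obtain ⟨u, v, hu, hv, hxu, hyv, huv⟩ := t2_separation hc
    have hy : y.base ∈ U α := hb ▸ hx
    exact ⟨_, _, hcont.isOpen_inter_preimage (c.isOpen_base_preimage α) hu,
      hcont.isOpen_inter_preimage (c.isOpen_base_preimage α) hv, ⟨hx, hxu⟩, ⟨hy, hyv⟩,
      (huv.preimage _).mono Set.inter_subset_right Set.inter_subset_right⟩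
  · exact separated_by_continuous c.contMDiff_base.continuous hb

/-- Countably many sets `U α ∩ (chart domain)` cover `M`, and over each of them the charts indexed
by rational cut points, again countably many, cover the total space. -/
instance [SecondCountableTopology M] [FiniteDimensional ℝ E] :
    SecondCountableTopology c.Total := by
  obtain ⟨s, hs, hsU⟩ := TopologicalSpace.countable_cover_nhds
    (f := fun m : M => U (c.frame m) ∩ (chartAt E m).source) fun m =>
      Filter.inter_mem ((c.isOpen_cover _).mem_nhds (c.frame_mem m)) (chart_source_mem_nhds E m)
  have : Countable s := hs.to_subtype
  have : ∀ i : s × (J → ℚ), SecondCountableTopology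
      (c.chartHomeo (c.frame i.1.1) i.1.1 i.2).source := fun i =>
    (c.chartHomeo (c.frame i.1.1) i.1.1 i.2).secondCountableTopology_source
  refine TopologicalSpace.secondCountableTopology_of_countable_cover
    (fun i : s × (J → ℚ) => (c.chartHomeo (c.frame i.1.1) i.1.1 i.2).open_source) ?_
  rw [Set.eq_univ_iff_forall]
  intro x
  have hx : x.base ∈ ⋃ m ∈ s, U (c.frame m) ∩ (chartAt E m).source := hsU ▸ Set.mem_univ _
  simp only [Set.mem_iUnion] at hx
  obtain ⟨m, hm, h1, h2⟩ := hx
  obtain ⟨a, ha⟩ := exists_mem_chart_source h1 h2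
  exact Set.mem_iUnion.2 ⟨(⟨m, hm⟩, a), ha⟩

/-- The torus bundle glued from a cocycle. -/
noncomputable def bundle : PrincipalTorusBundle J E M (E × (J → ℝ)) c.Total U where
  isOpen_cover := c.isOpen_cover
  cover := c.cover
  proj := Total.base
  proj_smooth := c.contMDiff_base
  -- The stored coordinate differs from every other one by a function of the base point, so
  -- translating it translates all of them.
  act t x := (x.1, t + x.2)
  act_zero x := Prod.ext rfl (zero_add _)
  act_add s t x := Prod.ext rfl (add_assoc _ _ _)
  act_smooth := by
    rintro ⟨r₀, x₀⟩
    have hx := c.frame_mem x₀.base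
    have h2 : ContMDiffAt (𝓘(ℝ, J → ℝ).prod 𝓘(ℝ, E × (J → ℝ))) 𝓘(ℝ, E × (J → ℝ)) ∞
      (fun p : (J → ℝ) × c.Total => p.2) (r₀, x₀) := contMDiffAt_snd
    refine contMDiffAt_of_coord (α := c.frame x₀.base) hx
      (ContMDiffAt.comp (f := fun p : (J → ℝ) × c.Total => p.2) (r₀, x₀)
        c.contMDiff_base.contMDiffAt h2) fun j => ?_
    have e1 : ContMDiff 𝓘(ℝ, J → ℝ) 𝓘(ℝ, ℝ) ∞ (fun r : J → ℝ => r j) :=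
      (contDiff_apply ℝ ℝ j).contMDiff
    refine ((smoothCircleAt_coe ((e1.comp contMDiff_fst).contMDiffAt)).add
      (SmoothCircleAt.comp (c := fun p : (J → ℝ) × c.Total => p.2)
        (smoothCircleAt_coord (x := x₀) hx j) h2)).congr (Filter.Eventually.of_forall fun p => ?_)
    exact add_sub_assoc (toTorus p.1 j) _ _
  proj_act _ _ := rfl
  coord α x := x.coord α
  coord_smooth α j := smoothCircleOn_of_smoothCircleAt (c.isOpen_base_preimage α)
    fun _ hx => smoothCircleAt_coord hx j
  coord_act α t x _ := add_sub_assoc t _ _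
  coord_inj α _ _ _ hb hc := c.ext_of_coord α hb hc
  exists_section α := by
    refine ⟨fun m => c.point α m 0, fun m hm => ContMDiffAt.contMDiffWithinAt ?_, fun m _ =>
      ⟨c.base_point α m 0, c.coord_point α m 0⟩⟩
    refine contMDiffAt_of_coord (f := fun m => c.point α m 0) (α := α) hm contMDiffAt_id fun j => ?_
    simp only [coord_point]
    exact smoothCircleAt_const _ _

theorem hasGluing_bundle : c.bundle.HasGluing c.fn := fun _ _ _ hα hβ => c.coord_sub_coord hα hβ

end TorusCocycle

/-! ### The double torus bundle as a fibre product -/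

section FibreProduct

variable {J : Type*} [Fintype J]
  {E : Type*} [NormedAddCommGroup E] [NormedSpace ℝ E]
  {M : Type*} [TopologicalSpace M] [ChartedSpace E M]
  {E' : Type*} [NormedAddCommGroup E'] [NormedSpace ℝ E']
  {X : Type*} [TopologicalSpace X] [ChartedSpace E' X]
  {E'' : Type*} [NormedAddCommGroup E''] [NormedSpace ℝ E'']
  {Y : Type*} [TopologicalSpace Y] [ChartedSpace E'' Y]
  {F : Type*} [NormedAddCommGroup F] [NormedSpace ℝ F]
  {X' : Type*} [TopologicalSpace X'] [ChartedSpace F X']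
  {ι : Type*} {U : ι → Set M}
  {P : PrincipalTorusBundle J E M E' X U}
  {Q : PrincipalTorusBundle J E' X E'' Y (fun α => P.proj ⁻¹' U α)}
  {N : ι → M → Matrix J J ℤ} {P' : PrincipalTorusBundle J E M F X' U}
  {h : ι → ι → M → Torus J}

/-- Equality of fibre coordinates does not depend on the member of the cover. -/
theorem coord_eq_twistedCoord
    (hh : ∀ α β y, P.proj (Q.proj y) ∈ U α → P.proj (Q.proj y) ∈ U β →
      twistedCoord P Q N α y - twistedCoord P Q N β y = - h α β (P.proj (Q.proj y)))
    (h' : P'.HasGluing h) {α β : ι} {x : X'} {y : Y} (hα : P.proj (Q.proj y) ∈ U α)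
    (hβ : P.proj (Q.proj y) ∈ U β) (hxy : P'.proj x = P.proj (Q.proj y))
    (hc : P'.coord α x = twistedCoord P Q N α y) : P'.coord β x = twistedCoord P Q N β y := by
  have e1 := hh β α y hβ hα
  have e2 := h' β α x (by rwa [hxy]) (by rwa [hxy])
  rw [hxy, ← e1, hc] at e2
  exact sub_left_inj.1 e2

variable (P Q N P') in
/-- The map from the double torus bundle to the bundle of the second torus. -/
noncomputable def dualMap (y : Y) : X' :=
  P'.act (twistedCoord P Q N (P.cover (P.proj (Q.proj y))).choose y)
    (P'.sect (P.cover (P.proj (Q.proj y))).choose (P.proj (Q.proj y)))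

theorem proj_dualMap (y : Y) : P'.proj (dualMap P Q N P' y) = P.proj (Q.proj y) := by
  rw [dualMap, P'.proj_act, P'.proj_sect (P.cover _).choose_spec]

/-- The definition of `dualMap` imposes this for one chosen frame; since `θ̃` and the coordinates of
`P'` share the gluing functions `h`, it then holds for every frame. -/
theorem coord_dualMap
    (hh : ∀ α β y, P.proj (Q.proj y) ∈ U α → P.proj (Q.proj y) ∈ U β →
      twistedCoord P Q N α y - twistedCoord P Q N β y = - h α β (P.proj (Q.proj y)))
    (h' : P'.HasGluing h) {α : ι} {y : Y} (hy : P.proj (Q.proj y) ∈ U α) :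
    P'.coord α (dualMap P Q N P' y) = twistedCoord P Q N α y := by
  have hβ := (P.cover (P.proj (Q.proj y))).choose_spec
  refine coord_eq_twistedCoord hh h' hβ hy (proj_dualMap y) ?_
  rw [dualMap, P'.coord_act _ _ _ (by rwa [P'.proj_sect hβ]), P'.coord_sect hβ, add_zero]

theorem contMDiff_dualMap
    (hN : ∀ α, ∀ m ∈ U α, ∀ᶠ m' in 𝓝 m, N α m' = N α m)
    (hh : ∀ α β y, P.proj (Q.proj y) ∈ U α → P.proj (Q.proj y) ∈ U β →
      twistedCoord P Q N α y - twistedCoord P Q N β y = - h α β (P.proj (Q.proj y)))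
    (h' : P'.HasGluing h) : ContMDiff 𝓘(ℝ, E'') 𝓘(ℝ, F) ∞ (dualMap P Q N P') := by
  intro y
  obtain ⟨α, hα⟩ := P.cover (P.proj (Q.proj y))
  have hM : ContMDiffAt 𝓘(ℝ, E'') 𝓘(ℝ, E) ∞ (fun y => P.proj (Q.proj y)) y :=
    (P.proj_smooth.comp Q.proj_smooth).contMDiffAt
  have h1 : ContMDiffAt 𝓘(ℝ, E'') 𝓘(ℝ, F) ∞ (fun y => P'.sect α (P.proj (Q.proj y))) y :=
    ContMDiffAt.comp (f := fun y => P.proj (Q.proj y)) y (P'.contMDiffAt_sect hα) hM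
  refine (P'.contMDiffAt_act (c := fun y => twistedCoord P Q N α y) (fun j =>
    (Q.smoothCircleAt_coord (x := y) hα j).sub
      ((P.smoothCircleAt_matTorus_coord (hN α) hα j).comp Q.proj_smooth.contMDiffAt))
    h1).congr_of_eventuallyEq ?_
  filter_upwards [(Q.isOpen_preimage α).mem_nhds hα] with y hy
  have hy' : P.proj (Q.proj y) ∈ U α := hy
  refine P'.coord_inj α _ _ (by rwa [proj_dualMap]) ?_ ?_
  · rw [proj_dualMap, P'.proj_act, P'.proj_sect hy']
  · rw [coord_dualMap hh h' hy', P'.coord_act _ _ _ (by rwa [P'.proj_sect hy']),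
      P'.coord_sect hy', add_zero]

variable (P Q N P') in
/-- The point of the double torus bundle over `x` with second coordinate that of `x'`. -/
noncomputable def pairPointOn (α : ι) (z : X × X') : Y :=
  Q.act (P'.coord α z.2 + matTorus (N α (P.proj z.1)) (P.coord α z.1)) (Q.sect α z.1)

theorem proj_pairPointOn {α : ι} {z : X × X'} (hz : P.proj z.1 ∈ U α) :
    Q.proj (pairPointOn P Q N P' α z) = z.1 := by
  rw [pairPointOn, Q.proj_act, Q.proj_sect hz]

theorem twistedCoord_pairPointOn {α : ι} {z : X × X'} (hz : P.proj z.1 ∈ U α) :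
    twistedCoord P Q N α (pairPointOn P Q N P' α z) = P'.coord α z.2 := by
  have h1 : Q.coord α (pairPointOn P Q N P' α z) =
      P'.coord α z.2 + matTorus (N α (P.proj z.1)) (P.coord α z.1) := by
    rw [pairPointOn, Q.coord_act _ _ _ (by rw [Q.proj_sect hz]; exact hz), Q.coord_sect hz,
      add_zero]
  rw [twistedCoord, h1, proj_pairPointOn hz, add_sub_cancel_right]

theorem pairPointOn_eq
    (hh : ∀ α β y, P.proj (Q.proj y) ∈ U α → P.proj (Q.proj y) ∈ U β →
      twistedCoord P Q N α y - twistedCoord P Q N β y = - h α β (P.proj (Q.proj y)))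
    (h' : P'.HasGluing h) {α β : ι} {z : X × X'} (hα : P.proj z.1 ∈ U α) (hβ : P.proj z.1 ∈ U β)
    (hz : P.proj z.1 = P'.proj z.2) :
    pairPointOn P Q N P' α z = pairPointOn P Q N P' β z := by
  have e1 : P.proj (Q.proj (pairPointOn P Q N P' α z)) = P.proj z.1 := by
    rw [proj_pairPointOn hα]
  refine eq_of_twistedCoord_eq N (α := β) (by rwa [e1])
    (by rw [proj_pairPointOn hα, proj_pairPointOn hβ])
    (by rw [proj_pairPointOn hα, proj_pairPointOn hβ]) ?_
  rw [twistedCoord_pairPointOn hβ]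
  exact (coord_eq_twistedCoord hh h' (by rwa [e1]) (by rwa [e1]) (by rw [e1, hz])
    (twistedCoord_pairPointOn hα).symm).symm

/-- With `α` fixed, the formula makes sense at pairs outside the fibre product, so it is smooth on
an open subset of `X × X'`. The inverse of `(p, q)` agrees with it only on the fibre product, where
independence of `α` is available. -/
theorem contMDiffAt_pairPointOn (hN : ∀ α, ∀ m ∈ U α, ∀ᶠ m' in 𝓝 m, N α m' = N α m) {α : ι}
    {z : X × X'} (hα : P.proj z.1 ∈ U α) (hα' : P'.proj z.2 ∈ U α) :
    ContMDiffAt (𝓘(ℝ, E').prod 𝓘(ℝ, F)) 𝓘(ℝ, E'') ∞ (pairPointOn P Q N P' α) z := by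
  have h1 : ContMDiffAt (𝓘(ℝ, E').prod 𝓘(ℝ, F)) 𝓘(ℝ, E') ∞ (fun z : X × X' => z.1) z :=
    contMDiffAt_fst
  have h2 : ContMDiffAt (𝓘(ℝ, E').prod 𝓘(ℝ, F)) 𝓘(ℝ, F) ∞ (fun z : X × X' => z.2) z :=
    contMDiffAt_snd
  have h3 : ContMDiffAt (𝓘(ℝ, E').prod 𝓘(ℝ, F)) 𝓘(ℝ, E'') ∞
      (fun z : X × X' => Q.sect α z.1) z :=
    ContMDiffAt.comp (f := fun z : X × X' => z.1) z (Q.contMDiffAt_sect hα) h1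
  exact Q.contMDiffAt_act (c := fun z : X × X' => P'.coord α z.2 +
    matTorus (N α (P.proj z.1)) (P.coord α z.1)) (fun j =>
      (SmoothCircleAt.comp (c := fun z : X × X' => z.2) (P'.smoothCircleAt_coord hα' j) h2).add
      (SmoothCircleAt.comp (c := fun z : X × X' => z.1)
        (P.smoothCircleAt_matTorus_coord (hN α) hα j) h1)) h3

theorem isFibreProduct_dualMap (hN : ∀ α, ∀ m ∈ U α, ∀ᶠ m' in 𝓝 m, N α m' = N α m)
    (hh : ∀ α β y, P.proj (Q.proj y) ∈ U α → P.proj (Q.proj y) ∈ U β →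
      twistedCoord P Q N α y - twistedCoord P Q N β y = - h α β (P.proj (Q.proj y)))
    (h' : P'.HasGluing h) :
    IsFibreProduct (E₁ := E') (E₂ := F) (E₃ := E'') P.proj P'.proj Q.proj
      (dualMap P Q N P') := by
  refine ⟨Q.proj_smooth, contMDiff_dualMap hN hh h', fun y => (proj_dualMap y).symm,
    fun z => pairPointOn P Q N P' (P.cover (P.proj z.1)).choose z, fun z hz => ?_,
    fun z hz => ?_, fun y => ?_⟩
  · have hz' : P.proj z.1 = P'.proj z.2 := hz
    obtain ⟨α, hα⟩ := P.cover (P.proj z.1)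
    refine (contMDiffAt_pairPointOn (Q := Q) hN hα (hz' ▸ hα)).contMDiffWithinAt.congr_of_eventuallyEq
      ?_ (pairPointOn_eq hh h' (P.cover _).choose_spec hα hz')
    have hopen : IsOpen {z : X × X' | P.proj z.1 ∈ U α} :=
      (P.isOpen_preimage α).preimage continuous_fst
    filter_upwards [self_mem_nhdsWithin, mem_nhdsWithin_of_mem_nhds (hopen.mem_nhds hα)] with w h1 h2
    exact pairPointOn_eq hh h' (P.cover _).choose_spec h2 h1
  · have hα := (P.cover (P.proj z.1)).choose_spec
    have e0 := proj_pairPointOn (Q := Q) (N := N) (P' := P') hα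
    refine ⟨e0, P'.coord_inj (P.cover (P.proj z.1)).choose _ _ ?_ ?_ ?_⟩
    · rw [proj_dualMap, e0]; exact hα
    · rw [proj_dualMap, e0, hz]
    · rw [coord_dualMap hh h' (by rw [e0]; exact hα), twistedCoord_pairPointOn hα]
  · have hα := (P.cover (P.proj (Q.proj y))).choose_spec
    have e0 := proj_pairPointOn (Q := Q) (N := N) (P' := P')
      (z := (Q.proj y, dualMap P Q N P' y)) hα
    refine eq_of_twistedCoord_eq (P := P) (Q := Q) N
      (α := (P.cover (P.proj (Q.proj y))).choose) ?_ ?_ ?_ ?_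
    · rw [e0]; exact hα
    · rw [e0]
    · rw [e0]
    · rw [twistedCoord_pairPointOn (z := (Q.proj y, dualMap P Q N P' y)) hα]
      exact coord_dualMap hh h' hα

theorem dualMap_act {D : PrincipalTorusBundle (J ⊕ J) E M E'' Y U}
    (hh : ∀ α β y, P.proj (Q.proj y) ∈ U α → P.proj (Q.proj y) ∈ U β →
      twistedCoord P Q N α y - twistedCoord P Q N β y = - h α β (P.proj (Q.proj y)))
    (h' : P'.HasGluing h) (hD : D.proj = P.proj ∘ Q.proj)
    (hc : ∀ α y, D.proj y ∈ U α → ∀ j, D.coord α y (Sum.inr j) = twistedCoord P Q N α y j)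
    (s t : Torus J) (y : Y) :
    dualMap P Q N P' (D.act (Sum.elim s t) y) = P'.act t (dualMap P Q N P' y) := by
  have hD' : ∀ y, D.proj y = P.proj (Q.proj y) := fun y => by rw [hD]; rfl
  obtain ⟨α, hα⟩ := P.cover (P.proj (Q.proj y))
  have e0 : P.proj (Q.proj (D.act (Sum.elim s t) y)) = P.proj (Q.proj y) := by
    rw [← hD', D.proj_act, hD']
  refine P'.coord_inj α _ _ (by rwa [proj_dualMap, e0]) ?_ ?_
  · rw [proj_dualMap, P'.proj_act, proj_dualMap, e0]
  · rw [coord_dualMap hh h' (by rwa [e0]), P'.coord_act _ _ _ (by rwa [proj_dualMap]),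
      coord_dualMap hh h' hα]
    funext j
    rw [← hc α _ (by rwa [hD', e0]), D.coord_act α _ _ (by rwa [hD']), Pi.add_apply, Pi.add_apply,
      hc α _ (by rwa [hD'])]
    rfl

end FibreProduct

/-- The gluing functions of a principal bundle whose coordinates are the differences of the given
functions form a cocycle. -/
theorem gluing_cocycle {J : Type*} [Fintype J]
    {E : Type*} [NormedAddCommGroup E] [NormedSpace ℝ E]
    {M : Type*} [TopologicalSpace M] [ChartedSpace E M]
    {E' : Type*} [NormedAddCommGroup E'] [NormedSpace ℝ E']
    {X : Type*} [TopologicalSpace X] [ChartedSpace E' X] {ι : Type*} {U : ι → Set M}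
    {P : PrincipalTorusBundle J E M E' X U} {g : ι → ι → M → Torus J} (hg : P.HasGluing g)
    {α β γ : ι} {m : M} (hα : m ∈ U α) (hβ : m ∈ U β) (hγ : m ∈ U γ) :
    g α β m + g β γ m = g α γ m := by
  have h0 := P.proj_sect hα
  have h1 := hg α β (P.sect α m) (by rwa [h0]) (by rwa [h0])
  have h2 := hg β γ (P.sect α m) (by rwa [h0]) (by rwa [h0])
  have h3 := hg α γ (P.sect α m) (by rwa [h0]) (by rwa [h0])
  rw [h0] at h1 h2 h3
  rw [← neg_inj, neg_add, ← h1, ← h2, ← h3, sub_add_sub_cancel]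

/-- Unfolding `θ̃` gives minus the gluing function on `X`; the content is that this has descended to
the base, which is what the double bundle needs. -/
theorem twistedCoord_sub {J : Type*} [Fintype J]
    {E : Type*} [NormedAddCommGroup E] [NormedSpace ℝ E]
    {M : Type*} [TopologicalSpace M] [ChartedSpace E M]
    {E' : Type*} [NormedAddCommGroup E'] [NormedSpace ℝ E'] [FiniteDimensional ℝ E']
    {X : Type*} [TopologicalSpace X] [ChartedSpace E' X] [IsManifold 𝓘(ℝ, E') ∞ X]
    {E'' : Type*} [NormedAddCommGroup E''] [NormedSpace ℝ E'']
    {Y : Type*} [TopologicalSpace Y] [ChartedSpace E'' Y]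
    {ι : Type*} {U : ι → Set M}
    {P : PrincipalTorusBundle J E M E' X U} {Θ : J → OneForm E' X}
    {G : GerbeConn E' X (fun α => P.proj ⁻¹' U α)} {N : ι → M → Matrix J J ℤ}
    {Q : PrincipalTorusBundle J E' X E'' Y (fun α => P.proj ⁻¹' U α)}
    {lamS : ι → ι → X → Torus J} (hΘ : P.IsConnection Θ) (hG : G.Invariant P)
    (hQ : IsCorrespondence P G Q lamS) (hN : IsCoboundary P G N) (α β : ι) (y : Y)
    (hα : P.proj (Q.proj y) ∈ U α) (hβ : P.proj (Q.proj y) ∈ U β) :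
    twistedCoord P Q N α y - twistedCoord P Q N β y =
      - baseGluing P N lamS α β (P.proj (Q.proj y)) := by
  have h1 := hQ.gluing α β y hα hβ
  rw [baseGluing_proj hΘ hG hQ hN hα hβ, dualGluing, twistedCoord, twistedCoord,
    sub_eq_iff_eq_add.1 h1]
  abel

end TorusGerbe
open TorusGerbe

theorem mainTheorem7 {n : ℕ} {ι : Type*}
    {E : Type*} [NormedAddCommGroup E] [NormedSpace ℝ E] [FiniteDimensional ℝ E]
    {M : Type uM} [TopologicalSpace M] [ChartedSpace E M] [IsManifold 𝓘(ℝ, E) ∞ M]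
    [T2Space M] [SecondCountableTopology M]
    {E' : Type*} [NormedAddCommGroup E'] [NormedSpace ℝ E'] [FiniteDimensional ℝ E']
    {X : Type*} [TopologicalSpace X] [ChartedSpace E' X] [IsManifold 𝓘(ℝ, E') ∞ X]
    {E'' : Type*} [NormedAddCommGroup E''] [NormedSpace ℝ E''] [FiniteDimensional ℝ E'']
    {Y : Type*} [TopologicalSpace Y] [ChartedSpace E'' Y] [IsManifold 𝓘(ℝ, E'') ∞ Y]
    (U : ι → Set M)
    (P : PrincipalTorusBundle (Fin n) E M E' X U)
    (lam : ι → ι → M → Torus (Fin n)) (hlam : P.HasGluing lam)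
    (Θ : Fin n → OneForm E' X) (hΘ : P.IsConnection Θ)
    (G : GerbeConn E' X (fun α => P.proj ⁻¹' U α)) (hG : G.Invariant P)
    (Q : PrincipalTorusBundle (Fin n) E' X E'' Y (fun α => P.proj ⁻¹' U α))
    (lamS : ι → ι → X → Torus (Fin n)) (hQ : IsCorrespondence P G Q lamS)
    (N : ι → M → Matrix (Fin n) (Fin n) ℤ) (hN : IsCoboundary P G N) :
    ∃ (h : ι → ι → M → Torus (Fin n)) (B₁ : ι → Fin n → OneForm E M),
      -- the gluing functions `h` of the dual torus
      (∀ α β j, SmoothCircleOn E (fun m => h α β m j) (U α ∩ U β)) ∧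
      (∀ α β x, P.proj x ∈ U α → P.proj x ∈ U β →
        h α β (P.proj x) = lamS α β x + matTorus (N α (P.proj x)) (P.coord α x)
          - matTorus (N β (P.proj x)) (P.coord β x)) ∧
      -- the component `B₁` of the gerbe connection
      (∀ α j, OneForm.SmoothOn E (B₁ α j) (U α)) ∧
      (∀ α j x, P.proj x ∈ U α →
        OneForm.pullback E P.proj (B₁ α j) x = compOne P Θ (shiftedB P G N α) j x) ∧
      (∀ α β j m, m ∈ U α → m ∈ U β →
        HasCircleDerivAt E (fun m => h α β m j) m (B₁ α j m - B₁ β j m)) ∧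
      -- `Y` is a principal double torus bundle over `M`
      ∃ (D : PrincipalTorusBundle (Fin n ⊕ Fin n) E M E'' Y U)
        (Θt : Fin n → OneForm E'' Y),
        D.proj = P.proj ∘ Q.proj ∧
        (∀ s t y, Q.proj (D.act (Sum.elim s t) y) = P.act s (Q.proj y)) ∧
        (∀ t y, D.act (Sum.elim 0 t) y = Q.act t y) ∧
        (∀ α y, D.proj y ∈ U α → D.coord α y = Sum.elim (P.coord α (Q.proj y))
          (Q.coord α y - matTorus (N α (D.proj y)) (P.coord α (Q.proj y)))) ∧
        D.HasGluing (fun α β m => Sum.elim (lam α β m) (h α β m)) ∧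
        -- the connection forms are `Θ` and `Θt = dθ̃ + B₁`
        D.IsConnection (Sum.elim (fun j => OneForm.pullback E' Q.proj (Θ j)) Θt) ∧
        (∀ α j y, D.proj y ∈ U α →
          HasCircleDerivAt E'' (fun y => D.coord α y (Sum.inr j)) y
            (Θt j y - OneForm.pullback E D.proj (B₁ α j) y)) ∧
        -- `Y` is the fibre product of `X` with the principal torus bundle `X'` glued by `h`
        ∃ (X' : Type uM) (_ : TopologicalSpace X') (_ : ChartedSpace (E × (Fin n → ℝ)) X')
          (_ : IsManifold 𝓘(ℝ, E × (Fin n → ℝ)) ∞ X') (_ : T2Space X')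
          (_ : SecondCountableTopology X')
          (P' : PrincipalTorusBundle (Fin n) E M (E × (Fin n → ℝ)) X' U) (q : Y → X'),
          P'.HasGluing h ∧
          IsFibreProduct (E₁ := E') (E₂ := E × (Fin n → ℝ)) (E₃ := E'')
            P.proj P'.proj Q.proj q ∧
          (∀ s t y, q (D.act (Sum.elim s t) y) = P'.act t (q y)) ∧
          (∀ α y, D.proj y ∈ U α → ∀ j, P'.coord α (q y) j = D.coord α y (Sum.inr j)) := by
  have hh := twistedCoord_sub hΘ hG hQ hN
  have hder := fun α β j m => hasCircleDerivAt_baseGluing (m := m) (α := α) (β := β) hΘ hG hQ hN j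
  have hBs := smoothOn_baseOneForm (G := G) (N := N) hΘ hN
  let D := doubleBundle P Q N hN.locally_const hh
  have hQD : ∀ u y, Q.proj (D.act u y) = P.act (fun j => u (Sum.inl j)) (Q.proj y) := by
    intro u y
    obtain ⟨α, hα⟩ := P.cover (P.proj (Q.proj y))
    exact (congrArg Q.proj (doubleAct_eq hh hα u)).trans (proj_doubleActOn N hα _ _)
  have hD : D.HasGluing
      (fun α β m => Sum.elim (lam α β m) (baseGluing P N lamS α β m)) := by
    intro α β y hα hβ
    funext j
    rcases j with j | j
    · exact congrFun (hlam α β (Q.proj y) hα hβ) j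
    · exact congrFun (hh α β y hα hβ) j
  -- The cocycle identity for `h` is the second half of the one for the gluing functions of `D`, so
  -- it follows from the existence of the coordinates on `Y`.
  let c : TorusCocycle (Fin n) E M U :=
    { isOpen_cover := P.isOpen_cover
      cover := P.cover
      fn := baseGluing P N lamS
      smooth := smoothCircleOn_baseGluing hQ hN
      cocycle := fun α β γ m hα hβ hγ => by
        have h1 := gluing_cocycle hD hα hβ hγ
        exact funext fun j => congrFun h1 (Sum.inr j) }
  refine ⟨baseGluing P N lamS, baseOneForm P Θ G N, smoothCircleOn_baseGluing hQ hN,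
    fun α β x hα hβ => baseGluing_proj hΘ hG hQ hN hα hβ, hBs,
    fun α j x hx => pullback_baseOneForm hΘ hG j hx, hder, D,
    fun j => D.connForm (Sum.inr j) fun α => baseOneForm P Θ G N α j, rfl,
    fun s t y => hQD _ y, ?_, fun α y hy => rfl, hD,
    isConnection_double hΘ hQD hD (fun j α β m => hder α β j m) hBs,
    fun α j y hy => PrincipalTorusBundle.hasCircleDerivAt_coord_connForm hD
      (k := Sum.inr j) (B := fun α => baseOneForm P Θ G N α j)
      (fun α β m => hder α β j m) hy,
    c.Total, inferInstance, inferInstance, inferInstance, inferInstance, inferInstance, c.bundle,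
    dualMap P Q N c.bundle, c.hasGluing_bundle,
    isFibreProduct_dualMap hN.locally_const hh c.hasGluing_bundle,
    dualMap_act hh c.hasGluing_bundle rfl fun _ _ _ _ => rfl, ?_⟩
  · intro t y
    obtain ⟨α, hα⟩ := P.cover (P.proj (Q.proj y))
    have e1 : Q.proj (D.act (Sum.elim 0 t) y) = Q.proj y :=
      (hQD _ y).trans (P.act_zero (Q.proj y))
    have e2 : Q.proj (Q.act t y) = Q.proj y := Q.proj_act t y
    refine eq_of_twistedCoord_eq (P := P) (Q := Q) N (α := α) (by rwa [e1]) (by rw [e1, e2])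
      (by rw [e1, e2]) ?_
    -- With the point of `X` held fixed, `θ̃_α` and `θ_#α` differ by a constant, so the second torus
    -- acts as the structure group of `p`.
    have e3 : twistedCoord P Q N α (D.act (Sum.elim 0 t) y) = t + twistedCoord P Q N α y :=
      (congrArg (twistedCoord P Q N α) (doubleAct_eq hh hα _)).trans
        (twistedCoord_doubleActOn N hα _ _)
    rw [e3, twistedCoord, twistedCoord, e2, Q.coord_act α t y hα, add_sub_assoc]
  · intro α y hy j
    exact congrFun (coord_dualMap hh c.hasGluing_bundle hy) j
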